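/- Conventions. Manifolds are smooth manifolds without boundary modelled on Banach spaces and vector bundles are smooth Banach bundles (finite dimension included). A Lie algebroid $\mathcal A\to B$ has an anchor $\#:\mathcal A\to TB$ (a smooth bundle map) and a Lie bracket on (local) smooth sections with $[\zeta,f\eta]=f[\zeta,\eta]+(\#\zeta\cdot f)\eta$; the algebroid differential $d_{\mathcal A}\xi(\zeta,\eta)=-\xi([\zeta,\eta])+\#\zeta\cdot\xi(\eta)-\#\eta\cdot\xi(\zeta)$ of a smooth $1$-form is required to be a smooth $2$-form on $\mathcal A$ (automatic in finite dimension). It is transitive if $\#$ is surjective on fibres. $\mathcal A^*$ is the dual bundle; in infinite dimension it may be a smooth dual, i.e. any Banach bundle with a smooth nondegenerate fibrewise pairing with $\mathcal A$. Smooth functions on $\mathcal A^*$ are those whose fibrewise differentials $d^Ff$ are smooth maps to $\mathcal A$ (automatic in finite dimension), with the Poisson bracket $$\{f,g\}(\xi)=-d_{\mathcal A}\hat\xi(d^F_\xi f,d^F_\xi g)+\#d^F_\xi f\cdot(g\circ\hat\xi)-\#d^F_\xi g\cdot(f\circ\hat\xi),$$ $\hat\xi$ a section extending $\xi$ (so that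 $\{\zeta,\eta\}=[\zeta,\eta]$ and $\{\zeta,f\}=\#\zeta\cdot f$ for sections $\zeta,\eta$ of $\mathcal A$ and functions $f$ on $B$). Trajectories of a Hamiltonian $h$ are the differentiable curves with $\frac{d}{dt}f(\xi(t))=\{h,f\}(\xi(t))$ for all smooth (local) functions $f$, and the symplectic leaf through a point is the set of points joined to it by finitely many pieces of trajectories of local Hamiltonians. An inertia operator is a smooth invertible symmetric bundle map $\mathcal I:\mathcal A\to\mathcal A^*$; it defines the metric $\langle u,v\rangle_{\mathcal A}=\langle\mathcal I u,v\rangle$, and the Euler–Arnold flow is the Hamiltonian flow on $\mathcal A^*$ of $\mathcal H(\xi)=\frac12\langle\mathcal I^{-1}\xi,\mathcal I^{-1}\xi\rangle_{\mathcal A}$. Let $\#^*(T^*B)$ be the set of those elements of $\mathcal A^*$ that have the form $\#^*p=p\circ\#$ with $p\in T^*B$. A trajectory of the geodesic flow of a (possibly weak) Riemannian metric $g$ on $B$ is a curve $p(t)=g(\dot x(t),\cdot)$ in $T^*B$ with $x(t)$ a geodesic of $g$. Proposition. Let $\mathcal A\to B$ be a transitive Lie algebroid, and let $\langle\,,\rangle_{\mathcal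 A}$ be the positive-definite metric on $\mathcal A$ given by an invertible inertia operator $\mathcal I:\mathcal A\to\mathcal A^*$. Assume that there is an orthogonal decomposition of vector bundles $\mathcal A=\mathrm{Ker}\,\#\oplus(\mathrm{Ker}\,\#)^\perp$ with smooth projections (automatic in finite dimension), and let $\#^{-1}:TB\to(\mathrm{Ker}\,\#)^\perp$ be the inverse of the restriction of $\#$ to $(\mathrm{Ker}\,\#)^\perp$. Then $\langle\zeta,\eta\rangle_B:=\langle\#^{-1}\zeta,\#^{-1}\eta\rangle_{\mathcal A}$ is a smooth (possibly weak) Riemannian metric on $B$, and the following holds. 1. If $B$ is connected, $\#^*(T^*B)$ is a symplectic leaf of $\mathcal A^*$. For every $B$, an Euler–Arnold trajectory (on an open interval) that meets $\#^*(T^*B)$ stays in it; and the pullback to $T^*B$ of the Euler–Arnold flow on $\#^*(T^*B)$ is the geodesic flow of $\langle\,,\rangle_B$: for a curve $p(t)$ in $T^*B$ with $\#^*p(t)\in\mathcal A^*$, defined on an open set of times, $\#^*p(t)$ is an Euler–Arnold trajectory if and only if $p(t)$ is a trajectory of the geodesic flow of $\langle\,,\rangle_B$. 2. The anchor is a Riemannian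 submersion of vector bundles $(\mathcal A,\langle\,,\rangle_{\mathcal A})\to(TB,\langle\,,\rangle_B)$: on each fibre it restricts to a bijective isometry $(\mathrm{Ker}\,\#)^\perp\to TB$. 3. Suppose moreover that $\mathcal A$ is the Lie algebroid of a transitive Lie groupoid $\mathcal G\rightrightarrows B$ (with fibre over $x$ the tangent space at $\mathrm{id}_x$ of the source fibre $\mathcal G_x=\mathrm{src}^{-1}(x)$, anchor the differential of the target map $\mathrm{trg}$, and bracket that of right-invariant vector fields tangent to source fibres), and let $\langle\,,\rangle_{\mathcal G}$ be the right-invariant metric on the source fibres that coincides with $\langle\,,\rangle_{\mathcal A}$ at the identities. Then for every $x\in B$ the map $\mathrm{trg}:(\mathcal G_x,\langle\,,\rangle_{\mathcal G})\to(B,\langle\,,\rangle_B)$ is a Riemannian submersion: it is smooth, its differential at each point is surjective, and it maps the orthogonal complement of the kernel of the differential isometrically onto the tangent space of $B$. -/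

import Mathlib

open Bundle Set
open scoped Manifold ContDiff Topology

noncomputable section EulerArnold

/-! Manifolds are boundaryless smooth manifolds modelled on Banach spaces, and vector bundles are
smooth Banach bundles; finite dimension is a special case. -/

section Base

variable {EB : Type*} [NormedAddCommGroup EB] [NormedSpace ℝ EB]
  {B : Type*} [TopologicalSpace B] [ChartedSpace EB B]

/-- The derivative `v · f` of a function `f` on `B` along a tangent vector `v`. -/
def dirDeriv {x : B} (v : TangentSpace 𝓘(ℝ, EB) x) (f : B → ℝ) : ℝ :=
  mfderiv 𝓘(ℝ, EB) 𝓘(ℝ, ℝ) f x v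

/-- The section `s` of the vector bundle `E` with typical fibre `F` is smooth on `U`. -/
def SmoothSectionOn (EB : Type*) [NormedAddCommGroup EB] [NormedSpace ℝ EB]
    {B : Type*} [TopologicalSpace B] [ChartedSpace EB B]
    (F : Type*) [NormedAddCommGroup F] [NormedSpace ℝ F] {E : B → Type*}
    [TopologicalSpace (TotalSpace F E)] [∀ x, TopologicalSpace (E x)] [FiberBundle F E]
    (s : ∀ x, E x) (U : Set B) : Prop :=
  ContMDiffOn 𝓘(ℝ, EB) (𝓘(ℝ, EB).prod 𝓘(ℝ, F)) ∞ (fun x => TotalSpace.mk' F x (s x)) U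

/-- A smooth Riemannian metric on `B`: a smooth field of symmetric positive definite
bilinear forms on the tangent spaces. In infinite dimension the metric may be weak, that is,
it need not induce the topology of the tangent spaces. -/
structure RiemannMetric (EB : Type*) [NormedAddCommGroup EB] [NormedSpace ℝ EB]
    (B : Type*) [TopologicalSpace B] [ChartedSpace EB B] [IsManifold 𝓘(ℝ, EB) ∞ B] where
  form : ∀ x : B, TangentSpace 𝓘(ℝ, EB) x →L[ℝ] TangentSpace 𝓘(ℝ, EB) x →L[ℝ] ℝ
  symm : ∀ x v w, form x v w = form x w v
  pos : ∀ x v, v ≠ 0 → 0 < form x v v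
  contMDiff : ContMDiff 𝓘(ℝ, EB) (𝓘(ℝ, EB).prod 𝓘(ℝ, EB →L[ℝ] EB →L[ℝ] ℝ)) ∞
    (fun x => TotalSpace.mk' (EB →L[ℝ] EB →L[ℝ] ℝ) x (form x))

/-- The velocity `x'(t)` of a curve in `B`. -/
def curveVelocity (EB : Type*) [NormedAddCommGroup EB] [NormedSpace ℝ EB]
    {B : Type*} [TopologicalSpace B] [ChartedSpace EB B] (x : ℝ → B) (t : ℝ) :
    TangentSpace 𝓘(ℝ, EB) (x t) :=
  mfderiv 𝓘(ℝ, ℝ) 𝓘(ℝ, EB) x t (1 : ℝ)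

/-- The metric `g` read in the chart at `x₀`: a field of bilinear forms on the model space. -/
def RiemannMetric.inChart [IsManifold 𝓘(ℝ, EB) ∞ B] (g : RiemannMetric EB B) (x₀ : B)
    (y v w : EB) : ℝ :=
  g.form ((extChartAt 𝓘(ℝ, EB) x₀).symm y)
    (mfderiv 𝓘(ℝ, EB) 𝓘(ℝ, EB) (extChartAt 𝓘(ℝ, EB) x₀).symm y v)
    (mfderiv 𝓘(ℝ, EB) 𝓘(ℝ, EB) (extChartAt 𝓘(ℝ, EB) x₀).symm y w)

/-- `x` is a geodesic of `g` on `J`: it is twice differentiable, and in charts it satisfies the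
geodesic equation, that is, the Euler-Lagrange equation of the energy
`½ ∫ g(x', x') dt`: `d/dt (g(c', v)) = ½ (∂_v g)(c', c')` for every vector `v` of the
model space, where `c` is `x` read in the chart. -/
structure RiemannMetric.IsGeodesicOn [IsManifold 𝓘(ℝ, EB) ∞ B] (g : RiemannMetric EB B)
    (x : ℝ → B) (J : Set ℝ) : Prop where
  differentiable : ∀ t ∈ J, MDifferentiableAt 𝓘(ℝ, ℝ) 𝓘(ℝ, EB) x t
  differentiable_velocity : ∀ t ∈ J, MDifferentiableAt 𝓘(ℝ, ℝ) 𝓘(ℝ, EB).tangent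
    (fun s => (⟨x s, curveVelocity EB x s⟩ : TangentBundle 𝓘(ℝ, EB) B)) t
  euler_lagrange : ∀ t ∈ J, ∀ v : EB,
    let c : ℝ → EB := fun s => extChartAt 𝓘(ℝ, EB) (x t) (x s)
    HasDerivAt (fun s => g.inChart (x t) (c s) (deriv c s) v)
      (1 / 2 * fderiv ℝ (fun y => g.inChart (x t) y (deriv c t) (deriv c t)) (c t) v) t

/-- The curve `t ↦ (x t, p t)` in `T*B` is a trajectory of the geodesic flow of `g`: `x` is a
geodesic, and `p` is the covector `g(x', ·)` that corresponds to its velocity. -/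
def RiemannMetric.IsGeodesicFlowTrajectory [IsManifold 𝓘(ℝ, EB) ∞ B] (g : RiemannMetric EB B)
    (x : ℝ → B) (p : ∀ t, TangentSpace 𝓘(ℝ, EB) (x t) →L[ℝ] ℝ) (J : Set ℝ) : Prop :=
  g.IsGeodesicOn x J ∧ ∀ t ∈ J, p t = g.form (x t) (curveVelocity EB x t)

end Base

section Algebroid

variable {EB : Type*} [NormedAddCommGroup EB] [NormedSpace ℝ EB]
  {B : Type*} [TopologicalSpace B] [ChartedSpace EB B]
  {F : Type*} [NormedAddCommGroup F] [NormedSpace ℝ F]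
  {A : B → Type*} [∀ x, AddCommGroup (A x)] [∀ x, Module ℝ (A x)] [∀ x, TopologicalSpace (A x)]

/-- The expression `#ζ · ξ(η) - #η · ξ(ζ) - ξ([ζ, η])` at `x` that defines the algebroid
differential of the section `ξ` of the dual bundle, for a given anchor and bracket. -/
def algebroidDifferential (anchor : ∀ x, A x →L[ℝ] TangentSpace 𝓘(ℝ, EB) x)
    (bracket : (∀ x, A x) → (∀ x, A x) → ∀ x, A x)
    (ξ : ∀ x, A x →L[ℝ] ℝ) (ζ η : ∀ x, A x) (x : B) : ℝ :=
  - ξ x (bracket ζ η x) + dirDeriv (anchor x (ζ x)) (fun y => ξ y (η y))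
    - dirDeriv (anchor x (η x)) (fun y => ξ y (ζ y))

variable [∀ x, IsTopologicalAddGroup (A x)] [∀ x, ContinuousSMul ℝ (A x)]
  [TopologicalSpace (TotalSpace F A)] [FiberBundle F A] [VectorBundle ℝ F A]

/-- A Lie algebroid over `B`. The bracket acts on local smooth sections: `bracket` is a total
function, but only its values on sections that are smooth on open sets are meaningful.

The last field says that the algebroid differential of a smooth 1-form is a smooth 2-form, in
particular does not depend on how elements of a fibre are extended to sections. If the bundle and
the base have finite dimension, this follows from the Leibniz rule; in infinite dimension this
is part of the definition, which then says that the bracket is a first-order differential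
operator. -/
structure LieAlgebroid (EB : Type*) [NormedAddCommGroup EB] [NormedSpace ℝ EB]
    {B : Type*} [TopologicalSpace B] [ChartedSpace EB B] [IsManifold 𝓘(ℝ, EB) ∞ B]
    (F : Type*) [NormedAddCommGroup F] [NormedSpace ℝ F]
    (A : B → Type*) [∀ x, AddCommGroup (A x)] [∀ x, Module ℝ (A x)]
    [∀ x, TopologicalSpace (A x)] [∀ x, IsTopologicalAddGroup (A x)]
    [∀ x, ContinuousSMul ℝ (A x)]
    [TopologicalSpace (TotalSpace F A)] [FiberBundle F A] [VectorBundle ℝ F A] where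
  anchor : ∀ x, A x →L[ℝ] TangentSpace 𝓘(ℝ, EB) x
  contMDiff_anchor : ContMDiff 𝓘(ℝ, EB) (𝓘(ℝ, EB).prod 𝓘(ℝ, F →L[ℝ] EB)) ∞
    (fun x => TotalSpace.mk' (F →L[ℝ] EB)
      (E := fun x => A x →L[ℝ] TangentSpace 𝓘(ℝ, EB) x) x (anchor x))
  bracket : (∀ x, A x) → (∀ x, A x) → ∀ x, A x
  smooth_bracket : ∀ (U : Set B), IsOpen U → ∀ ζ η, SmoothSectionOn EB F ζ U →
    SmoothSectionOn EB F η U → SmoothSectionOn EB F (bracket ζ η) U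
  bracket_local : ∀ (U : Set B), IsOpen U → ∀ ζ η ζ' η', SmoothSectionOn EB F ζ U →
    SmoothSectionOn EB F η U → (∀ x ∈ U, ζ x = ζ' x) → (∀ x ∈ U, η x = η' x) →
    ∀ x ∈ U, bracket ζ η x = bracket ζ' η' x
  bracket_skew : ∀ (U : Set B), IsOpen U → ∀ ζ η, SmoothSectionOn EB F ζ U →
    SmoothSectionOn EB F η U → ∀ x ∈ U, bracket ζ η x = - bracket η ζ x
  bracket_add : ∀ (U : Set B), IsOpen U → ∀ ζ η θ, SmoothSectionOn EB F ζ U →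
    SmoothSectionOn EB F η U → SmoothSectionOn EB F θ U →
    ∀ x ∈ U, bracket ζ (fun y => η y + θ y) x = bracket ζ η x + bracket ζ θ x
  jacobi : ∀ (U : Set B), IsOpen U → ∀ ζ η θ, SmoothSectionOn EB F ζ U →
    SmoothSectionOn EB F η U → SmoothSectionOn EB F θ U → ∀ x ∈ U,
    bracket ζ (bracket η θ) x + bracket η (bracket θ ζ) x + bracket θ (bracket ζ η) x = 0
  leibniz : ∀ (U : Set B), IsOpen U → ∀ ζ η, ∀ f : B → ℝ, SmoothSectionOn EB F ζ U →
    SmoothSectionOn EB F η U → ContMDiffOn 𝓘(ℝ, EB) 𝓘(ℝ, ℝ) ∞ f U → ∀ x ∈ U,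
    bracket ζ (fun y => f y • η y) x =
      f x • bracket ζ η x + dirDeriv (anchor x (ζ x)) f • η x
  differential_smooth : ∀ (U : Set B), IsOpen U → ∀ ξ : ∀ x, A x →L[ℝ] ℝ,
    ContMDiffOn 𝓘(ℝ, EB) (𝓘(ℝ, EB).prod 𝓘(ℝ, F →L[ℝ] ℝ)) ∞
      (fun x => TotalSpace.mk' (F →L[ℝ] ℝ) x (ξ x)) U →
    ∃ Ω : ∀ x, A x →L[ℝ] A x →L[ℝ] ℝ,
      ContMDiffOn 𝓘(ℝ, EB) (𝓘(ℝ, EB).prod 𝓘(ℝ, F →L[ℝ] F →L[ℝ] ℝ)) ∞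
        (fun x => TotalSpace.mk' (F →L[ℝ] F →L[ℝ] ℝ) x (Ω x)) U ∧
      ∀ (V : Set B), IsOpen V → V ⊆ U → ∀ ζ η, SmoothSectionOn EB F ζ V →
        SmoothSectionOn EB F η V → ∀ x ∈ V,
        algebroidDifferential anchor bracket ξ ζ η x = Ω x (ζ x) (η x)

/-- A Lie algebroid is transitive if its anchor is surjective. -/
def LieAlgebroid.IsTransitive [IsManifold 𝓘(ℝ, EB) ∞ B] (L : LieAlgebroid EB F A) : Prop :=
  ∀ x, Function.Surjective (L.anchor x)

/-- A realization of the (smooth) dual bundle of `A`: a vector bundle `D` with a smooth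
nondegenerate fibrewise pairing with `A`. In finite dimension, `D` is necessarily the usual dual
bundle; in infinite dimension it may consist of only some of the functionals. -/
structure SmoothDual (EB : Type*) [NormedAddCommGroup EB] [NormedSpace ℝ EB]
    {B : Type*} [TopologicalSpace B] [ChartedSpace EB B]
    (F : Type*) [NormedAddCommGroup F] [NormedSpace ℝ F]
    (A : B → Type*) [∀ x, AddCommGroup (A x)] [∀ x, Module ℝ (A x)]
    [∀ x, TopologicalSpace (A x)] [∀ x, IsTopologicalAddGroup (A x)]
    [∀ x, ContinuousSMul ℝ (A x)]
    [TopologicalSpace (TotalSpace F A)] [FiberBundle F A] [VectorBundle ℝ F A]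
    (FD : Type*) [NormedAddCommGroup FD] [NormedSpace ℝ FD]
    (D : B → Type*) [∀ x, AddCommGroup (D x)] [∀ x, Module ℝ (D x)]
    [∀ x, TopologicalSpace (D x)]
    [TopologicalSpace (TotalSpace FD D)] [FiberBundle FD D] [VectorBundle ℝ FD D] where
  pairing : ∀ x, D x →L[ℝ] A x →L[ℝ] ℝ
  contMDiff_pairing : ContMDiff 𝓘(ℝ, EB) (𝓘(ℝ, EB).prod 𝓘(ℝ, FD →L[ℝ] F →L[ℝ] ℝ)) ∞
    (fun x => TotalSpace.mk' (FD →L[ℝ] F →L[ℝ] ℝ)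
      (E := fun x => D x →L[ℝ] A x →L[ℝ] ℝ) x (pairing x))
  eq_zero_of_left : ∀ x (ξ : D x), (∀ a : A x, pairing x ξ a = 0) → ξ = 0
  eq_zero_of_right : ∀ x (a : A x), (∀ ξ : D x, pairing x ξ a = 0) → a = 0

/-- The usual dual bundle `A*`, with fibres the continuous functionals on the fibres of `A` and
with the evaluation pairing. -/
def SmoothDual.standard (EB : Type*) [NormedAddCommGroup EB] [NormedSpace ℝ EB]
    {B : Type*} [TopologicalSpace B] [ChartedSpace EB B]
    (F : Type*) [NormedAddCommGroup F] [NormedSpace ℝ F]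
    (A : B → Type*) [∀ x, AddCommGroup (A x)] [∀ x, Module ℝ (A x)]
    [∀ x, TopologicalSpace (A x)] [∀ x, IsTopologicalAddGroup (A x)]
    [∀ x, ContinuousSMul ℝ (A x)]
    [TopologicalSpace (TotalSpace F A)] [FiberBundle F A] [VectorBundle ℝ F A] :
    SmoothDual EB F A (F →L[ℝ] ℝ) (fun x => A x →L[ℝ] ℝ) where
  pairing x := ContinuousLinearMap.id ℝ _
  contMDiff_pairing := by
    intro x₀
    rw [contMDiffAt_hom_bundle]
    refine ⟨contMDiffAt_id, ?_⟩
    refine (contMDiffAt_const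
      (c := ContinuousLinearMap.id ℝ (F →L[ℝ] ℝ))).congr_of_eventuallyEq ?_
    filter_upwards [(trivializationAt (F →L[ℝ] ℝ) (fun x => A x →L[ℝ] ℝ)
      x₀).open_baseSet.mem_nhds (FiberBundle.mem_baseSet_trivializationAt' x₀)] with x hx
    ext1 φ
    simp only [ContinuousLinearMap.inCoordinates, ContinuousLinearMap.comp_apply,
      ContinuousLinearMap.id_apply]
    rw [Bundle.Trivialization.continuousLinearMapAt_symmL _ hx]
  eq_zero_of_left x ξ h := by ext a; exact h a
  eq_zero_of_right x a h := by
    by_contra ha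
    let e := (trivializationAt F A x).continuousLinearEquivAt ℝ x
      (FiberBundle.mem_baseSet_trivializationAt' x)
    have hea : ‖e a‖ ≠ 0 := by simpa using ha
    obtain ⟨f, -, hf⟩ := exists_dual_vector ℝ (e a) hea
    have h1 : f (e a) = 0 := h (f.comp (e : A x →L[ℝ] F))
    rw [h1] at hf
    exact hea (by simpa using hf.symm)

variable
  {FD : Type*} [NormedAddCommGroup FD] [NormedSpace ℝ FD]
  {D : B → Type*} [∀ x, AddCommGroup (D x)] [∀ x, Module ℝ (D x)]
  [∀ x, TopologicalSpace (D x)]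
  [TopologicalSpace (TotalSpace FD D)] [FiberBundle FD D] [VectorBundle ℝ FD D]

/-- An element of `A x` that represents the differential at `ξ` of the restriction of `f` to the
fibre through `ξ`; it is unique if it exists. -/
def SmoothDual.fiberDifferential (S : SmoothDual EB F A FD D) (f : TotalSpace FD D → ℝ)
    (ξ : TotalSpace FD D) : A ξ.proj :=
  Classical.epsilon fun a : A ξ.proj => ∀ η : D ξ.proj,
    HasDerivAt (fun t : ℝ => f ⟨ξ.proj, ξ.2 + t • η⟩) (S.pairing ξ.proj η a) 0

/-- `f` is smooth on `W`, and its fibrewise differentials are represented by elements of `A`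
that depend smoothly on the point. In finite dimension the second condition follows from the
first. -/
def SmoothDual.IsSmoothFunctionOn (S : SmoothDual EB F A FD D) (f : TotalSpace FD D → ℝ)
    (W : Set (TotalSpace FD D)) : Prop :=
  ContMDiffOn (𝓘(ℝ, EB).prod 𝓘(ℝ, FD)) 𝓘(ℝ, ℝ) ∞ f W ∧
  ∃ a : ∀ ξ : TotalSpace FD D, A ξ.proj,
    ContMDiffOn (𝓘(ℝ, EB).prod 𝓘(ℝ, FD)) (𝓘(ℝ, EB).prod 𝓘(ℝ, F)) ∞
      (fun ξ => TotalSpace.mk' F ξ.proj (a ξ)) W ∧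
    ∀ ξ ∈ W, ∀ η : D ξ.proj,
      HasDerivAt (fun t : ℝ => f ⟨ξ.proj, ξ.2 + t • η⟩) (S.pairing ξ.proj η (a ξ)) 0

variable [IsManifold 𝓘(ℝ, EB) ∞ B]

/-- The Poisson bracket of functions on the dual of the Lie algebroid `L`,
`{f, g}(ξ) = - d_A ξ̂ (a, b) + #a · (g ∘ ξ̂) - #b · (f ∘ ξ̂)`, where `a` and `b` are the fibrewise
differentials of `f` and `g` at `ξ`, and `ξ̂` is a section that extends `ξ`. The value does not
depend on the extensions of `ξ`, `a` and `b` to sections, and those that are constant in a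
trivialization are used. -/
def LieAlgebroid.poissonBracket (L : LieAlgebroid EB F A) (S : SmoothDual EB F A FD D)
    (f g : TotalSpace FD D → ℝ) (ξ : TotalSpace FD D) : ℝ :=
  let a : A ξ.proj := S.fiberDifferential f ξ
  let b : A ξ.proj := S.fiberDifferential g ξ
  let ξ' : ∀ x, D x := FiberBundle.extend FD ξ.2
  dirDeriv (L.anchor ξ.proj a) (fun x => g ⟨x, ξ' x⟩)
    - dirDeriv (L.anchor ξ.proj b) (fun x => f ⟨x, ξ' x⟩)
    - algebroidDifferential L.anchor L.bracket (fun x => S.pairing x (ξ' x))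
      (FiberBundle.extend F a) (FiberBundle.extend F b) ξ.proj

/-- `γ` is a trajectory on `J` of the Hamiltonian equation with Hamiltonian `h`: it is
differentiable, and `d/dt f(γ(t)) = {h, f}(γ(t))` for all smooth functions `f`. (The sign is the
one for which `{ζ, f} = #ζ · f` for a linear function `ζ` and a function `f` on the base.) -/
def LieAlgebroid.IsHamiltonianTrajectory (L : LieAlgebroid EB F A) (S : SmoothDual EB F A FD D)
    (h : TotalSpace FD D → ℝ) (γ : ℝ → TotalSpace FD D) (J : Set ℝ) : Prop :=
  ∀ t ∈ J, MDifferentiableAt 𝓘(ℝ, ℝ) (𝓘(ℝ, EB).prod 𝓘(ℝ, FD)) γ t ∧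
    ∀ (W : Set (TotalSpace FD D)) (f : TotalSpace FD D → ℝ), IsOpen W → γ t ∈ W →
      S.IsSmoothFunctionOn f W →
      HasDerivAt (fun s => f (γ s)) (L.poissonBracket S h f (γ t)) t

/-- `η` is reached from `ξ` in unit time along a trajectory of a (local) Hamiltonian. -/
def LieAlgebroid.HamiltonianStep (L : LieAlgebroid EB F A) (S : SmoothDual EB F A FD D)
    (ξ η : TotalSpace FD D) : Prop :=
  ∃ (W : Set (TotalSpace FD D)) (h : TotalSpace FD D → ℝ) (J : Set ℝ) (γ : ℝ → TotalSpace FD D),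
    IsOpen W ∧ S.IsSmoothFunctionOn h W ∧ IsOpen J ∧ Icc 0 1 ⊆ J ∧ (∀ t ∈ J, γ t ∈ W) ∧
    L.IsHamiltonianTrajectory S h γ J ∧ γ 0 = ξ ∧ γ 1 = η

/-- The symplectic leaf through `ξ`: the set of points that can be joined to `ξ` by finitely
many pieces of Hamiltonian trajectories. -/
def LieAlgebroid.symplecticLeaf (L : LieAlgebroid EB F A) (S : SmoothDual EB F A FD D)
    (ξ : TotalSpace FD D) : Set (TotalSpace FD D) :=
  {η | Relation.ReflTransGen (L.HamiltonianStep S) ξ η}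

/-- The image `#*(T*B)`: the elements of the dual bundle of the form `#* p = p ∘ #`, where `p` is
a covector on `B`. -/
def LieAlgebroid.dualAnchorImage (L : LieAlgebroid EB F A) (S : SmoothDual EB F A FD D) :
    Set (TotalSpace FD D) :=
  {ξ | ∃ p : TangentSpace 𝓘(ℝ, EB) ξ.proj →L[ℝ] ℝ,
    ∀ a, S.pairing ξ.proj ξ.2 a = p (L.anchor ξ.proj a)}

/-- An inertia operator: a smooth invertible bundle map from `A` to the (smooth) dual bundle that
is symmetric, so that it defines a metric on `A`. -/
structure InertiaOperator (S : SmoothDual EB F A FD D) where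
  toEquiv : ∀ x, A x ≃L[ℝ] D x
  contMDiff : ContMDiff (𝓘(ℝ, EB).prod 𝓘(ℝ, F)) (𝓘(ℝ, EB).prod 𝓘(ℝ, FD)) ∞
    (fun v : TotalSpace F A => TotalSpace.mk' FD v.proj (toEquiv v.proj v.2))
  contMDiff_symm : ContMDiff (𝓘(ℝ, EB).prod 𝓘(ℝ, FD)) (𝓘(ℝ, EB).prod 𝓘(ℝ, F)) ∞
    (fun ξ : TotalSpace FD D => TotalSpace.mk' F ξ.proj ((toEquiv ξ.proj).symm ξ.2))
  symm : ∀ x (u v : A x), S.pairing x (toEquiv x u) v = S.pairing x (toEquiv x v) u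

namespace InertiaOperator

variable {S : SmoothDual EB F A FD D} (I : InertiaOperator S)

/-- The metric `⟨u, v⟩_A = ⟨I u, v⟩`. -/
def metric {x : B} (u v : A x) : ℝ := S.pairing x (I.toEquiv x u) v

/-- The metric is positive definite. -/
def IsPositive : Prop := ∀ x (u : A x), u ≠ 0 → 0 < I.metric u u

/-- The Hamiltonian `½ ⟨ξ, ξ⟩_{A*} = ½ ⟨I⁻¹ ξ, I⁻¹ ξ⟩_A`. -/
def hamiltonian (ξ : TotalSpace FD D) : ℝ :=
  1 / 2 * I.metric ((I.toEquiv ξ.proj).symm ξ.2) ((I.toEquiv ξ.proj).symm ξ.2)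

/-- `γ` is a trajectory on `J` of the groupoid Euler-Arnold flow. -/
def IsEulerArnoldTrajectory (L : LieAlgebroid EB F A) (γ : ℝ → TotalSpace FD D)
    (J : Set ℝ) : Prop :=
  L.IsHamiltonianTrajectory S I.hamiltonian γ J

/-- The orthogonal complement `(Ker #)^⊥` in the fibre over `x`. -/
def horizontal (L : LieAlgebroid EB F A) (x : B) : Set (A x) :=
  {a | ∀ k : A x, L.anchor x k = 0 → I.metric a k = 0}

/-- There is an orthogonal decomposition of vector bundles `A = Ker # ⊕ (Ker #)^⊥`: every element
of a fibre is the sum of an element of `Ker #` and of an element of `(Ker #)^⊥`, and the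
projection to `Ker #` is smooth. -/
def HasOrthogonalDecomposition (L : LieAlgebroid EB F A) : Prop :=
  ∃ P : ∀ x, A x →L[ℝ] A x,
    ContMDiff 𝓘(ℝ, EB) (𝓘(ℝ, EB).prod 𝓘(ℝ, F →L[ℝ] F)) ∞
      (fun x => TotalSpace.mk' (F →L[ℝ] F) (E := fun x => A x →L[ℝ] A x) x (P x)) ∧
    ∀ x (a : A x), L.anchor x (P x a) = 0 ∧ a - P x a ∈ I.horizontal L x

/-- `#⁻¹ : TB → (Ker #)^⊥`, the inverse of the restriction of the anchor to `(Ker #)^⊥`. -/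
def anchorInv (L : LieAlgebroid EB F A) (x : B) : TangentSpace 𝓘(ℝ, EB) x → A x :=
  Function.invFunOn (L.anchor x) (I.horizontal L x)

end InertiaOperator

end Algebroid

section Groupoid

variable {EB : Type*} [NormedAddCommGroup EB] [NormedSpace ℝ EB]
  {B : Type*} [TopologicalSpace B] [ChartedSpace EB B] [IsManifold 𝓘(ℝ, EB) ∞ B]
  {EG : Type*} [NormedAddCommGroup EG] [NormedSpace ℝ EG]
  {G : Type*} [TopologicalSpace G] [ChartedSpace EG G] [IsManifold 𝓘(ℝ, EG) ∞ G]

/-- A Lie groupoid `G` over `B`. The product is a total function of which only the values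
`mul g h` with `src g = trg h` are meaningful. -/
structure LieGroupoid (EB : Type*) [NormedAddCommGroup EB] [NormedSpace ℝ EB]
    (B : Type*) [TopologicalSpace B] [ChartedSpace EB B] [IsManifold 𝓘(ℝ, EB) ∞ B]
    (EG : Type*) [NormedAddCommGroup EG] [NormedSpace ℝ EG]
    (G : Type*) [TopologicalSpace G] [ChartedSpace EG G] [IsManifold 𝓘(ℝ, EG) ∞ G] where
  src : G → B
  trg : G → B
  mul : G → G → G
  one : B → G
  inv : G → G
  src_mul : ∀ g h, src g = trg h → src (mul g h) = src h
  trg_mul : ∀ g h, src g = trg h → trg (mul g h) = trg g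
  mul_assoc : ∀ g h k, src g = trg h → src h = trg k → mul g (mul h k) = mul (mul g h) k
  src_one : ∀ x, src (one x) = x
  trg_one : ∀ x, trg (one x) = x
  one_mul : ∀ g, mul (one (trg g)) g = g
  mul_one : ∀ g, mul g (one (src g)) = g
  src_inv : ∀ g, src (inv g) = trg g
  trg_inv : ∀ g, trg (inv g) = src g
  inv_mul : ∀ g, mul (inv g) g = one (src g)
  mul_inv : ∀ g, mul g (inv g) = one (trg g)
  submersion_src : ∀ g, Manifold.IsSubmersionAt 𝓘(ℝ, EG) 𝓘(ℝ, EB) ∞ src g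
  submersion_trg : ∀ g, Manifold.IsSubmersionAt 𝓘(ℝ, EG) 𝓘(ℝ, EB) ∞ trg g
  contMDiff_mul : ContMDiffOn (𝓘(ℝ, EG).prod 𝓘(ℝ, EG)) 𝓘(ℝ, EG) ∞
    (fun q : G × G => mul q.1 q.2) {q | src q.1 = trg q.2}
  contMDiff_one : ContMDiff 𝓘(ℝ, EB) 𝓘(ℝ, EG) ∞ one
  contMDiff_inv : ContMDiff 𝓘(ℝ, EG) 𝓘(ℝ, EG) ∞ inv

namespace LieGroupoid

variable (𝒢 : LieGroupoid EB B EG G)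

/-- A groupoid is transitive if any two objects are joined by an arrow. -/
def IsTransitive : Prop := ∀ x y, ∃ g, 𝒢.src g = x ∧ 𝒢.trg g = y

/-- The source fibre `G_x`, a submanifold of `G`. -/
def sourceFiber (x : B) : Set G := {g | 𝒢.src g = x}

/-- The tangent space at `g` to the source fibre through `g`. -/
def sourceTangent (g : G) : Submodule ℝ (TangentSpace 𝓘(ℝ, EG) g) :=
  LinearMap.ker (mfderiv 𝓘(ℝ, EG) 𝓘(ℝ, EB) 𝒢.src g).toLinearMap

/-- The differential at `h` of the right translation `G_(trg k) → G_(src k)`, `h ↦ h k`. It is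
meaningful on vectors tangent to the source fibre through `h`. -/
def rightTranslate (k h : G) :
    TangentSpace 𝓘(ℝ, EG) h →L[ℝ] TangentSpace 𝓘(ℝ, EG) (𝒢.mul h k) :=
  mfderivWithin 𝓘(ℝ, EG) 𝓘(ℝ, EG) (fun h' => 𝒢.mul h' k) (𝒢.sourceFiber (𝒢.trg k)) h

variable
  {F : Type*} [NormedAddCommGroup F] [NormedSpace ℝ F]
  {A : B → Type*} [∀ x, AddCommGroup (A x)] [∀ x, Module ℝ (A x)] [∀ x, TopologicalSpace (A x)]

/-- Given identifications `φ` of the fibres of `A` with the tangent spaces to the source fibres at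
the identities, the right-invariant vector field on `G` that extends the section `ζ`. -/
def rightInvariantField (φ : ∀ x, A x →L[ℝ] TangentSpace 𝓘(ℝ, EG) (𝒢.one x))
    (ζ : ∀ x, A x) (g : G) : TangentSpace 𝓘(ℝ, EG) g :=
  (𝒢.one_mul g) ▸ 𝒢.rightTranslate g (𝒢.one (𝒢.trg g)) (φ (𝒢.trg g) (ζ (𝒢.trg g)))

variable [∀ x, IsTopologicalAddGroup (A x)] [∀ x, ContinuousSMul ℝ (A x)]
  [TopologicalSpace (TotalSpace F A)] [FiberBundle F A] [VectorBundle ℝ F A]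

/-- The Lie algebroid `L` corresponds to the Lie groupoid: an identification of `L` with the
algebroid of the groupoid, whose fibre over `x` is the tangent space to the source fibre at
`id_x`, whose anchor is the differential of the target map, and whose bracket is the Lie bracket
of right-invariant vector fields. -/
structure AlgebroidIdentification (𝒢 : LieGroupoid EB B EG G) (L : LieAlgebroid EB F A) where
  toFun : ∀ x, A x →L[ℝ] TangentSpace 𝓘(ℝ, EG) (𝒢.one x)
  injective : ∀ x, Function.Injective (toFun x)
  range_eq : ∀ x, Set.range (toFun x) = (𝒢.sourceTangent (𝒢.one x) : Set _)
  contMDiff : ContMDiff (𝓘(ℝ, EB).prod 𝓘(ℝ, F)) 𝓘(ℝ, EG).tangent ∞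
    (fun v : TotalSpace F A =>
      (⟨𝒢.one v.proj, toFun v.proj v.2⟩ : TangentBundle 𝓘(ℝ, EG) G))
  anchor_eq : ∀ x (a : A x),
    mfderiv 𝓘(ℝ, EG) 𝓘(ℝ, EB) 𝒢.trg (𝒢.one x) (toFun x a) = (𝒢.trg_one x).symm ▸ L.anchor x a
  bracket_eq : ∀ (U : Set B), IsOpen U → ∀ ζ η, SmoothSectionOn EB F ζ U →
    SmoothSectionOn EB F η U → ∀ x ∈ U,
    VectorField.mlieBracket 𝓘(ℝ, EG) (𝒢.rightInvariantField toFun ζ)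
      (𝒢.rightInvariantField toFun η) (𝒢.one x) = toFun x (L.bracket ζ η x)

variable {𝒢} {L : LieAlgebroid EB F A} (Φ : AlgebroidIdentification 𝒢 L)

/-- The element of `A` over `trg g` that corresponds to a vector `v` tangent to a source fibre at
`g`: the right translate of `v` to the identity at `trg g`, read in `A`. -/
def AlgebroidIdentification.toAlgebroid (g : G) (v : TangentSpace 𝓘(ℝ, EG) g) : A (𝒢.trg g) :=
  Function.invFun (Φ.toFun (𝒢.trg g))
    ((𝒢.mul_inv g) ▸ 𝒢.rightTranslate (𝒢.inv g) g v)

variable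
  {FD : Type*} [NormedAddCommGroup FD] [NormedSpace ℝ FD]
  {D : B → Type*} [∀ x, AddCommGroup (D x)] [∀ x, Module ℝ (D x)]
  [∀ x, TopologicalSpace (D x)]
  [TopologicalSpace (TotalSpace FD D)] [FiberBundle FD D] [VectorBundle ℝ FD D]
  {S : SmoothDual EB F A FD D}

/-- The right-invariant source-wise metric on `G` that corresponds to the metric on `A`. -/
def AlgebroidIdentification.sourceMetric (I : InertiaOperator S) (g : G)
    (v w : TangentSpace 𝓘(ℝ, EG) g) : ℝ :=
  I.metric (Φ.toAlgebroid g v) (Φ.toAlgebroid g w)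

/-- The horizontal space at `g` of the target map on the source fibre through `g`: the vectors
tangent to the source fibre that are orthogonal to the kernel of the differential of the target
map. -/
def AlgebroidIdentification.horizontal (I : InertiaOperator S) (g : G) :
    Set (TangentSpace 𝓘(ℝ, EG) g) :=
  {v | v ∈ 𝒢.sourceTangent g ∧ ∀ k ∈ 𝒢.sourceTangent g,
    mfderiv 𝓘(ℝ, EG) 𝓘(ℝ, EB) 𝒢.trg g k = 0 → Φ.sourceMetric I g v k = 0}

/-- The target map from the source fibre `G_x`, with the source-wise metric, to `B`, with the
metric `gB`, is a Riemannian submersion: it is smooth, its differential is surjective, and it maps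
the horizontal spaces isometrically onto the tangent spaces of `B`. -/
structure AlgebroidIdentification.IsRiemannianSubmersionTrg (I : InertiaOperator S)
    (gB : RiemannMetric EB B) (x : B) : Prop where
  contMDiffOn : ContMDiffOn 𝓘(ℝ, EG) 𝓘(ℝ, EB) ∞ 𝒢.trg (𝒢.sourceFiber x)
  surjective : ∀ g ∈ 𝒢.sourceFiber x, ∀ ζ : TangentSpace 𝓘(ℝ, EB) (𝒢.trg g),
    ∃ v ∈ 𝒢.sourceTangent g, mfderiv 𝓘(ℝ, EG) 𝓘(ℝ, EB) 𝒢.trg g v = ζ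
  bijOn : ∀ g ∈ 𝒢.sourceFiber x,
    BijOn (mfderiv 𝓘(ℝ, EG) 𝓘(ℝ, EB) 𝒢.trg g) (Φ.horizontal I g) univ
  isometry : ∀ g ∈ 𝒢.sourceFiber x, ∀ v ∈ Φ.horizontal I g, ∀ w ∈ Φ.horizontal I g,
    gB.form (𝒢.trg g) (mfderiv 𝓘(ℝ, EG) 𝓘(ℝ, EB) 𝒢.trg g v)
      (mfderiv 𝓘(ℝ, EG) 𝓘(ℝ, EB) 𝒢.trg g w) = Φ.sourceMetric I g v w

end LieGroupoid

end Groupoid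

end EulerArnold

/-! The orthogonal complement of `Ker #` supplies a smooth right inverse `#⁻¹` of the anchor, so
`#*(T*B)` is the annihilator of `Ker #`. The bracket of any section with a section of `Ker #` is
again a section of `Ker #`; hence along a Hamiltonian trajectory the pairings with `Ker #` solve a
homogeneous linear differential equation, and vanish identically once they vanish at one time.
Conversely, the Hamiltonian flows of functions on `B` translate the fibres of `#*(T*B)` by `#* dp`,
and those of fibrewise linear functions `#⁻¹ X` move the base point along the vector field `X`;
over a connected base the two together reach every point.

On `#*(T*B)` the Euler–Arnold Hamiltonian is the kinetic energy of `⟨ , ⟩_B`. Testing Hamilton's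
equations on the lifts `#⁻¹ X` of constant chart fields, whose brackets lie in `Ker #` and hence
pair to zero with `#*(T*B)`, turns them into the Euler–Lagrange equations of that energy. For a
groupoid, right translation identifies the tangent spaces of the source fibres with the fibres of
`A` and the differential of the target map with the anchor. -/

section DirectionalDerivative

variable {EB : Type*} [NormedAddCommGroup EB] [NormedSpace ℝ EB]
  {B : Type*} [TopologicalSpace B] [ChartedSpace EB B]

theorem dirDeriv_congr {x : B} (v : TangentSpace 𝓘(ℝ, EB) x) {f g : B → ℝ} (h : f =ᶠ[𝓝 x] g) :
    dirDeriv v f = dirDeriv v g := by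
  rw [dirDeriv, dirDeriv, h.mfderiv_eq]; rfl

theorem dirDeriv_zero_left (x : B) (f : B → ℝ) :
    dirDeriv (0 : TangentSpace 𝓘(ℝ, EB) x) f = 0 := map_zero _

theorem dirDeriv_const {x : B} (v : TangentSpace 𝓘(ℝ, EB) x) (c : ℝ) :
    dirDeriv v (fun _ : B => c) = 0 := by
  rw [dirDeriv, mfderiv_const]; rfl

theorem dirDeriv_sub {x : B} (v : TangentSpace 𝓘(ℝ, EB) x) {f g : B → ℝ}
    (hf : MDifferentiableAt 𝓘(ℝ, EB) 𝓘(ℝ, ℝ) f x) (hg : MDifferentiableAt 𝓘(ℝ, EB) 𝓘(ℝ, ℝ) g x) :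
    dirDeriv v (fun y => f y - g y) = dirDeriv v f - dirDeriv v g :=
  DFunLike.congr_fun (hf.hasMFDerivAt.sub hg.hasMFDerivAt).mfderiv v

theorem dirDeriv_const_mul {x : B} (v : TangentSpace 𝓘(ℝ, EB) x) {f : B → ℝ} (c : ℝ)
    (hf : MDifferentiableAt 𝓘(ℝ, EB) 𝓘(ℝ, ℝ) f x) :
    dirDeriv v (fun y => c * f y) = c * dirDeriv v f :=
  DFunLike.congr_fun (hf.hasMFDerivAt.const_smul c).mfderiv v

theorem dirDeriv_clm_comp {V : Type*} [NormedAddCommGroup V] [NormedSpace ℝ V] {x : B}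
    (v : TangentSpace 𝓘(ℝ, EB) x) {k : B → V} (hk : MDifferentiableAt 𝓘(ℝ, EB) 𝓘(ℝ, V) k x)
    (l : V →L[ℝ] ℝ) :
    dirDeriv v (fun y => l (k y)) = l (mfderiv 𝓘(ℝ, EB) 𝓘(ℝ, V) k x v) :=
  DFunLike.congr_fun ((l.hasMFDerivAt (x := k x)).comp x hk.hasMFDerivAt).mfderiv v

theorem hasDerivAt_comp_curve {EM : Type*} [NormedAddCommGroup EM] [NormedSpace ℝ EM]
    {HM : Type*} [TopologicalSpace HM] {IM : ModelWithCorners ℝ EM HM}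
    {M : Type*} [TopologicalSpace M] [ChartedSpace HM M]
    {V : Type*} [NormedAddCommGroup V] [NormedSpace ℝ V]
    {g : M → V} {γ : ℝ → M} {t : ℝ} (hg : MDifferentiableAt IM 𝓘(ℝ, V) g (γ t))
    (hγ : MDifferentiableAt 𝓘(ℝ, ℝ) IM γ t) :
    HasDerivAt (fun s => g (γ s)) (mfderiv IM 𝓘(ℝ, V) g (γ t) (mfderiv 𝓘(ℝ, ℝ) IM γ t (1 : ℝ)))
      t := by
  have h : HasFDerivAt (fun s => g (γ s)) (show ℝ →L[ℝ] V from
      (mfderiv IM 𝓘(ℝ, V) g (γ t)).comp (mfderiv 𝓘(ℝ, ℝ) IM γ t)) t :=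
    (hg.hasMFDerivAt.comp t hγ.hasMFDerivAt).hasFDerivAt
  exact h.hasDerivAt

variable [IsManifold 𝓘(ℝ, EB) ∞ B]

theorem eq_of_forall_dirDeriv_eq {x : B} {u v : TangentSpace 𝓘(ℝ, EB) x}
    (h : ∀ (U : Set B) (f : B → ℝ), IsOpen U → x ∈ U → ContMDiffOn 𝓘(ℝ, EB) 𝓘(ℝ, ℝ) ∞ f U →
      dirDeriv u f = dirDeriv v f) : u = v := by
  have hx := mem_chart_source EB x
  refine (isInvertible_mfderiv_extChartAt (mem_extChartAt_source (I := 𝓘(ℝ, EB)) x)).injective ?_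
  refine (SeparatingDual.eq_iff_forall_dual_eq (R := ℝ) (V := EB)).2 fun ℓ => ?_
  have hℓ := h _ (fun y => ℓ (extChartAt 𝓘(ℝ, EB) x y)) (chartAt EB x).open_source hx
    (ℓ.contMDiff.comp_contMDiffOn contMDiffOn_extChartAt)
  rwa [dirDeriv_clm_comp u (mdifferentiableAt_extChartAt hx),
    dirDeriv_clm_comp v (mdifferentiableAt_extChartAt hx)] at hℓ

theorem contMDiffOn_mfderiv_apply
    {EM : Type*} [NormedAddCommGroup EM] [NormedSpace ℝ EM] {HM : Type*} [TopologicalSpace HM]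
    {IM : ModelWithCorners ℝ EM HM} {M : Type*} [TopologicalSpace M] [ChartedSpace HM M]
    {V : Type*} [NormedAddCommGroup V] [NormedSpace ℝ V]
    {f : B → V} {U : Set B} (hU : IsOpen U) (hf : ContMDiffOn 𝓘(ℝ, EB) 𝓘(ℝ, V) ∞ f U)
    {b : M → B} {v : ∀ m, TangentSpace 𝓘(ℝ, EB) (b m)} {s : Set M} (hb : MapsTo b s U)
    (hv : ContMDiffOn IM (𝓘(ℝ, EB).prod 𝓘(ℝ, EB)) ∞
      (fun m => (⟨b m, v m⟩ : TangentBundle 𝓘(ℝ, EB) B)) s) :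
    ContMDiffOn IM 𝓘(ℝ, V) ∞ (fun m => (mfderiv 𝓘(ℝ, EB) 𝓘(ℝ, V) f (b m) (v m) : V)) s := by
  have htangent : ContMDiffOn IM 𝓘(ℝ, V).tangent ∞
      (fun m => tangentMapWithin 𝓘(ℝ, EB) 𝓘(ℝ, V) f U ⟨b m, v m⟩) s :=
    (hf.contMDiffOn_tangentMapWithin (m := ∞) (by simp) hU.uniqueMDiffOn).comp hv
      fun m hm => by simpa using hb hm
  refine ((contMDiff_snd_tangentBundle_modelSpace V 𝓘(ℝ, V)).comp_contMDiffOn htangent).congr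
    fun m hm => ?_
  simp only [Function.comp, tangentMapWithin]
  rw [mfderivWithin_of_isOpen hU (hb hm)]

end DirectionalDerivative

section FiberCritical

variable {EB : Type*} [NormedAddCommGroup EB] [NormedSpace ℝ EB]
  {B : Type*} [TopologicalSpace B] [ChartedSpace EB B]
  {F : Type*} [NormedAddCommGroup F] [NormedSpace ℝ F]
  {E : B → Type*} [∀ x, TopologicalSpace (E x)]
  [TopologicalSpace (TotalSpace F E)] [FiberBundle F E]

theorem SmoothSectionOn.mdifferentiableAt {s : ∀ x, E x} {U : Set B} (hU : IsOpen U)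
    (hs : SmoothSectionOn EB F s U) {x : B} (hx : x ∈ U) :
    MDifferentiableAt 𝓘(ℝ, EB) (𝓘(ℝ, EB).prod 𝓘(ℝ, F)) (fun x => TotalSpace.mk' F x (s x)) x :=
  ((hs x hx).contMDiffAt (hU.mem_nhds hx)).mdifferentiableAt (by simp)

theorem SmoothSectionOn.contMDiffOn_comp_proj
    {F' : Type*} [NormedAddCommGroup F'] [NormedSpace ℝ F']
    {E' : B → Type*} [∀ x, TopologicalSpace (E' x)] [TopologicalSpace (TotalSpace F' E')]
    [FiberBundle F' E'] {s : ∀ x, E x} {U : Set B} (hs : SmoothSectionOn EB F s U) :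
    ContMDiffOn (𝓘(ℝ, EB).prod 𝓘(ℝ, F')) (𝓘(ℝ, EB).prod 𝓘(ℝ, F)) ∞
      (fun ξ : TotalSpace F' E' => TotalSpace.mk' F ξ.proj (s ξ.proj)) (π F' E' ⁻¹' U) :=
  ContMDiffOn.comp hs (Bundle.contMDiff_proj E').contMDiffOn (fun _ h => h)

theorem mfderiv_proj_mfderiv_section {s : ∀ x, E x} {x : B}
    (hs : MDifferentiableAt 𝓘(ℝ, EB) (𝓘(ℝ, EB).prod 𝓘(ℝ, F))
      (fun x => TotalSpace.mk' F x (s x)) x) (v : TangentSpace 𝓘(ℝ, EB) x) :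
    mfderiv (𝓘(ℝ, EB).prod 𝓘(ℝ, F)) 𝓘(ℝ, EB) (π F E) (TotalSpace.mk' F x (s x))
      (mfderiv 𝓘(ℝ, EB) (𝓘(ℝ, EB).prod 𝓘(ℝ, F)) (fun x => TotalSpace.mk' F x (s x)) x v) = v := by
  have hπ : MDifferentiableAt (𝓘(ℝ, EB).prod 𝓘(ℝ, F)) 𝓘(ℝ, EB) (π F E)
      (TotalSpace.mk' F x (s x)) :=
    (Bundle.contMDiff_proj (n := ∞) E).mdifferentiableAt (by simp)
  exact DFunLike.congr_fun (hasMFDerivAt_unique (hπ.hasMFDerivAt.comp x hs.hasMFDerivAt)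
    (hasMFDerivAt_id x)) v

theorem mdifferentiableAt_comp_section {g : TotalSpace F E → ℝ} {ξ : TotalSpace F E}
    (hg : MDifferentiableAt (𝓘(ℝ, EB).prod 𝓘(ℝ, F)) 𝓘(ℝ, ℝ) g ξ)
    {s : ∀ x, E x} (hs : MDifferentiableAt 𝓘(ℝ, EB) (𝓘(ℝ, EB).prod 𝓘(ℝ, F))
      (fun x => TotalSpace.mk' F x (s x)) ξ.proj) (hsξ : s ξ.proj = ξ.2) :
    MDifferentiableAt 𝓘(ℝ, EB) 𝓘(ℝ, ℝ) (fun x => g ⟨x, s x⟩) ξ.proj := by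
  have hg' : MDifferentiableAt (𝓘(ℝ, EB).prod 𝓘(ℝ, F)) 𝓘(ℝ, ℝ) g ⟨ξ.proj, s ξ.proj⟩ := by
    rwa [hsξ]
  exact MDifferentiableAt.comp (g := g) (f := fun x => TotalSpace.mk' F x (s x)) ξ.proj hg' hs

variable [∀ x, AddCommGroup (E x)] [∀ x, Module ℝ (E x)]

/-- The derivatives of `g` at `ξ` along the fibre through `ξ` vanish. First-order behaviour of such
a function at `ξ` only depends on the motion of the base point. -/
def IsFiberCriticalAt (g : TotalSpace F E → ℝ) (ξ : TotalSpace F E) : Prop :=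
  ∀ η : E ξ.proj, HasDerivAt (fun t : ℝ => g ⟨ξ.proj, ξ.2 + t • η⟩) 0 0

theorem trivialization_symm_add_smul (e : Trivialization F (π F E)) [e.IsLinear ℝ] {x : B}
    (hx : x ∈ e.baseSet) (ξ : E x) (t : ℝ) (w : F) :
    e.toOpenPartialHomeomorph.symm (x, (e ⟨x, ξ⟩).2 + t • w) = ⟨x, ξ + t • e.symm x w⟩ := by
  rw [← e.mk_symm hx]
  congr 1
  have hξ : e.symm x (e ⟨x, ξ⟩).2 = ξ := e.symm_apply_apply_mk hx ξ
  have hsymmL := fun z => (e.symmL_apply (R := ℝ) hx z).symm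
  rw [hsymmL, map_add, map_smul, ← hsymmL, ← hsymmL, hξ]

variable [VectorBundle ℝ F E]

theorem contMDiffWithinAt_mk_trivialization_symm [ContMDiffVectorBundle ∞ F E 𝓘(ℝ, EB)]
    {EM : Type*} [NormedAddCommGroup EM] [NormedSpace ℝ EM] {HM : Type*} [TopologicalSpace HM]
    {IM : ModelWithCorners ℝ EM HM} {M : Type*} [TopologicalSpace M] [ChartedSpace HM M]
    {e : Trivialization F (π F E)} [MemTrivializationAtlas e]
    {b : M → B} {w : M → F} {s : Set M} {m₀ : M}
    (hb : ContMDiffWithinAt IM 𝓘(ℝ, EB) ∞ b s m₀) (hw : ContMDiffWithinAt IM 𝓘(ℝ, F) ∞ w s m₀)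
    (hm₀ : b m₀ ∈ e.baseSet) :
    ContMDiffWithinAt IM (𝓘(ℝ, EB).prod 𝓘(ℝ, F)) ∞
      (fun m => TotalSpace.mk' F (b m) (e.symm (b m) (w m))) s m₀ := by
  have hsymm : ContMDiffAt (𝓘(ℝ, EB).prod 𝓘(ℝ, F)) (𝓘(ℝ, EB).prod 𝓘(ℝ, F)) ∞
      e.toOpenPartialHomeomorph.symm (b m₀, w m₀) :=
    (e.contMDiffOn_symm (IB := 𝓘(ℝ, EB)) (n := ∞)).contMDiffAt
      (e.open_target.mem_nhds (e.mem_target.2 hm₀))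
  refine (hsymm.comp_contMDiffWithinAt m₀ (hb.prodMk hw)).congr_of_eventuallyEq ?_
    (e.mk_symm hm₀ (w m₀))
  filter_upwards [hb.continuousWithinAt.preimage_mem_nhdsWithin (e.open_baseSet.mem_nhds hm₀)]
    with m hm using e.mk_symm hm (w m)

theorem smoothSectionOn_trivialization_symm [ContMDiffVectorBundle ∞ F E 𝓘(ℝ, EB)]
    (e : Trivialization F (π F E)) [MemTrivializationAtlas e] (w : F) :
    SmoothSectionOn EB F (fun x => e.symm x w) e.baseSet := fun _ hx =>
  contMDiffWithinAt_mk_trivialization_symm contMDiffWithinAt_id contMDiffWithinAt_const hx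

theorem smoothSectionOn_extend [ContMDiffVectorBundle ∞ F E 𝓘(ℝ, EB)] {x : B} (v : E x) :
    SmoothSectionOn EB F (FiberBundle.extend F v) (trivializationAt F E x).baseSet :=
  smoothSectionOn_trivialization_symm _ _

theorem exists_smoothSectionOn_apply_eq [ContMDiffVectorBundle ∞ F E 𝓘(ℝ, EB)] {x : B} (v : E x) :
    ∃ U : Set B, IsOpen U ∧ x ∈ U ∧ ∃ s : ∀ x, E x, SmoothSectionOn EB F s U ∧ s x = v :=
  ⟨_, (trivializationAt F E x).open_baseSet, FiberBundle.mem_baseSet_trivializationAt' x,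
    FiberBundle.extend F v, smoothSectionOn_extend v, FiberBundle.extend_apply_self F v⟩

section Trivialization

variable [ContMDiffVectorBundle ∞ F E 𝓘(ℝ, EB)] {ξ : TotalSpace F E}
  {e : Trivialization F (π F E)} [MemTrivializationAtlas e]

theorem mdifferentiableAt_trivialization (hξ : ξ ∈ e.source) :
    MDifferentiableAt (𝓘(ℝ, EB).prod 𝓘(ℝ, F)) (𝓘(ℝ, EB).prod 𝓘(ℝ, F)) e ξ :=
  (e.contMDiffOn (IB := 𝓘(ℝ, EB)) (n := ∞)).contMDiffAt
    (e.open_source.mem_nhds hξ) |>.mdifferentiableAt (by simp)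

theorem mdifferentiableAt_comp_trivialization_symm {g : TotalSpace F E → ℝ}
    (hg : MDifferentiableAt (𝓘(ℝ, EB).prod 𝓘(ℝ, F)) 𝓘(ℝ, ℝ) g ξ) (hξ : ξ ∈ e.source) :
    MDifferentiableAt (𝓘(ℝ, EB).prod 𝓘(ℝ, F)) 𝓘(ℝ, ℝ)
      (fun q => g (e.toOpenPartialHomeomorph.symm q)) (e ξ) := by
  have hsymm : MDifferentiableAt (𝓘(ℝ, EB).prod 𝓘(ℝ, F)) (𝓘(ℝ, EB).prod 𝓘(ℝ, F))
      e.toOpenPartialHomeomorph.symm (e ξ) :=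
    (e.contMDiffOn_symm (IB := 𝓘(ℝ, EB)) (n := ∞)).contMDiffAt
      (e.open_target.mem_nhds (e.map_source hξ)) |>.mdifferentiableAt (by simp)
  rw [← e.left_inv hξ] at hg
  exact hg.comp (e ξ) hsymm

theorem mfderiv_eq_mfderiv_comp_trivialization_symm {g : TotalSpace F E → ℝ}
    (hg : MDifferentiableAt (𝓘(ℝ, EB).prod 𝓘(ℝ, F)) 𝓘(ℝ, ℝ) g ξ) (hξ : ξ ∈ e.source)
    (u : TangentSpace (𝓘(ℝ, EB).prod 𝓘(ℝ, F)) ξ) :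
    mfderiv (𝓘(ℝ, EB).prod 𝓘(ℝ, F)) 𝓘(ℝ, ℝ) g ξ u =
      mfderiv (𝓘(ℝ, EB).prod 𝓘(ℝ, F)) 𝓘(ℝ, ℝ) (fun q => g (e.toOpenPartialHomeomorph.symm q)) (e ξ)
        (mfderiv (𝓘(ℝ, EB).prod 𝓘(ℝ, F)) (𝓘(ℝ, EB).prod 𝓘(ℝ, F)) e ξ u) := by
  have heq : g =ᶠ[𝓝 ξ] fun ζ => g (e.toOpenPartialHomeomorph.symm (e ζ)) := by
    filter_upwards [e.open_source.mem_nhds hξ] with ζ hζ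
    exact congrArg g (e.left_inv hζ).symm
  have hcomp := (mdifferentiableAt_comp_trivialization_symm hg hξ).hasMFDerivAt.comp ξ
    (mdifferentiableAt_trivialization hξ).hasMFDerivAt
  exact DFunLike.congr_fun (hcomp.congr_of_eventuallyEq heq).mfderiv u

theorem fst_mfderiv_trivialization (hξ : ξ ∈ e.source)
    (u : TangentSpace (𝓘(ℝ, EB).prod 𝓘(ℝ, F)) ξ) :
    (mfderiv (𝓘(ℝ, EB).prod 𝓘(ℝ, F)) (𝓘(ℝ, EB).prod 𝓘(ℝ, F)) e ξ u : EB × F).1 =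
      mfderiv (𝓘(ℝ, EB).prod 𝓘(ℝ, F)) 𝓘(ℝ, EB) (π F E) ξ u := by
  have hfst := (hasMFDerivAt_fst (I := 𝓘(ℝ, EB)) (I' := 𝓘(ℝ, F)) (e ξ)).comp ξ
    (mdifferentiableAt_trivialization hξ).hasMFDerivAt
  have heq : π F E =ᶠ[𝓝 ξ] fun ζ => (e ζ).1 := by
    filter_upwards [e.open_source.mem_nhds hξ] with ζ hζ
    exact (e.coe_fst hζ).symm
  exact (DFunLike.congr_fun (hfst.congr_of_eventuallyEq heq).mfderiv u).symm

end Trivialization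

variable [ContMDiffVectorBundle ∞ F E 𝓘(ℝ, EB)] {g : TotalSpace F E → ℝ} {ξ : TotalSpace F E}

theorem IsFiberCriticalAt.mfderiv_eq_zero (hv : IsFiberCriticalAt g ξ)
    (hg : MDifferentiableAt (𝓘(ℝ, EB).prod 𝓘(ℝ, F)) 𝓘(ℝ, ℝ) g ξ)
    {u : TangentSpace (𝓘(ℝ, EB).prod 𝓘(ℝ, F)) ξ}
    (hu : mfderiv (𝓘(ℝ, EB).prod 𝓘(ℝ, F)) 𝓘(ℝ, EB) (π F E) ξ u = 0) :
    mfderiv (𝓘(ℝ, EB).prod 𝓘(ℝ, F)) 𝓘(ℝ, ℝ) g ξ u = 0 := by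
  set e := trivializationAt F E ξ.proj
  have hx : ξ.proj ∈ e.baseSet := FiberBundle.mem_baseSet_trivializationAt' ξ.proj
  have hξ : ξ ∈ e.source := e.mem_source.2 hx
  have hG := mdifferentiableAt_comp_trivialization_symm hg hξ
  rw [mfderiv_eq_mfderiv_comp_trivialization_symm hg hξ, mfderiv_prod_eq_add_apply hG,
    fst_mfderiv_trivialization hξ, hu]
  set w : F := (mfderiv (𝓘(ℝ, EB).prod 𝓘(ℝ, F)) (𝓘(ℝ, EB).prod 𝓘(ℝ, F)) e ξ u : EB × F).2
  have hfiber : MDifferentiableAt 𝓘(ℝ, F) 𝓘(ℝ, ℝ)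
      (fun z => g (e.toOpenPartialHomeomorph.symm ((e ξ).1, z))) (e ξ).2 :=
    MDifferentiableAt.comp (f := fun z => ((e ξ).1, z)) (e ξ).2 hG
      (mdifferentiableAt_const.prodMk mdifferentiableAt_id)
  have hline := hfiber.differentiableAt.hasFDerivAt.hasLineDerivAt w
  have hfun : ∀ t : ℝ, g (e.toOpenPartialHomeomorph.symm ((e ξ).1, (e ξ).2 + t • w)) =
      g ⟨ξ.proj, ξ.2 + t • e.symm ξ.proj w⟩ := fun t => by
    rw [e.coe_fst hξ]
    exact congrArg g (trivialization_symm_add_smul e hx ξ.2 t w)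
  simp only [HasLineDerivAt, hfun] at hline
  have hbase : mfderiv 𝓘(ℝ, EB) 𝓘(ℝ, ℝ)
      (fun z => g (e.toOpenPartialHomeomorph.symm (z, (e ξ).2))) (e ξ).1 0 = 0 := map_zero _
  have hvertical : mfderiv 𝓘(ℝ, F) 𝓘(ℝ, ℝ)
      (fun z => g (e.toOpenPartialHomeomorph.symm ((e ξ).1, z))) (e ξ).2 w = 0 := by
    rw [mfderiv_eq_fderiv]
    exact hline.unique (hv _)
  exact (congrArg₂ (· + ·) hbase hvertical).trans (add_zero _)

theorem mfderiv_eq_dirDeriv_section (hv : IsFiberCriticalAt g ξ)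
    (hg : MDifferentiableAt (𝓘(ℝ, EB).prod 𝓘(ℝ, F)) 𝓘(ℝ, ℝ) g ξ) {s : ∀ x, E x}
    (hs : MDifferentiableAt 𝓘(ℝ, EB) (𝓘(ℝ, EB).prod 𝓘(ℝ, F))
      (fun x => TotalSpace.mk' F x (s x)) ξ.proj) (hsξ : s ξ.proj = ξ.2)
    (u : TangentSpace (𝓘(ℝ, EB).prod 𝓘(ℝ, F)) ξ) :
    mfderiv (𝓘(ℝ, EB).prod 𝓘(ℝ, F)) 𝓘(ℝ, ℝ) g ξ u =
      dirDeriv (mfderiv (𝓘(ℝ, EB).prod 𝓘(ℝ, F)) 𝓘(ℝ, EB) (π F E) ξ u) (fun x => g ⟨x, s x⟩) := by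
  obtain ⟨x, v⟩ := ξ
  dsimp only at hsξ hs
  subst hsξ
  set w := mfderiv (𝓘(ℝ, EB).prod 𝓘(ℝ, F)) 𝓘(ℝ, EB) (π F E) (TotalSpace.mk' F x (s x)) u
  have hvertical := hv.mfderiv_eq_zero hg (u := u - mfderiv 𝓘(ℝ, EB) (𝓘(ℝ, EB).prod 𝓘(ℝ, F))
    (fun x => TotalSpace.mk' F x (s x)) x w)
    (by rw [map_sub, sub_eq_zero]; exact (mfderiv_proj_mfderiv_section hs w).symm)
  rw [map_sub, sub_eq_zero] at hvertical
  exact hvertical.trans (DFunLike.congr_fun (hg.hasMFDerivAt.comp x hs.hasMFDerivAt).mfderiv w).symm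

theorem IsFiberCriticalAt.dirDeriv_section_congr (hv : IsFiberCriticalAt g ξ)
    (hg : MDifferentiableAt (𝓘(ℝ, EB).prod 𝓘(ℝ, F)) 𝓘(ℝ, ℝ) g ξ) {s s' : ∀ x, E x}
    (hs : MDifferentiableAt 𝓘(ℝ, EB) (𝓘(ℝ, EB).prod 𝓘(ℝ, F))
      (fun x => TotalSpace.mk' F x (s x)) ξ.proj) (hsξ : s ξ.proj = ξ.2)
    (hs' : MDifferentiableAt 𝓘(ℝ, EB) (𝓘(ℝ, EB).prod 𝓘(ℝ, F))
      (fun x => TotalSpace.mk' F x (s' x)) ξ.proj) (hsξ' : s' ξ.proj = ξ.2)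
    (v : TangentSpace 𝓘(ℝ, EB) ξ.proj) :
    dirDeriv v (fun x => g ⟨x, s x⟩) = dirDeriv v (fun x => g ⟨x, s' x⟩) := by
  obtain ⟨u, rfl⟩ : ∃ u : TangentSpace (𝓘(ℝ, EB).prod 𝓘(ℝ, F)) ξ,
      mfderiv (𝓘(ℝ, EB).prod 𝓘(ℝ, F)) 𝓘(ℝ, EB) (π F E) ξ u = v := by
    clear hs' hsξ' hv hg
    obtain ⟨x, z⟩ := ξ
    dsimp only at hsξ hs
    subst hsξ
    exact ⟨_, mfderiv_proj_mfderiv_section hs v⟩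
  rw [← mfderiv_eq_dirDeriv_section hv hg hs hsξ, ← mfderiv_eq_dirDeriv_section hv hg hs' hsξ']

theorem IsFiberCriticalAt.hasDerivAt_comp {γ : ℝ → TotalSpace F E} {t : ℝ}
    (hv : IsFiberCriticalAt g (γ t))
    (hg : MDifferentiableAt (𝓘(ℝ, EB).prod 𝓘(ℝ, F)) 𝓘(ℝ, ℝ) g (γ t)) {s : ∀ x, E x}
    (hs : MDifferentiableAt 𝓘(ℝ, EB) (𝓘(ℝ, EB).prod 𝓘(ℝ, F))
      (fun x => TotalSpace.mk' F x (s x)) (γ t).proj) (hsγ : s (γ t).proj = (γ t).2)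
    (hγ : MDifferentiableAt 𝓘(ℝ, ℝ) (𝓘(ℝ, EB).prod 𝓘(ℝ, F)) γ t) :
    HasDerivAt (fun r => g (γ r))
      (dirDeriv (curveVelocity EB (fun r => (γ r).proj) t) (fun x => g ⟨x, s x⟩)) t := by
  have hπ : MDifferentiableAt (𝓘(ℝ, EB).prod 𝓘(ℝ, F)) 𝓘(ℝ, EB) (π F E) (γ t) :=
    (Bundle.contMDiff_proj (n := ∞) E).mdifferentiableAt (by simp)
  have hvelocity : curveVelocity EB (fun r => (γ r).proj) t =
      mfderiv (𝓘(ℝ, EB).prod 𝓘(ℝ, F)) 𝓘(ℝ, EB) (π F E) (γ t)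
        (mfderiv 𝓘(ℝ, ℝ) (𝓘(ℝ, EB).prod 𝓘(ℝ, F)) γ t (1 : ℝ)) :=
    DFunLike.congr_fun (hπ.hasMFDerivAt.comp t hγ.hasMFDerivAt).mfderiv (1 : ℝ)
  rw [hvelocity, ← mfderiv_eq_dirDeriv_section hv hg hs hsγ]
  exact hasDerivAt_comp_curve hg hγ

end FiberCritical

section PoissonBracket

variable {EB : Type*} [NormedAddCommGroup EB] [NormedSpace ℝ EB]
  {B : Type*} [TopologicalSpace B] [ChartedSpace EB B]
  {F : Type*} [NormedAddCommGroup F] [NormedSpace ℝ F]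
  {A : B → Type*} [∀ x, AddCommGroup (A x)] [∀ x, Module ℝ (A x)] [∀ x, TopologicalSpace (A x)]
  [∀ x, IsTopologicalAddGroup (A x)] [∀ x, ContinuousSMul ℝ (A x)]
  [TopologicalSpace (TotalSpace F A)] [FiberBundle F A] [VectorBundle ℝ F A]
  {FD : Type*} [NormedAddCommGroup FD] [NormedSpace ℝ FD]
  {D : B → Type*} [∀ x, AddCommGroup (D x)] [∀ x, Module ℝ (D x)] [∀ x, TopologicalSpace (D x)]
  [TopologicalSpace (TotalSpace FD D)] [FiberBundle FD D] [VectorBundle ℝ FD D]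

namespace SmoothDual

variable (S : SmoothDual EB F A FD D)

theorem contMDiffWithinAt_pairing
    {EM : Type*} [NormedAddCommGroup EM] [NormedSpace ℝ EM] {HM : Type*} [TopologicalSpace HM]
    {IM : ModelWithCorners ℝ EM HM} {M : Type*} [TopologicalSpace M] [ChartedSpace HM M]
    {b : M → B} {ξ : ∀ m, D (b m)} {a : ∀ m, A (b m)} {s : Set M} {m₀ : M}
    (hξ : ContMDiffWithinAt IM (𝓘(ℝ, EB).prod 𝓘(ℝ, FD)) ∞ (fun m => TotalSpace.mk' FD (b m) (ξ m))
      s m₀)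
    (ha : ContMDiffWithinAt IM (𝓘(ℝ, EB).prod 𝓘(ℝ, F)) ∞ (fun m => TotalSpace.mk' F (b m) (a m))
      s m₀) :
    ContMDiffWithinAt IM 𝓘(ℝ, ℝ) ∞ (fun m => S.pairing (b m) (ξ m) (a m)) s m₀ := by
  have hb : ContMDiffWithinAt IM 𝓘(ℝ, EB) ∞ b s m₀ := (contMDiffWithinAt_totalSpace.1 ha).1
  have hpairing : ContMDiffWithinAt IM (𝓘(ℝ, EB).prod 𝓘(ℝ, ℝ)) ∞
      (fun m => TotalSpace.mk' ℝ (E := Bundle.Trivial B ℝ) (b m) (S.pairing (b m) (ξ m) (a m)))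
      s m₀ :=
    ContMDiffWithinAt.clm_bundle_apply₂ (F₁ := FD) (F₂ := F)
      (S.contMDiff_pairing.contMDiffAt.comp_contMDiffWithinAt m₀ hb) hξ ha
  exact (contMDiffWithinAt_totalSpace.1 hpairing).2

theorem contMDiffOn_pairing_section {s : ∀ x, D x} {U : Set B} (hs : SmoothSectionOn EB FD s U) :
    ContMDiffOn 𝓘(ℝ, EB) (𝓘(ℝ, EB).prod 𝓘(ℝ, F →L[ℝ] ℝ)) ∞
      (fun x => TotalSpace.mk' (F →L[ℝ] ℝ) (E := fun x => A x →L[ℝ] ℝ) x (S.pairing x (s x))) U :=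
  fun x hx => ContMDiffWithinAt.clm_bundle_apply (F₁ := FD) (F₂ := F →L[ℝ] ℝ)
    (E₂ := fun x => A x →L[ℝ] ℝ) (b := fun x => x)
    (S.contMDiff_pairing.contMDiffAt.contMDiffWithinAt) (hs x hx)

theorem mdifferentiableAt_pairing {s : ∀ x, D x} {ζ : ∀ x, A x} {U : Set B} (hU : IsOpen U)
    (hs : SmoothSectionOn EB FD s U) (hζ : SmoothSectionOn EB F ζ U) {x : B} (hx : x ∈ U) :
    MDifferentiableAt 𝓘(ℝ, EB) 𝓘(ℝ, ℝ) (fun y => S.pairing y (s y) (ζ y)) x :=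
  ((S.contMDiffWithinAt_pairing (b := fun y => y) (hs x hx) (hζ x hx)).contMDiffAt
    (hU.mem_nhds hx)).mdifferentiableAt (by simp)

/-- `a` represents the differential at `ξ` of the restriction of `f` to the fibre through `ξ`;
`SmoothDual.fiberDifferential` chooses such an element. -/
def HasFiberDifferentialAt (f : TotalSpace FD D → ℝ) (ξ : TotalSpace FD D) (a : A ξ.proj) : Prop :=
  ∀ η : D ξ.proj, HasDerivAt (fun t : ℝ => f ⟨ξ.proj, ξ.2 + t • η⟩) (S.pairing ξ.proj η a) 0

/-- The fibrewise linear function on the dual bundle defined by a section of `A`. -/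
noncomputable def linearFunction (ζ : ∀ x, A x) (ξ : TotalSpace FD D) : ℝ :=
  S.pairing ξ.proj ξ.2 (ζ ξ.proj)

theorem hasFiberDifferentialAt_linearFunction (ζ : ∀ x, A x) (ξ : TotalSpace FD D) :
    S.HasFiberDifferentialAt (S.linearFunction ζ) ξ (ζ ξ.proj) := by
  intro η
  have h := ((hasDerivAt_id (0 : ℝ)).mul_const (S.pairing ξ.proj η (ζ ξ.proj))).const_add
    (S.pairing ξ.proj ξ.2 (ζ ξ.proj))
  exact (h.congr_deriv (one_mul _)).congr_of_eventuallyEq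
    (.of_forall fun t => by simp [linearFunction])

theorem linearFunction_zeroSection (η : ∀ x, A x) (x : B) :
    S.linearFunction η (zeroSection FD D x) = 0 :=
  DFunLike.congr_fun (map_zero (S.pairing x)) (η x)

theorem hasFiberDifferentialAt_comp_proj (f : B → ℝ) (ξ : TotalSpace FD D) :
    S.HasFiberDifferentialAt (fun ξ => f ξ.proj) ξ 0 := fun η => by
  simpa using hasDerivAt_const (0 : ℝ) (f ξ.proj)

variable {S} {f : TotalSpace FD D → ℝ} {ξ : TotalSpace FD D}

theorem HasFiberDifferentialAt.fiberDifferential_eq {a : A ξ.proj}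
    (h : S.HasFiberDifferentialAt f ξ a) : S.fiberDifferential f ξ = a := by
  have hspec : S.HasFiberDifferentialAt f ξ (S.fiberDifferential f ξ) :=
    Classical.epsilon_spec (p := S.HasFiberDifferentialAt f ξ) ⟨a, h⟩
  refine sub_eq_zero.1 (S.eq_zero_of_right _ _ fun η => ?_)
  rw [map_sub, sub_eq_zero]
  exact (hspec η).unique (h η)

theorem HasFiberDifferentialAt.isFiberCriticalAt_sub_linearFunction {θ : ∀ x, A x}
    (h : S.HasFiberDifferentialAt f ξ (θ ξ.proj)) :
    IsFiberCriticalAt (fun q => f q - S.linearFunction θ q) ξ := fun η =>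
  ((h η).sub (S.hasFiberDifferentialAt_linearFunction θ ξ η)).congr_deriv (sub_self _)

variable (S)

theorem isSmoothFunctionOn_linearFunction {ζ : ∀ x, A x} {U : Set B}
    (hζ : SmoothSectionOn EB F ζ U) :
    S.IsSmoothFunctionOn (S.linearFunction ζ) (π FD D ⁻¹' U) :=
  ⟨fun ξ hξ => S.contMDiffWithinAt_pairing (b := fun ξ : TotalSpace FD D => ξ.proj)
      (ξ := fun ξ => ξ.2) contMDiffWithinAt_id (hζ.contMDiffOn_comp_proj ξ hξ),
    fun ξ => ζ ξ.proj, hζ.contMDiffOn_comp_proj,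
    fun ξ _ => S.hasFiberDifferentialAt_linearFunction ζ ξ⟩

theorem isSmoothFunctionOn_comp_proj {f : B → ℝ} {U : Set B}
    (hf : ContMDiffOn 𝓘(ℝ, EB) 𝓘(ℝ, ℝ) ∞ f U) :
    S.IsSmoothFunctionOn (fun ξ => f ξ.proj) (π FD D ⁻¹' U) :=
  ⟨hf.comp (Bundle.contMDiff_proj D).contMDiffOn (fun _ h => h), fun _ => 0,
    ((Bundle.contMDiff_zeroSection ℝ A).comp (Bundle.contMDiff_proj D)).contMDiffOn,
    fun ξ _ => S.hasFiberDifferentialAt_comp_proj f ξ⟩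

variable {S}

theorem IsSmoothFunctionOn.mdifferentiableAt {W : Set (TotalSpace FD D)}
    (hf : S.IsSmoothFunctionOn f W) (hW : IsOpen W) (hξ : ξ ∈ W) :
    MDifferentiableAt (𝓘(ℝ, EB).prod 𝓘(ℝ, FD)) 𝓘(ℝ, ℝ) f ξ :=
  (hf.1.contMDiffAt (hW.mem_nhds hξ)).mdifferentiableAt (by simp)

theorem mdifferentiableAt_linearFunction {ζ : ∀ x, A x} {U : Set B} (hU : IsOpen U)
    (hζ : SmoothSectionOn EB F ζ U) (hξ : ξ.proj ∈ U) :
    MDifferentiableAt (𝓘(ℝ, EB).prod 𝓘(ℝ, FD)) 𝓘(ℝ, ℝ) (S.linearFunction ζ) ξ :=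
  (S.isSmoothFunctionOn_linearFunction hζ).mdifferentiableAt
    (hU.preimage (FiberBundle.continuous_proj FD D)) hξ

theorem HasFiberDifferentialAt.dirDeriv_section_sub_pairing
    [ContMDiffVectorBundle ∞ FD D 𝓘(ℝ, EB)]
    {f : TotalSpace FD D → ℝ} {ξ : TotalSpace FD D} {θ : ∀ x, A x}
    (hb : S.HasFiberDifferentialAt f ξ (θ ξ.proj))
    (hf : MDifferentiableAt (𝓘(ℝ, EB).prod 𝓘(ℝ, FD)) 𝓘(ℝ, ℝ) f ξ)
    {U : Set B} (hU : IsOpen U) (hx : ξ.proj ∈ U) (hθ : SmoothSectionOn EB F θ U)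
    {s s' : ∀ x, D x} (hs : SmoothSectionOn EB FD s U) (hsξ : s ξ.proj = ξ.2)
    (hs' : SmoothSectionOn EB FD s' U) (hsξ' : s' ξ.proj = ξ.2)
    (v : TangentSpace 𝓘(ℝ, EB) ξ.proj) :
    dirDeriv v (fun x => f ⟨x, s x⟩ - S.pairing x (s x) (θ x)) =
      dirDeriv v (fun x => f ⟨x, s' x⟩) - dirDeriv v (fun x => S.pairing x (s' x) (θ x)) := by
  rw [← dirDeriv_sub v (mdifferentiableAt_comp_section hf (hs'.mdifferentiableAt hU hx) hsξ')
    (S.mdifferentiableAt_pairing hU hs' hθ hx)]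
  exact hb.isFiberCriticalAt_sub_linearFunction.dirDeriv_section_congr
    (hf.sub (SmoothDual.mdifferentiableAt_linearFunction hU hθ hx))
    (hs.mdifferentiableAt hU hx) hsξ (hs'.mdifferentiableAt hU hx) hsξ' v

end SmoothDual

variable {S : SmoothDual EB F A FD D} [IsManifold 𝓘(ℝ, EB) ∞ B]

namespace LieAlgebroid

variable (L : LieAlgebroid EB F A)

theorem smoothSectionOn_anchor {ζ : ∀ x, A x} {U : Set B} (hζ : SmoothSectionOn EB F ζ U) :
    SmoothSectionOn EB EB (fun x => L.anchor x (ζ x)) U :=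
  fun x hx => ContMDiffWithinAt.clm_bundle_apply (F₁ := F) (F₂ := EB)
    (E₂ := fun x : B => TangentSpace 𝓘(ℝ, EB) x) (b := fun x => x)
    (L.contMDiff_anchor.contMDiffAt.contMDiffWithinAt) (hζ x hx)

theorem contMDiff_anchor_totalSpace :
    ContMDiff (𝓘(ℝ, EB).prod 𝓘(ℝ, F)) (𝓘(ℝ, EB).prod 𝓘(ℝ, EB)) ∞
      (fun v : TotalSpace F A => (⟨v.proj, L.anchor v.proj v.2⟩ : TangentBundle 𝓘(ℝ, EB) B)) :=
  fun v => ContMDiffAt.clm_bundle_apply (F₁ := F) (F₂ := EB) (E₁ := A)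
    (E₂ := TangentSpace 𝓘(ℝ, EB)) (b := fun v : TotalSpace F A => v.proj)
    ((L.contMDiff_anchor.comp (Bundle.contMDiff_proj A)) v) contMDiffAt_id

theorem contMDiffOn_dirDeriv_anchor {ζ : ∀ x, A x} {U : Set B} (hU : IsOpen U)
    (hζ : SmoothSectionOn EB F ζ U) {f : B → ℝ} (hf : ContMDiffOn 𝓘(ℝ, EB) 𝓘(ℝ, ℝ) ∞ f U) :
    ContMDiffOn 𝓘(ℝ, EB) 𝓘(ℝ, ℝ) ∞ (fun x => dirDeriv (L.anchor x (ζ x)) f) U :=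
  contMDiffOn_mfderiv_apply hU hf (b := fun x => x) (fun _ h => h) (L.smoothSectionOn_anchor hζ)

theorem algebroidDifferential_congr {U : Set B} (hU : IsOpen U) {s : ∀ x, D x}
    (hs : SmoothSectionOn EB FD s U) {ζ η ζ' η' : ∀ x, A x} (hζ : SmoothSectionOn EB F ζ U)
    (hη : SmoothSectionOn EB F η U) (hζ' : SmoothSectionOn EB F ζ' U)
    (hη' : SmoothSectionOn EB F η' U) {x : B} (hx : x ∈ U) (hζx : ζ x = ζ' x) (hηx : η x = η' x) :
    algebroidDifferential L.anchor L.bracket (fun x => S.pairing x (s x)) ζ η x =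
      algebroidDifferential L.anchor L.bracket (fun x => S.pairing x (s x)) ζ' η' x := by
  obtain ⟨Ω, -, hΩ⟩ := L.differential_smooth U hU _ (S.contMDiffOn_pairing_section hs)
  rw [hΩ U hU subset_rfl ζ η hζ hη x hx, hΩ U hU subset_rfl ζ' η' hζ' hη' x hx, hζx, hηx]

end LieAlgebroid

theorem LieAlgebroid.poissonBracket_eq
    [ContMDiffVectorBundle ∞ F A 𝓘(ℝ, EB)] [ContMDiffVectorBundle ∞ FD D 𝓘(ℝ, EB)]
    (L : LieAlgebroid EB F A) {h f : TotalSpace FD D → ℝ} {ξ : TotalSpace FD D}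
    (hh : MDifferentiableAt (𝓘(ℝ, EB).prod 𝓘(ℝ, FD)) 𝓘(ℝ, ℝ) h ξ)
    (hf : MDifferentiableAt (𝓘(ℝ, EB).prod 𝓘(ℝ, FD)) 𝓘(ℝ, ℝ) f ξ)
    {U : Set B} (hU : IsOpen U) (hx : ξ.proj ∈ U) {ζ η : ∀ x, A x}
    (hζ : SmoothSectionOn EB F ζ U) (hη : SmoothSectionOn EB F η U)
    (ha : S.HasFiberDifferentialAt h ξ (ζ ξ.proj)) (hb : S.HasFiberDifferentialAt f ξ (η ξ.proj))
    {s : ∀ x, D x} (hs : SmoothSectionOn EB FD s U) (hsξ : s ξ.proj = ξ.2) :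
    L.poissonBracket S h f ξ =
      dirDeriv (L.anchor ξ.proj (ζ ξ.proj)) (fun x => f ⟨x, s x⟩ - S.pairing x (s x) (η x))
      - dirDeriv (L.anchor ξ.proj (η ξ.proj)) (fun x => h ⟨x, s x⟩ - S.pairing x (s x) (ζ x))
      + S.pairing ξ.proj ξ.2 (L.bracket ζ η ξ.proj) := by
  set s₀ : ∀ x, D x := FiberBundle.extend FD ξ.2 with hs₀
  have hs₀ξ : s₀ ξ.proj = ξ.2 := FiberBundle.extend_apply_self FD ξ.2
  set V := U ∩ ((trivializationAt F A ξ.proj).baseSet ∩ (trivializationAt FD D ξ.proj).baseSet)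
  have hV : IsOpen V := hU.inter ((trivializationAt F A ξ.proj).open_baseSet.inter
    (trivializationAt FD D ξ.proj).open_baseSet)
  have hxV : ξ.proj ∈ V := ⟨hx, FiberBundle.mem_baseSet_trivializationAt' _,
    FiberBundle.mem_baseSet_trivializationAt' _⟩
  have hsV : SmoothSectionOn EB FD s V := hs.mono fun _ h => h.1
  have hs₀V : SmoothSectionOn EB FD s₀ V := (smoothSectionOn_extend ξ.2).mono fun _ h => h.2.2
  have hζV : SmoothSectionOn EB F ζ V := hζ.mono fun _ h => h.1
  have hηV : SmoothSectionOn EB F η V := hη.mono fun _ h => h.1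
  have hextend : ∀ a : A ξ.proj, SmoothSectionOn EB F (FiberBundle.extend F a) V :=
    fun a => (smoothSectionOn_extend a).mono fun _ h => h.2.1
  have hdifferential := L.algebroidDifferential_congr (S := S) hV hs₀V (hextend (ζ ξ.proj))
    (hextend (η ξ.proj)) hζV hηV hxV (FiberBundle.extend_apply_self F _)
    (FiberBundle.extend_apply_self F _)
  rw [hb.dirDeriv_section_sub_pairing hf hV hxV hηV hsV hsξ hs₀V hs₀ξ,
    ha.dirDeriv_section_sub_pairing hh hV hxV hζV hsV hsξ hs₀V hs₀ξ, poissonBracket]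
  simp only [ha.fiberDifferential_eq, hb.fiberDifferential_eq]
  rw [← hs₀, hdifferential, algebroidDifferential, hs₀ξ]
  ring

end PoissonBracket

section AnchorMorphism

variable {EB : Type*} [NormedAddCommGroup EB] [NormedSpace ℝ EB]
  {B : Type*} [TopologicalSpace B] [ChartedSpace EB B]
  {F : Type*} [NormedAddCommGroup F] [NormedSpace ℝ F]
  {A : B → Type*} [∀ x, AddCommGroup (A x)] [∀ x, Module ℝ (A x)] [∀ x, TopologicalSpace (A x)]
  [TopologicalSpace (TotalSpace F A)] [FiberBundle F A] [VectorBundle ℝ F A]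

theorem smoothSectionOn_zero (U : Set B) : SmoothSectionOn EB F (fun x => (0 : A x)) U :=
  (Bundle.contMDiff_zeroSection ℝ A).contMDiffOn

variable [∀ x, IsTopologicalAddGroup (A x)] [∀ x, ContinuousSMul ℝ (A x)]
  [IsManifold 𝓘(ℝ, EB) ∞ B]

namespace LieAlgebroid

variable (L : LieAlgebroid EB F A) {U : Set B} {ζ η θ : ∀ x, A x} {f : B → ℝ} {x : B}

theorem bracket_neg_right (hU : IsOpen U) (hζ : SmoothSectionOn EB F ζ U)
    (hη : SmoothSectionOn EB F η U) (hx : x ∈ U) :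
    L.bracket ζ (fun y => - η y) x = - L.bracket ζ η x := by
  have h := L.leibniz U hU ζ η (fun _ => -1) hζ hη contMDiffOn_const x hx
  simpa only [neg_one_smul, dirDeriv_const, zero_smul, add_zero] using h

theorem bracket_zero_right (hU : IsOpen U) (hζ : SmoothSectionOn EB F ζ U) (hx : x ∈ U) :
    L.bracket ζ (fun _ => 0) x = 0 := by
  have h := L.leibniz U hU ζ (fun _ => 0) (fun _ => 0) hζ (smoothSectionOn_zero U)
    contMDiffOn_const x hx
  simpa only [smul_zero, zero_smul, add_zero] using h

theorem bracket_bracket (hU : IsOpen U) (hζ : SmoothSectionOn EB F ζ U)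
    (hη : SmoothSectionOn EB F η U) (hθ : SmoothSectionOn EB F θ U) (hx : x ∈ U) :
    L.bracket ζ (L.bracket η θ) x =
      L.bracket (L.bracket ζ η) θ x + L.bracket η (L.bracket ζ θ) x := by
  have hθζ : L.bracket η (L.bracket θ ζ) x = - L.bracket η (L.bracket ζ θ) x := by
    rw [← L.bracket_neg_right hU hη (L.smooth_bracket U hU ζ θ hζ hθ) hx]
    exact L.bracket_local U hU _ _ _ _ hη (L.smooth_bracket U hU _ _ hθ hζ) (fun _ _ => rfl)
      (L.bracket_skew U hU θ ζ hθ hζ) x hx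
  have hjacobi := L.jacobi U hU ζ η θ hζ hη hθ x hx
  rw [hθζ, L.bracket_skew U hU _ _ hθ (L.smooth_bracket U hU ζ η hζ hη) x hx] at hjacobi
  linear_combination (norm := module) hjacobi

theorem bracket_bracket_smul (hU : IsOpen U) (hζ : SmoothSectionOn EB F ζ U)
    (hη : SmoothSectionOn EB F η U) (hθ : SmoothSectionOn EB F θ U)
    (hf : ContMDiffOn 𝓘(ℝ, EB) 𝓘(ℝ, ℝ) ∞ f U) (hx : x ∈ U) :
    L.bracket ζ (L.bracket η (fun y => f y • θ y)) x =
      (f x • L.bracket ζ (L.bracket η θ) x +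
        dirDeriv (L.anchor x (ζ x)) f • L.bracket η θ x) +
      (dirDeriv (L.anchor x (η x)) f • L.bracket ζ θ x +
        dirDeriv (L.anchor x (ζ x)) (fun y => dirDeriv (L.anchor y (η y)) f) • θ x) := by
  have hηθ := L.smooth_bracket U hU η θ hη hθ
  have hηf := L.contMDiffOn_dirDeriv_anchor hU hη hf
  have hleibniz : L.bracket ζ (L.bracket η (fun y => f y • θ y)) x = L.bracket ζ
      (fun y => f y • L.bracket η θ y + dirDeriv (L.anchor y (η y)) f • θ y) x :=
    L.bracket_local U hU _ _ _ _ hζ (L.smooth_bracket U hU _ _ hη (hf.smul_section hθ))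
      (fun _ _ => rfl) (L.leibniz U hU η θ f hη hθ hf) x hx
  rw [hleibniz, L.bracket_add U hU ζ (fun y => f y • L.bracket η θ y)
    (fun y => dirDeriv (L.anchor y (η y)) f • θ y) hζ (hf.smul_section hηθ)
    (hηf.smul_section hθ) x hx, L.leibniz U hU ζ _ f hζ hηθ hf x hx,
    L.leibniz U hU ζ θ _ hζ hθ hηf x hx]

theorem dirDeriv_anchor_bracket_smul (hU : IsOpen U) (hζ : SmoothSectionOn EB F ζ U)
    (hη : SmoothSectionOn EB F η U) (hθ : SmoothSectionOn EB F θ U)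
    (hf : ContMDiffOn 𝓘(ℝ, EB) 𝓘(ℝ, ℝ) ∞ f U) (hx : x ∈ U) :
    dirDeriv (L.anchor x (L.bracket ζ η x)) f • θ x =
      (dirDeriv (L.anchor x (ζ x)) (fun y => dirDeriv (L.anchor y (η y)) f)
        - dirDeriv (L.anchor x (η x)) (fun y => dirDeriv (L.anchor y (ζ y)) f)) • θ x := by
  have hθ_jacobi := L.bracket_bracket hU hζ hη hθ hx
  have hfθ_jacobi := L.bracket_bracket (θ := fun y => f y • θ y) hU hζ hη (hf.smul_section hθ) hx
  rw [L.bracket_bracket_smul hU hζ hη hθ hf hx, L.bracket_bracket_smul hU hη hζ hθ hf hx,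
    L.leibniz U hU _ θ f (L.smooth_bracket U hU ζ η hζ hη) hθ hf x hx] at hfθ_jacobi
  linear_combination (norm := module) f x • hθ_jacobi - hfθ_jacobi

variable [ContMDiffVectorBundle ∞ F A 𝓘(ℝ, EB)]

theorem dirDeriv_anchor_bracket (hL : L.IsTransitive) (hU : IsOpen U)
    (hζ : SmoothSectionOn EB F ζ U) (hη : SmoothSectionOn EB F η U)
    (hf : ContMDiffOn 𝓘(ℝ, EB) 𝓘(ℝ, ℝ) ∞ f U) (hx : x ∈ U) :
    dirDeriv (L.anchor x (L.bracket ζ η x)) f =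
      dirDeriv (L.anchor x (ζ x)) (fun y => dirDeriv (L.anchor y (η y)) f)
        - dirDeriv (L.anchor x (η x)) (fun y => dirDeriv (L.anchor y (ζ y)) f) := by
  by_cases hfiber : ∀ a : A x, a = 0
  · have htangent : ∀ v : TangentSpace 𝓘(ℝ, EB) x, v = 0 := fun v => by
      obtain ⟨a, rfl⟩ := hL x v
      rw [hfiber a, map_zero]
    rw [htangent (L.anchor x (ζ x)), htangent (L.anchor x (η x)),
      htangent (L.anchor x (L.bracket ζ η x))]
    simp only [dirDeriv_zero_left, sub_zero]
  · push Not at hfiber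
    obtain ⟨a, ha⟩ := hfiber
    obtain ⟨V, hV, hxV, θ, hθ, rfl⟩ := exists_smoothSectionOn_apply_eq (EB := EB) (F := F) a
    exact smul_left_injective ℝ ha (L.dirDeriv_anchor_bracket_smul (hU.inter hV)
      (hζ.mono inter_subset_left) (hη.mono inter_subset_left) (hθ.mono inter_subset_right)
      (hf.mono inter_subset_left) ⟨hx, hxV⟩)

theorem anchor_bracket_eq_zero_of_anchor_eq_zero (hL : L.IsTransitive) (hU : IsOpen U)
    (hζ : SmoothSectionOn EB F ζ U) (hη : SmoothSectionOn EB F η U)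
    (hη_ker : ∀ x ∈ U, L.anchor x (η x) = 0) (hx : x ∈ U) :
    L.anchor x (L.bracket ζ η x) = 0 := by
  refine eq_of_forall_dirDeriv_eq fun V f hV hxV hf => ?_
  rw [L.dirDeriv_anchor_bracket hL (hU.inter hV) (hζ.mono inter_subset_left)
    (hη.mono inter_subset_left) (hf.mono inter_subset_right) ⟨hx, hxV⟩, hη_ker x hx,
    dirDeriv_zero_left, dirDeriv_zero_left, sub_zero, ← dirDeriv_const (L.anchor x (ζ x)) 0]
  refine dirDeriv_congr _ ?_
  filter_upwards [hU.mem_nhds hx] with y hy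
  rw [hη_ker y hy, dirDeriv_zero_left]

end LieAlgebroid

end AnchorMorphism

section HamiltonianTrajectories

variable {EB : Type*} [NormedAddCommGroup EB] [NormedSpace ℝ EB]
  {B : Type*} [TopologicalSpace B] [ChartedSpace EB B]
  {F : Type*} [NormedAddCommGroup F] [NormedSpace ℝ F]
  {A : B → Type*} [∀ x, AddCommGroup (A x)] [∀ x, Module ℝ (A x)]
  [∀ x, TopologicalSpace (A x)] [∀ x, IsTopologicalAddGroup (A x)] [∀ x, ContinuousSMul ℝ (A x)]
  [TopologicalSpace (TotalSpace F A)] [FiberBundle F A] [VectorBundle ℝ F A]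
  {FD : Type*} [NormedAddCommGroup FD] [NormedSpace ℝ FD]
  {D : B → Type*} [∀ x, AddCommGroup (D x)] [∀ x, Module ℝ (D x)] [∀ x, TopologicalSpace (D x)]
  [TopologicalSpace (TotalSpace FD D)] [FiberBundle FD D] [VectorBundle ℝ FD D]

namespace InertiaOperator

variable {S : SmoothDual EB F A FD D} (I : InertiaOperator S)

theorem hamiltonian_eq (ξ : TotalSpace FD D) :
    I.hamiltonian ξ = 1 / 2 * S.pairing ξ.proj ξ.2 ((I.toEquiv ξ.proj).symm ξ.2) := by
  simp [hamiltonian, metric]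

theorem hamiltonian_sub_pairing_toEquiv {x : B} (a : A x) :
    I.hamiltonian ⟨x, I.toEquiv x a⟩ - S.pairing x (I.toEquiv x a) a =
      -(1 / 2 : ℝ) * I.metric a a := by
  simp only [hamiltonian_eq, metric, (I.toEquiv x).symm_apply_apply]
  ring

theorem pairing_symm_comm {x : B} (ξ η : D x) :
    S.pairing x ξ ((I.toEquiv x).symm η) = S.pairing x η ((I.toEquiv x).symm ξ) := by
  simpa using I.symm x ((I.toEquiv x).symm ξ) ((I.toEquiv x).symm η)

theorem hasFiberDifferentialAt_hamiltonian (ξ : TotalSpace FD D) :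
    S.HasFiberDifferentialAt I.hamiltonian ξ ((I.toEquiv ξ.proj).symm ξ.2) := by
  intro η
  have hpolynomial : (fun t : ℝ => I.hamiltonian ⟨ξ.proj, ξ.2 + t • η⟩) = fun t : ℝ =>
      1 / 2 * S.pairing ξ.proj ξ.2 ((I.toEquiv ξ.proj).symm ξ.2) +
        t * S.pairing ξ.proj η ((I.toEquiv ξ.proj).symm ξ.2) +
        t ^ 2 * (1 / 2 * S.pairing ξ.proj η ((I.toEquiv ξ.proj).symm η)) := by
    funext t
    rw [hamiltonian_eq]
    simp only [map_add, map_smul, add_apply, smul_apply, smul_eq_mul, I.pairing_symm_comm ξ.2 η]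
    ring
  rw [hpolynomial]
  refine (((hasDerivAt_mul_const _).const_add _).add
    ((hasDerivAt_pow 2 (0 : ℝ)).mul_const _)).congr_deriv ?_
  simp

theorem isSmoothFunctionOn_hamiltonian : S.IsSmoothFunctionOn I.hamiltonian univ := by
  refine ⟨fun ξ _ => ?_, fun ξ => (I.toEquiv ξ.proj).symm ξ.2, I.contMDiff_symm.contMDiffOn,
    fun ξ _ => I.hasFiberDifferentialAt_hamiltonian ξ⟩
  rw [show I.hamiltonian = _ from funext I.hamiltonian_eq]
  exact contMDiffWithinAt_const.mul (S.contMDiffWithinAt_pairing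
    (b := fun ξ : TotalSpace FD D => ξ.proj) (ξ := fun ξ => ξ.2) contMDiffWithinAt_id
    (I.contMDiff_symm ξ))

end InertiaOperator

variable [IsManifold 𝓘(ℝ, EB) ∞ B] [ContMDiffVectorBundle ∞ F A 𝓘(ℝ, EB)]
  [ContMDiffVectorBundle ∞ FD D 𝓘(ℝ, EB)]

namespace LieAlgebroid

variable (L : LieAlgebroid EB F A) {S : SmoothDual EB F A FD D} {h f : TotalSpace FD D → ℝ}

theorem poissonBracket_linearFunction {ξ : TotalSpace FD D}
    (hh : MDifferentiableAt (𝓘(ℝ, EB).prod 𝓘(ℝ, FD)) 𝓘(ℝ, ℝ) h ξ)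
    {U : Set B} (hU : IsOpen U) (hx : ξ.proj ∈ U) {ζ η : ∀ x, A x}
    (hζ : SmoothSectionOn EB F ζ U) (hη : SmoothSectionOn EB F η U)
    (ha : S.HasFiberDifferentialAt h ξ (ζ ξ.proj))
    {s : ∀ x, D x} (hs : SmoothSectionOn EB FD s U) (hsξ : s ξ.proj = ξ.2) :
    L.poissonBracket S h (S.linearFunction η) ξ =
      S.pairing ξ.proj ξ.2 (L.bracket ζ η ξ.proj)
      - dirDeriv (L.anchor ξ.proj (η ξ.proj)) (fun x => h ⟨x, s x⟩ - S.pairing x (s x) (ζ x)) := by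
  rw [L.poissonBracket_eq hh (SmoothDual.mdifferentiableAt_linearFunction hU hη hx) hU hx hζ hη ha
    (S.hasFiberDifferentialAt_linearFunction η ξ) hs hsξ]
  simp only [SmoothDual.linearFunction, sub_self, dirDeriv_const]
  ring

theorem poissonBracket_eq_dirDeriv_add_poissonBracket_linearFunction {ξ : TotalSpace FD D}
    (hh : MDifferentiableAt (𝓘(ℝ, EB).prod 𝓘(ℝ, FD)) 𝓘(ℝ, ℝ) h ξ)
    (hf : MDifferentiableAt (𝓘(ℝ, EB).prod 𝓘(ℝ, FD)) 𝓘(ℝ, ℝ) f ξ)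
    {a : A ξ.proj} (ha : S.HasFiberDifferentialAt h ξ a)
    {U : Set B} (hU : IsOpen U) (hx : ξ.proj ∈ U) {η : ∀ x, A x} (hη : SmoothSectionOn EB F η U)
    (hb : S.HasFiberDifferentialAt f ξ (η ξ.proj))
    {s : ∀ x, D x} (hs : SmoothSectionOn EB FD s U) (hsξ : s ξ.proj = ξ.2) :
    L.poissonBracket S h f ξ =
      dirDeriv (L.anchor ξ.proj a) (fun x => f ⟨x, s x⟩ - S.pairing x (s x) (η x)) +
        L.poissonBracket S h (S.linearFunction η) ξ := by
  obtain ⟨V, hV, hxV, ζ, hζ, rfl⟩ := exists_smoothSectionOn_apply_eq (EB := EB) (F := F) a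
  have hUV := hU.inter hV
  have hζ' := hζ.mono (inter_subset_right (s := U))
  have hη' := hη.mono (inter_subset_left (t := V))
  have hs' := hs.mono (inter_subset_left (t := V))
  rw [L.poissonBracket_eq hh hf hUV ⟨hx, hxV⟩ hζ' hη' ha hb hs' hsξ,
    L.poissonBracket_linearFunction hh hUV ⟨hx, hxV⟩ hζ' hη' ha hs' hsξ]
  ring

theorem poissonBracket_comp_proj {ξ : TotalSpace FD D}
    (hh : MDifferentiableAt (𝓘(ℝ, EB).prod 𝓘(ℝ, FD)) 𝓘(ℝ, ℝ) h ξ) {a : A ξ.proj}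
    (ha : S.HasFiberDifferentialAt h ξ a) {U : Set B} (hU : IsOpen U) (hx : ξ.proj ∈ U) {f : B → ℝ}
    (hf : ContMDiffOn 𝓘(ℝ, EB) 𝓘(ℝ, ℝ) ∞ f U) :
    L.poissonBracket S h (fun ξ => f ξ.proj) ξ = dirDeriv (L.anchor ξ.proj a) f := by
  obtain ⟨V, hV, hxV, ζ, hζ, rfl⟩ := exists_smoothSectionOn_apply_eq (EB := EB) (F := F) a
  obtain ⟨W, hW, hxW, s, hs, hsξ⟩ := exists_smoothSectionOn_apply_eq (EB := EB) (F := FD) ξ.2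
  have hζ' := hζ.mono (inter_subset_left (t := W))
  rw [L.poissonBracket_eq hh ((S.isSmoothFunctionOn_comp_proj hf).mdifferentiableAt
      (hU.preimage (FiberBundle.continuous_proj FD D)) hx) (hV.inter hW) ⟨hxV, hxW⟩ hζ'
    (smoothSectionOn_zero _) ha (S.hasFiberDifferentialAt_comp_proj f ξ)
    (hs.mono inter_subset_right) hsξ, L.bracket_zero_right (hV.inter hW) hζ' ⟨hxV, hxW⟩]
  simp only [map_zero, dirDeriv_zero_left, sub_zero, add_zero]

variable {γ : ℝ → TotalSpace FD D} {t : ℝ}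

theorem curveVelocity_eq_anchor
    (hh : MDifferentiableAt (𝓘(ℝ, EB).prod 𝓘(ℝ, FD)) 𝓘(ℝ, ℝ) h (γ t)) {a : A (γ t).proj}
    (ha : S.HasFiberDifferentialAt h (γ t) a)
    (hγ : MDifferentiableAt 𝓘(ℝ, ℝ) (𝓘(ℝ, EB).prod 𝓘(ℝ, FD)) γ t)
    (hf : ∀ (W : Set (TotalSpace FD D)) (f : TotalSpace FD D → ℝ), IsOpen W → γ t ∈ W →
      S.IsSmoothFunctionOn f W → HasDerivAt (fun s => f (γ s)) (L.poissonBracket S h f (γ t)) t) :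
    curveVelocity EB (fun s => (γ s).proj) t = L.anchor (γ t).proj a := by
  refine eq_of_forall_dirDeriv_eq fun U f hU hx hfU => ?_
  have hpoisson := hf (π FD D ⁻¹' U) (fun ξ => f ξ.proj)
    (hU.preimage (FiberBundle.continuous_proj FD D)) hx (S.isSmoothFunctionOn_comp_proj hfU)
  rw [L.poissonBracket_comp_proj hh ha hU hx hfU] at hpoisson
  have hbase : MDifferentiableAt 𝓘(ℝ, ℝ) 𝓘(ℝ, EB) (fun s => (γ s).proj) t :=
    MDifferentiableAt.comp t ((Bundle.contMDiff_proj (n := ∞) D).mdifferentiableAt (by simp)) hγ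
  exact (hasDerivAt_comp_curve ((hfU.contMDiffAt (hU.mem_nhds hx)).mdifferentiableAt (by simp))
    hbase).unique hpoisson

theorem hasDerivAt_poissonBracket_of_linear
    (hh : MDifferentiableAt (𝓘(ℝ, EB).prod 𝓘(ℝ, FD)) 𝓘(ℝ, ℝ) h (γ t))
    {a : A (γ t).proj} (ha : S.HasFiberDifferentialAt h (γ t) a)
    (hγ : MDifferentiableAt 𝓘(ℝ, ℝ) (𝓘(ℝ, EB).prod 𝓘(ℝ, FD)) γ t)
    (hvelocity : curveVelocity EB (fun s => (γ s).proj) t = L.anchor (γ t).proj a)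
    (hlinear : ∀ b : A (γ t).proj, ∃ (U : Set B) (η : ∀ x, A x), IsOpen U ∧ (γ t).proj ∈ U ∧
      SmoothSectionOn EB F η U ∧ η (γ t).proj = b ∧
      HasDerivAt (fun s => S.linearFunction η (γ s))
        (L.poissonBracket S h (S.linearFunction η) (γ t)) t)
    {W : Set (TotalSpace FD D)} (hW : IsOpen W) (hγW : γ t ∈ W)
    (hf : S.IsSmoothFunctionOn f W) :
    HasDerivAt (fun s => f (γ s)) (L.poissonBracket S h f (γ t)) t := by
  have hf' := hf.mdifferentiableAt hW hγW
  obtain ⟨-, b, -, hb⟩ := hf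
  obtain ⟨U, η, hU, hxU, hη, hηb, hderiv⟩ := hlinear (b (γ t))
  obtain ⟨V, hV, hxV, s, hs, hsγ⟩ := exists_smoothSectionOn_apply_eq (EB := EB) (F := FD) (γ t).2
  have hbη : S.HasFiberDifferentialAt f (γ t) (η (γ t).proj) := hηb ▸ hb _ hγW
  have hdifference := hbη.isFiberCriticalAt_sub_linearFunction.hasDerivAt_comp
    (hf'.sub (SmoothDual.mdifferentiableAt_linearFunction hU hη hxU))
    (hs.mdifferentiableAt hV hxV) hsγ hγ
  have hsum := hdifference.add hderiv
  simp only [Pi.add_def, sub_add_cancel, hvelocity] at hsum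
  rwa [L.poissonBracket_eq_dirDeriv_add_poissonBracket_linearFunction hh hf' ha (hU.inter hV)
    ⟨hxU, hxV⟩ (hη.mono inter_subset_left) hbη (hs.mono inter_subset_right) hsγ]

end LieAlgebroid

end HamiltonianTrajectories

section HomSections

variable {EB : Type*} [NormedAddCommGroup EB] [NormedSpace ℝ EB]
  {B : Type*} [TopologicalSpace B] [ChartedSpace EB B]
  {F₁ : Type*} [NormedAddCommGroup F₁] [NormedSpace ℝ F₁]
  {E₁ : B → Type*} [∀ x, AddCommGroup (E₁ x)] [∀ x, Module ℝ (E₁ x)] [∀ x, TopologicalSpace (E₁ x)]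
  [TopologicalSpace (TotalSpace F₁ E₁)] [FiberBundle F₁ E₁] [VectorBundle ℝ F₁ E₁]
  {F₂ : Type*} [NormedAddCommGroup F₂] [NormedSpace ℝ F₂]
  {E₂ : B → Type*} [∀ x, AddCommGroup (E₂ x)] [∀ x, Module ℝ (E₂ x)] [∀ x, TopologicalSpace (E₂ x)]
  [TopologicalSpace (TotalSpace F₂ E₂)] [FiberBundle F₂ E₂] [VectorBundle ℝ F₂ E₂]

theorem contMDiffAt_hom_of_uncurry
    [∀ x, IsTopologicalAddGroup (E₂ x)] [∀ x, ContinuousSMul ℝ (E₂ x)]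
    {EM : Type*} [NormedAddCommGroup EM] [NormedSpace ℝ EM] {HM : Type*} [TopologicalSpace HM]
    {IM : ModelWithCorners ℝ EM HM} {M : Type*} [TopologicalSpace M] [ChartedSpace HM M]
    [IsManifold IM ∞ M]
    {b : M → B} {m₀ : M} (hb : ContMDiffAt IM 𝓘(ℝ, EB) ∞ b m₀) {ψ : ∀ m, E₁ (b m) →L[ℝ] E₂ (b m)}
    (h : ContMDiffAt (IM.prod 𝓘(ℝ, F₁)) (𝓘(ℝ, EB).prod 𝓘(ℝ, F₂)) ∞
      (fun q : M × F₁ => TotalSpace.mk' F₂ (b q.1)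
        (ψ q.1 ((trivializationAt F₁ E₁ (b m₀)).symm (b q.1) q.2))) (m₀, 0)) :
    ContMDiffAt IM (𝓘(ℝ, EB).prod 𝓘(ℝ, F₁ →L[ℝ] F₂)) ∞
      (fun m => TotalSpace.mk' (F₁ →L[ℝ] F₂) (E := fun x => E₁ x →L[ℝ] E₂ x) (b m) (ψ m)) m₀ := by
  -- A linear map is its own derivative, so its coordinate expression is a partial derivative
  -- of the uncurried map.
  set e₁ := trivializationAt F₁ E₁ (b m₀)
  set e₂ := trivializationAt F₂ E₂ (b m₀)
  rw [contMDiffAt_hom_bundle]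
  refine ⟨hb, ?_⟩
  have huncurry := (contMDiffAt_totalSpace.1 h).2
  dsimp only at huncurry
  have hderiv := ContMDiffAt.mfderiv (m := ∞)
    (fun (m : M) (w : F₁) => (e₂ ⟨b m, ψ m (e₁.symm (b m) w)⟩).2) (fun _ => (0 : F₁)) huncurry
    contMDiffAt_const (by simp)
  erw [inTangentCoordinates_model_space] at hderiv
  refine hderiv.congr_of_eventuallyEq ?_
  filter_upwards [hb.continuousAt (e₁.open_baseSet.mem_nhds
      (FiberBundle.mem_baseSet_trivializationAt' _)),
    hb.continuousAt (e₂.open_baseSet.mem_nhds (FiberBundle.mem_baseSet_trivializationAt' _))]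
    with m hm₁ hm₂
  have hlinear : (fun w : F₁ => (e₂ ⟨b m, ψ m (e₁.symm (b m) w)⟩).2) =
      ContinuousLinearMap.inCoordinates F₁ E₁ F₂ E₂ (b m₀) (b m) (b m₀) (b m) (ψ m) := by
    funext w
    rw [ContinuousLinearMap.inCoordinates_eq hm₁ hm₂]
    simp [e₁, e₂]
  rw [hlinear, mfderiv_eq_fderiv, ContinuousLinearMap.fderiv]

theorem contMDiffAt_hom_hom_of_uncurry [IsManifold 𝓘(ℝ, EB) ∞ B]
    {F₃ : Type*} [NormedAddCommGroup F₃] [NormedSpace ℝ F₃]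
    {E₃ : B → Type*} [∀ x, AddCommGroup (E₃ x)] [∀ x, Module ℝ (E₃ x)]
    [∀ x, TopologicalSpace (E₃ x)] [∀ x, IsTopologicalAddGroup (E₃ x)]
    [∀ x, ContinuousSMul ℝ (E₃ x)]
    [TopologicalSpace (TotalSpace F₃ E₃)] [FiberBundle F₃ E₃] [VectorBundle ℝ F₃ E₃]
    {β : ∀ x, E₁ x →L[ℝ] E₂ x →L[ℝ] E₃ x} {x₀ : B}
    (h : ContMDiffAt ((𝓘(ℝ, EB).prod 𝓘(ℝ, F₁)).prod 𝓘(ℝ, F₂)) (𝓘(ℝ, EB).prod 𝓘(ℝ, F₃)) ∞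
      (fun q : (B × F₁) × F₂ => TotalSpace.mk' F₃ q.1.1
        (β q.1.1 ((trivializationAt F₁ E₁ x₀).symm q.1.1 q.1.2)
          ((trivializationAt F₂ E₂ x₀).symm q.1.1 q.2))) ((x₀, 0), 0)) :
    ContMDiffAt 𝓘(ℝ, EB) (𝓘(ℝ, EB).prod 𝓘(ℝ, F₁ →L[ℝ] F₂ →L[ℝ] F₃)) ∞
      (fun x => TotalSpace.mk' (F₁ →L[ℝ] F₂ →L[ℝ] F₃) (E := fun x => E₁ x →L[ℝ] E₂ x →L[ℝ] E₃ x)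
        x (β x)) x₀ :=
  contMDiffAt_hom_of_uncurry (F₂ := F₂ →L[ℝ] F₃) (E₂ := fun x => E₂ x →L[ℝ] E₃ x)
    (b := fun x => x) contMDiffAt_id
    (contMDiffAt_hom_of_uncurry (b := fun q : B × F₁ => q.1) (m₀ := (x₀, 0)) contMDiffAt_fst h)

variable [∀ x, IsTopologicalAddGroup (E₂ x)] [∀ x, ContinuousSMul ℝ (E₂ x)]

theorem contMDiff_hom_id :
    ContMDiff 𝓘(ℝ, EB) (𝓘(ℝ, EB).prod 𝓘(ℝ, F₂ →L[ℝ] F₂)) ∞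
      (fun x => TotalSpace.mk' (F₂ →L[ℝ] F₂) (E := fun x => E₂ x →L[ℝ] E₂ x) x
        (ContinuousLinearMap.id ℝ (E₂ x))) := by
  intro x₀
  rw [contMDiffAt_hom_bundle]
  refine ⟨contMDiffAt_id, (contMDiffAt_const
    (c := ContinuousLinearMap.id ℝ F₂)).congr_of_eventuallyEq ?_⟩
  filter_upwards [(trivializationAt F₂ E₂ x₀).open_baseSet.mem_nhds
    (FiberBundle.mem_baseSet_trivializationAt' x₀)] with x hx
  ext w
  exact (trivializationAt F₂ E₂ x₀).continuousLinearMapAt_symmL hx w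

theorem contMDiffAt_hom_comp
    {F₃ : Type*} [NormedAddCommGroup F₃] [NormedSpace ℝ F₃]
    {E₃ : B → Type*} [∀ x, AddCommGroup (E₃ x)] [∀ x, Module ℝ (E₃ x)]
    [∀ x, TopologicalSpace (E₃ x)] [∀ x, IsTopologicalAddGroup (E₃ x)]
    [∀ x, ContinuousSMul ℝ (E₃ x)]
    [TopologicalSpace (TotalSpace F₃ E₃)] [FiberBundle F₃ E₃] [VectorBundle ℝ F₃ E₃]
    {ψ : ∀ x, E₂ x →L[ℝ] E₃ x} {ϕ : ∀ x, E₁ x →L[ℝ] E₂ x} {x₀ : B}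
    (hψ : ContMDiffAt 𝓘(ℝ, EB) (𝓘(ℝ, EB).prod 𝓘(ℝ, F₂ →L[ℝ] F₃)) ∞
      (fun x => TotalSpace.mk' (F₂ →L[ℝ] F₃) (E := fun x => E₂ x →L[ℝ] E₃ x) x (ψ x)) x₀)
    (hϕ : ContMDiffAt 𝓘(ℝ, EB) (𝓘(ℝ, EB).prod 𝓘(ℝ, F₁ →L[ℝ] F₂)) ∞
      (fun x => TotalSpace.mk' (F₁ →L[ℝ] F₂) (E := fun x => E₁ x →L[ℝ] E₂ x) x (ϕ x)) x₀) :
    ContMDiffAt 𝓘(ℝ, EB) (𝓘(ℝ, EB).prod 𝓘(ℝ, F₁ →L[ℝ] F₃)) ∞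
      (fun x => TotalSpace.mk' (F₁ →L[ℝ] F₃) (E := fun x => E₁ x →L[ℝ] E₃ x) x
        ((ψ x).comp (ϕ x))) x₀ := by
  rw [contMDiffAt_hom_bundle] at hψ hϕ ⊢
  refine ⟨contMDiffAt_id, (hψ.2.clm_comp hϕ.2).congr_of_eventuallyEq ?_⟩
  filter_upwards [(trivializationAt F₂ E₂ x₀).open_baseSet.mem_nhds
    (FiberBundle.mem_baseSet_trivializationAt' x₀)] with x hx
  ext w
  simp only [ContinuousLinearMap.inCoordinates, ContinuousLinearMap.comp_apply,
    (trivializationAt F₂ E₂ x₀).symmL_continuousLinearMapAt hx]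

end HomSections

section RightInverse

variable {E F : Type*} [NormedAddCommGroup E] [NormedSpace ℝ E] [CompleteSpace E]
  [NormedAddCommGroup F] [NormedSpace ℝ F]

theorem exists_continuous_rightInverse [CompleteSpace F] {T : F →L[ℝ] E}
    (hT : Function.Surjective T) {P : F →L[ℝ] F} (hTP : ∀ v, T (P v) = 0)
    (hP : ∀ v, T v = 0 → P v = v) : ∃ R : E →L[ℝ] F, ∀ v, T (R v) = v := by
  let K : Submodule ℝ F := LinearMap.ker P.toLinearMap
  have : CompleteSpace K := P.isClosed_ker.completeSpace_coe
  let TK : K →L[ℝ] E := T.comp K.subtypeL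
  have hinjective : LinearMap.ker TK.toLinearMap = ⊥ := by
    rw [LinearMap.ker_eq_bot']
    exact fun v hv => Subtype.ext ((hP v hv).symm.trans v.2)
  have hsurjective : LinearMap.range TK.toLinearMap = ⊤ := by
    rw [LinearMap.range_eq_top]
    intro w
    obtain ⟨v, rfl⟩ := hT w
    refine ⟨⟨v - P v, ?_⟩, ?_⟩
    · change P (v - P v) = 0
      rw [map_sub, hP (P v) (hTP v), sub_self]
    · change T (v - P v) = T v
      rw [map_sub, hTP, sub_zero]
  let e := ContinuousLinearEquiv.ofBijective TK hinjective hsurjective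
  exact ⟨K.subtypeL.comp (e.symm : E →L[ℝ] K), e.apply_symm_apply⟩

theorem exists_contMDiffAt_rightInverse
    {EM : Type*} [NormedAddCommGroup EM] [NormedSpace ℝ EM] {HM : Type*} [TopologicalSpace HM]
    {IM : ModelWithCorners ℝ EM HM} {M : Type*} [TopologicalSpace M] [ChartedSpace HM M]
    {T : M → F →L[ℝ] E} {m₀ : M} (hT : ContMDiffAt IM 𝓘(ℝ, F →L[ℝ] E) ∞ T m₀) {R : E →L[ℝ] F}
    (hR : ∀ v, T m₀ (R v) = v) :
    ∃ τ : M → E →L[ℝ] F, ContMDiffAt IM 𝓘(ℝ, E →L[ℝ] F) ∞ τ m₀ ∧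
      ∀ᶠ m in 𝓝 m₀, ∀ v, T m (τ m v) = v := by
  -- `T ∘ R` is the identity at `m₀`, hence invertible nearby, and `R ∘ (T ∘ R)⁻¹` works.
  have hTR : ContMDiffAt IM 𝓘(ℝ, E →L[ℝ] E) ∞ (fun m => (T m).comp R) m₀ :=
    hT.clm_comp contMDiffAt_const
  have hTR₀ : (T m₀).comp R = (ContinuousLinearEquiv.refl ℝ E : E →L[ℝ] E) := by
    ext v; exact hR v
  refine ⟨fun m => R.comp (ContinuousLinearMap.inverse ((T m).comp R)),
    contMDiffAt_const.clm_comp ?_, ?_⟩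
  · have hinverse : ContDiffAt ℝ ∞ (ContinuousLinearMap.inverse : (E →L[ℝ] E) → E →L[ℝ] E)
        ((T m₀).comp R) := hTR₀ ▸ contDiffAt_map_inverse _
    exact hinverse.contMDiffAt.comp m₀ hTR
  · have hequiv := ContinuousLinearEquiv.nhds (ContinuousLinearEquiv.refl ℝ E)
    rw [← hTR₀] at hequiv
    filter_upwards [hTR.continuousAt hequiv] with m hm v
    obtain ⟨e, he : (e : E →L[ℝ] E) = (T m).comp R⟩ := hm
    change ((T m).comp R) (ContinuousLinearMap.inverse ((T m).comp R) v) = v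
    rw [← he, ContinuousLinearMap.inverse_equiv]
    exact e.apply_symm_apply v

theorem exists_contMDiffAt_hom_rightInverse
    {EB : Type*} [NormedAddCommGroup EB] [NormedSpace ℝ EB]
    {B : Type*} [TopologicalSpace B] [ChartedSpace EB B]
    {V : B → Type*} [∀ x, AddCommGroup (V x)] [∀ x, Module ℝ (V x)] [∀ x, TopologicalSpace (V x)]
    [∀ x, IsTopologicalAddGroup (V x)] [∀ x, ContinuousSMul ℝ (V x)]
    [TopologicalSpace (TotalSpace F V)] [FiberBundle F V] [VectorBundle ℝ F V]
    {W : B → Type*} [∀ x, AddCommGroup (W x)] [∀ x, Module ℝ (W x)] [∀ x, TopologicalSpace (W x)]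
    [∀ x, IsTopologicalAddGroup (W x)] [∀ x, ContinuousSMul ℝ (W x)]
    [TopologicalSpace (TotalSpace E W)] [FiberBundle E W] [VectorBundle ℝ E W]
    {ϕ : ∀ x, V x →L[ℝ] W x} {x₀ : B}
    (hϕ : ContMDiffAt 𝓘(ℝ, EB) (𝓘(ℝ, EB).prod 𝓘(ℝ, F →L[ℝ] E)) ∞
      (fun x => TotalSpace.mk' (F →L[ℝ] E) (E := fun x => V x →L[ℝ] W x) x (ϕ x)) x₀)
    {R : W x₀ →L[ℝ] V x₀} (hR : ∀ v, ϕ x₀ (R v) = v) :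
    ∃ τ : ∀ x, W x →L[ℝ] V x,
      ContMDiffAt 𝓘(ℝ, EB) (𝓘(ℝ, EB).prod 𝓘(ℝ, E →L[ℝ] F)) ∞
        (fun x => TotalSpace.mk' (E →L[ℝ] F) (E := fun x => W x →L[ℝ] V x) x (τ x)) x₀ ∧
      ∀ᶠ x in 𝓝 x₀, ∀ v, ϕ x (τ x v) = v := by
  set eV := trivializationAt F V x₀
  set eW := trivializationAt E W x₀
  have hV : x₀ ∈ eV.baseSet := FiberBundle.mem_baseSet_trivializationAt' x₀
  have hW : x₀ ∈ eW.baseSet := FiberBundle.mem_baseSet_trivializationAt' x₀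
  obtain ⟨T, hT, hϕT⟩ := exists_contMDiffAt_rightInverse ((contMDiffAt_hom_bundle _).1 hϕ).2
    (R := (eV.continuousLinearMapAt ℝ x₀).comp (R.comp (eW.symmL ℝ x₀))) fun w => by
      change eW.continuousLinearMapAt ℝ x₀ (ϕ x₀ (eV.symmL ℝ x₀ (eV.continuousLinearMapAt ℝ x₀
        (R (eW.symmL ℝ x₀ w))))) = w
      rw [eV.symmL_continuousLinearMapAt hV, hR, eW.continuousLinearMapAt_symmL hW]
  refine ⟨fun x => (eV.symmL ℝ x).comp ((T x).comp (eW.continuousLinearMapAt ℝ x)), ?_, ?_⟩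
  · rw [contMDiffAt_hom_bundle]
    refine ⟨contMDiffAt_id, hT.congr_of_eventuallyEq ?_⟩
    filter_upwards [eV.open_baseSet.mem_nhds hV, eW.open_baseSet.mem_nhds hW] with x hxV hxW
    ext w
    change eV.continuousLinearMapAt ℝ x (eV.symmL ℝ x (T x (eW.continuousLinearMapAt ℝ x
      (eW.symmL ℝ x w)))) = T x w
    rw [eV.continuousLinearMapAt_symmL hxV, eW.continuousLinearMapAt_symmL hxW]
  · filter_upwards [hϕT, eW.open_baseSet.mem_nhds hW] with x hx hxW v
    have hv := congrArg (eW.symmL ℝ x) (hx (eW.continuousLinearMapAt ℝ x v))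
    change eW.symmL ℝ x (eW.continuousLinearMapAt ℝ x (ϕ x (eV.symmL ℝ x (T x
      (eW.continuousLinearMapAt ℝ x v))))) = _ at hv
    rwa [eW.symmL_continuousLinearMapAt hxW, eW.symmL_continuousLinearMapAt hxW] at hv

end RightInverse

section HorizontalLift

variable {EB : Type*} [NormedAddCommGroup EB] [NormedSpace ℝ EB]
  {B : Type*} [TopologicalSpace B] [ChartedSpace EB B]
  {F : Type*} [NormedAddCommGroup F] [NormedSpace ℝ F]
  {A : B → Type*} [∀ x, AddCommGroup (A x)] [∀ x, Module ℝ (A x)]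
  [∀ x, TopologicalSpace (A x)] [∀ x, IsTopologicalAddGroup (A x)] [∀ x, ContinuousSMul ℝ (A x)]
  [TopologicalSpace (TotalSpace F A)] [FiberBundle F A] [VectorBundle ℝ F A]
  {FD : Type*} [NormedAddCommGroup FD] [NormedSpace ℝ FD]
  {D : B → Type*} [∀ x, AddCommGroup (D x)] [∀ x, Module ℝ (D x)] [∀ x, TopologicalSpace (D x)]
  [TopologicalSpace (TotalSpace FD D)] [FiberBundle FD D] [VectorBundle ℝ FD D]

namespace InertiaOperator

variable {S : SmoothDual EB F A FD D} {I : InertiaOperator S}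

theorem metric_sub_left {x : B} (a b k : A x) :
    I.metric (a - b) k = I.metric a k - I.metric b k := by
  simp only [metric, map_sub, sub_apply]

variable [IsManifold 𝓘(ℝ, EB) ∞ B] {L : LieAlgebroid EB F A}

theorem eq_of_mem_horizontal (hI : I.IsPositive) {x : B} {a b : A x} (ha : a ∈ I.horizontal L x)
    (hb : b ∈ I.horizontal L x) (hab : L.anchor x a = L.anchor x b) : a = b := by
  by_contra hne
  have hker : L.anchor x (a - b) = 0 := by rw [map_sub, hab, sub_self]
  have hpos := hI x (a - b) (sub_ne_zero.2 hne)
  rw [metric_sub_left, ha _ hker, hb _ hker, sub_self] at hpos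
  exact lt_irrefl _ hpos

theorem zero_mem_horizontal (x : B) : (0 : A x) ∈ I.horizontal L x := fun k _ => by simp [metric]

theorem projection_eq_self (hI : I.IsPositive) {x : B} {P : A x →L[ℝ] A x}
    (hP : ∀ a : A x, L.anchor x (P a) = 0 ∧ a - P a ∈ I.horizontal L x) {a : A x}
    (ha : L.anchor x a = 0) : P a = a :=
  (sub_eq_zero.1 (eq_of_mem_horizontal hI (hP a).2 (zero_mem_horizontal x)
    (by rw [map_sub, (hP a).1, ha, map_zero, sub_zero]))).symm

theorem exists_mem_horizontal (hL : L.IsTransitive) (hdec : I.HasOrthogonalDecomposition L) {x : B}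
    (v : TangentSpace 𝓘(ℝ, EB) x) : ∃ a ∈ I.horizontal L x, L.anchor x a = v := by
  obtain ⟨P, -, hP⟩ := hdec
  obtain ⟨a, rfl⟩ := hL x v
  exact ⟨a - P x a, (hP x a).2, by rw [map_sub, (hP x a).1, sub_zero]⟩

theorem anchorInv_mem (hL : L.IsTransitive) (hdec : I.HasOrthogonalDecomposition L) {x : B}
    (v : TangentSpace 𝓘(ℝ, EB) x) : I.anchorInv L x v ∈ I.horizontal L x :=
  Function.invFunOn_mem (exists_mem_horizontal hL hdec v)

theorem anchor_anchorInv (hL : L.IsTransitive) (hdec : I.HasOrthogonalDecomposition L) {x : B}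
    (v : TangentSpace 𝓘(ℝ, EB) x) : L.anchor x (I.anchorInv L x v) = v :=
  Function.invFunOn_eq (exists_mem_horizontal hL hdec v)

theorem anchorInv_eq (hL : L.IsTransitive) (hI : I.IsPositive)
    (hdec : I.HasOrthogonalDecomposition L) {x : B} {v : TangentSpace 𝓘(ℝ, EB) x} {a : A x}
    (ha : a ∈ I.horizontal L x) (hav : L.anchor x a = v) : I.anchorInv L x v = a :=
  eq_of_mem_horizontal hI (anchorInv_mem hL hdec v) ha ((anchor_anchorInv hL hdec v).trans hav.symm)

theorem bijOn_anchor_horizontal (hL : L.IsTransitive) (hI : I.IsPositive)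
    (hdec : I.HasOrthogonalDecomposition L) (x : B) :
    BijOn (L.anchor x) (I.horizontal L x) univ :=
  ⟨mapsTo_univ _ _, fun _ ha _ hb hab => eq_of_mem_horizontal hI ha hb hab,
    fun v _ => exists_mem_horizontal hL hdec v⟩

/-- `g` is the metric `⟨ζ, η⟩_B = ⟨#⁻¹ζ, #⁻¹η⟩_A` on the base. -/
def InducesMetric (I : InertiaOperator S) (L : LieAlgebroid EB F A) (g : RiemannMetric EB B) :
    Prop :=
  ∀ x (ζ η : TangentSpace 𝓘(ℝ, EB) x),
    g.form x ζ η = I.metric (I.anchorInv L x ζ) (I.anchorInv L x η)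

theorem form_anchor_anchor (hL : L.IsTransitive) (hI : I.IsPositive)
    (hdec : I.HasOrthogonalDecomposition L) {g : RiemannMetric EB B} (hg : I.InducesMetric L g)
    {x : B} {a b : A x} (ha : a ∈ I.horizontal L x) (hb : b ∈ I.horizontal L x) :
    g.form x (L.anchor x a) (L.anchor x b) = I.metric a b := by
  rw [hg, anchorInv_eq hL hI hdec ha rfl, anchorInv_eq hL hI hdec hb rfl]

theorem contMDiff_metric_comp {σ : ∀ x, TangentSpace 𝓘(ℝ, EB) x →L[ℝ] A x}
    (hσ : ContMDiff 𝓘(ℝ, EB) (𝓘(ℝ, EB).prod 𝓘(ℝ, EB →L[ℝ] F)) ∞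
      (fun x => TotalSpace.mk' (EB →L[ℝ] F)
        (E := fun x => TangentSpace 𝓘(ℝ, EB) x →L[ℝ] A x) x (σ x))) :
    ContMDiff 𝓘(ℝ, EB) (𝓘(ℝ, EB).prod 𝓘(ℝ, EB →L[ℝ] EB →L[ℝ] ℝ)) ∞
      (fun x => TotalSpace.mk' (EB →L[ℝ] EB →L[ℝ] ℝ)
        (E := fun x => TangentSpace 𝓘(ℝ, EB) x →L[ℝ] TangentSpace 𝓘(ℝ, EB) x →L[ℝ] ℝ) x
        ((ContinuousLinearMap.precomp ℝ (σ x)).comp ((S.pairing x).comp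
          ((I.toEquiv x : A x →L[ℝ] D x).comp (σ x))))) := by
  intro x₀
  apply contMDiffAt_hom_hom_of_uncurry (E₃ := Bundle.Trivial B ℝ)
  have hbase : ContMDiffAt ((𝓘(ℝ, EB).prod 𝓘(ℝ, EB)).prod 𝓘(ℝ, EB)) 𝓘(ℝ, EB) ∞
      (fun q : (B × EB) × EB => q.1.1) ((x₀, 0), 0) := contMDiffAt_fst.comp _ contMDiffAt_fst
  have hlift {w : (B × EB) × EB → EB}
      (hw : ContMDiffAt ((𝓘(ℝ, EB).prod 𝓘(ℝ, EB)).prod 𝓘(ℝ, EB)) 𝓘(ℝ, EB) ∞ w ((x₀, 0), 0)) :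
      ContMDiffAt ((𝓘(ℝ, EB).prod 𝓘(ℝ, EB)).prod 𝓘(ℝ, EB)) (𝓘(ℝ, EB).prod 𝓘(ℝ, F)) ∞
        (fun q => TotalSpace.mk' F q.1.1 (σ q.1.1
          ((trivializationAt EB (TangentSpace 𝓘(ℝ, EB)) x₀).symm q.1.1 (w q)))) ((x₀, 0), 0) :=
    ((hσ x₀).comp ((x₀, (0 : EB)), (0 : EB)) hbase).clm_bundle_apply
      (contMDiffWithinAt_mk_trivialization_symm hbase hw
        (FiberBundle.mem_baseSet_trivializationAt' x₀))
  exact contMDiffAt_totalSpace.2 ⟨hbase, S.contMDiffWithinAt_pairing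
    ((I.contMDiff _).comp _ (hlift (contMDiffAt_snd.comp _ contMDiffAt_fst)))
    (hlift contMDiffAt_snd)⟩

variable [CompleteSpace EB] [CompleteSpace F]

theorem exists_rightInverse_anchor (hL : L.IsTransitive) (hI : I.IsPositive) {x : B}
    {P : A x →L[ℝ] A x} (hP : ∀ a : A x, L.anchor x (P a) = 0 ∧ a - P a ∈ I.horizontal L x) :
    ∃ R : TangentSpace 𝓘(ℝ, EB) x →L[ℝ] A x, ∀ v, L.anchor x (R v) = v := by
  let e : A x ≃L[ℝ] F := (trivializationAt F A x).continuousLinearEquivAt ℝ x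
    (FiberBundle.mem_baseSet_trivializationAt' x)
  let T : F →L[ℝ] EB := (L.anchor x : A x →L[ℝ] EB).comp (e.symm : F →L[ℝ] A x)
  have hsurjective : Function.Surjective T := (hL x).comp e.symm.surjective
  obtain ⟨R, hR⟩ := exists_continuous_rightInverse hsurjective
    (P := (e : A x →L[ℝ] F).comp (P.comp (e.symm : F →L[ℝ] A x)))
    (fun w => (congrArg (L.anchor x) (e.symm_apply_apply _)).trans (hP _).1)
    (fun w hw => (congrArg e (projection_eq_self hI hP hw)).trans (e.apply_symm_apply w))
  exact ⟨(e.symm : F →L[ℝ] A x).comp R, hR⟩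

theorem exists_contMDiffAt_anchorInv (hL : L.IsTransitive)
    (hI : I.IsPositive) (hdec : I.HasOrthogonalDecomposition L) (x₀ : B) :
    ∃ τ : ∀ x, TangentSpace 𝓘(ℝ, EB) x →L[ℝ] A x,
      ContMDiffAt 𝓘(ℝ, EB) (𝓘(ℝ, EB).prod 𝓘(ℝ, EB →L[ℝ] F)) ∞
        (fun x => TotalSpace.mk' (EB →L[ℝ] F)
          (E := fun x => TangentSpace 𝓘(ℝ, EB) x →L[ℝ] A x) x (τ x)) x₀ ∧
      ∀ᶠ x in 𝓝 x₀, ∀ v, τ x v = I.anchorInv L x v := by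
  have ⟨P, hPs, hP⟩ := hdec
  obtain ⟨R, hR⟩ := exists_rightInverse_anchor hL hI (hP x₀)
  obtain ⟨τ, hτ, hτ_anchor⟩ := exists_contMDiffAt_hom_rightInverse (L.contMDiff_anchor x₀) hR
  refine ⟨fun x => (ContinuousLinearMap.id ℝ (A x) - P x).comp (τ x),
    contMDiffAt_hom_comp ((contMDiff_hom_id x₀).sub_section (hPs x₀)) hτ, ?_⟩
  filter_upwards [hτ_anchor] with x hx v
  refine (anchorInv_eq hL hI hdec (hP x (τ x v)).2 ?_).symm
  rw [map_sub, (hP x _).1, sub_zero, hx]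

theorem exists_horizontalLift (hL : L.IsTransitive) (hI : I.IsPositive)
    (hdec : I.HasOrthogonalDecomposition L) :
    ∃ σ : ∀ x, TangentSpace 𝓘(ℝ, EB) x →L[ℝ] A x,
      ContMDiff 𝓘(ℝ, EB) (𝓘(ℝ, EB).prod 𝓘(ℝ, EB →L[ℝ] F)) ∞
        (fun x => TotalSpace.mk' (EB →L[ℝ] F)
          (E := fun x => TangentSpace 𝓘(ℝ, EB) x →L[ℝ] A x) x (σ x)) ∧
      ∀ x v, σ x v = I.anchorInv L x v := by
  choose τ hτ hτ_eq using exists_contMDiffAt_anchorInv hL hI hdec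
  refine ⟨fun x => τ x x, fun x₀ => (hτ x₀).congr_of_eventuallyEq ?_,
    fun x => (hτ_eq x).self_of_nhds⟩
  filter_upwards [hτ_eq x₀] with x hx
  congr 1
  ext v
  rw [hx, (hτ_eq x).self_of_nhds]

theorem smoothSectionOn_anchorInv (hL : L.IsTransitive) (hI : I.IsPositive)
    (hdec : I.HasOrthogonalDecomposition L) {X : ∀ x, TangentSpace 𝓘(ℝ, EB) x} {U : Set B}
    (hX : SmoothSectionOn EB EB X U) :
    SmoothSectionOn EB F (fun x => I.anchorInv L x (X x)) U := by
  obtain ⟨σ, hσ_smooth, hσ⟩ := exists_horizontalLift hL hI hdec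
  simp only [← hσ]
  exact fun x hx => ContMDiffWithinAt.clm_bundle_apply (F₁ := EB) (F₂ := F)
    (E₁ := TangentSpace 𝓘(ℝ, EB)) (E₂ := A) (b := fun x => x)
    hσ_smooth.contMDiffAt.contMDiffWithinAt (hX x hx)

theorem exists_inducesMetric (hL : L.IsTransitive) (hI : I.IsPositive)
    (hdec : I.HasOrthogonalDecomposition L) : ∃ g : RiemannMetric EB B, I.InducesMetric L g := by
  obtain ⟨σ, hσs, hσ⟩ := exists_horizontalLift hL hI hdec
  refine ⟨⟨_, fun x v w => I.symm x (σ x v) (σ x w), fun x v hv => hI x (σ x v) fun hσv => hv ?_,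
    contMDiff_metric_comp (I := I) hσs⟩, fun x ζ η => ?_⟩
  · rw [← anchor_anchorInv (I := I) hL hdec v, ← hσ, hσv, map_zero]
  · exact congrArg₂ I.metric (hσ x ζ) (hσ x η)

end InertiaOperator

end HorizontalLift

section LinearEquation

variable {E G : Type*} [NormedAddCommGroup E] [NormedSpace ℝ E]
  [NormedAddCommGroup G] [NormedSpace ℝ G]

theorem exists_opNorm_le_of_continuousOn_apply [CompleteSpace E] {X : Type*}
    [TopologicalSpace X] {K : Set X} (hK : IsCompact K) {T : X → E →L[ℝ] G}
    (hT : ∀ k, ContinuousOn (fun x => T x k) K) : ∃ C, ∀ x ∈ K, ‖T x‖ ≤ C := by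
  obtain ⟨C, hC⟩ := banach_steinhaus (g := fun x : K => T x) fun k =>
    (hK.exists_bound_of_continuousOn (hT k)).imp fun _ hM x => hM x x.2
  exact ⟨C, fun x hx => hC ⟨x, hx⟩⟩

theorem exists_norm_le_of_forall_functional {ι : Type*} {v : ι → E}
    (hv : ∀ l : E →L[ℝ] ℝ, ∃ C, ∀ i, ‖l (v i)‖ ≤ C) : ∃ C, ∀ i, ‖v i‖ ≤ C := by
  obtain ⟨C, hC⟩ := banach_steinhaus (g := fun i => NormedSpace.inclusionInDoubleDual ℝ E (v i)) hv
  exact ⟨C, fun i => ((NormedSpace.inclusionInDoubleDualLi ℝ).norm_map (v i)).symm.trans_le (hC i)⟩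

variable {Q : ℝ → E →L[ℝ] G} {m : ℝ → E → E}

theorem opNorm_le_half_of_hasDerivAt {T : Set ℝ} (hT : Convex ℝ T)
    (hQ : ∀ t ∈ T, ∀ k, HasDerivAt (fun s => Q s k) (Q t (m t k)) t) {C M : ℝ}
    (hm : ∀ t ∈ T, ∀ k, ‖k‖ ≤ 1 → ‖m t k‖ ≤ C) {s : ℝ} (hs : s ∈ T) (hQs : Q s = 0)
    (hC : ∀ t ∈ T, C * ‖t - s‖ ≤ 1 / 2) (hM : ∀ t ∈ T, ‖Q t‖ ≤ M) {t : ℝ} (ht : t ∈ T) :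
    ‖Q t‖ ≤ M / 2 := by
  have hM₀ : 0 ≤ M := (norm_nonneg _).trans (hM s hs)
  refine ContinuousLinearMap.opNorm_le_of_unit_norm (by positivity) fun k hk => ?_
  have hmean := hT.norm_image_sub_le_of_norm_hasDerivWithin_le (f := fun s => Q s k) (C := M * C)
    (fun u hu => (hQ u hu k).hasDerivWithinAt)
    (fun u hu => ((Q u).le_opNorm _).trans (mul_le_mul (hM u hu) (hm u hu k hk.le)
      (norm_nonneg _) hM₀)) hs ht
  rw [hQs, zero_apply, sub_zero] at hmean
  calc ‖Q t k‖ ≤ M * (C * ‖t - s‖) := by rwa [← mul_assoc]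
    _ ≤ M * (1 / 2) := by gcongr; exact hC t ht
    _ = M / 2 := by ring

theorem eq_zero_of_hasDerivAt_of_mul_norm_sub_le {T : Set ℝ} (hT : Convex ℝ T)
    (hQ : ∀ t ∈ T, ∀ k, HasDerivAt (fun s => Q s k) (Q t (m t k)) t) {C M : ℝ}
    (hm : ∀ t ∈ T, ∀ k, ‖k‖ ≤ 1 → ‖m t k‖ ≤ C) {s : ℝ} (hs : s ∈ T) (hQs : Q s = 0)
    (hC : ∀ t ∈ T, C * ‖t - s‖ ≤ 1 / 2) (hM : ∀ t ∈ T, ‖Q t‖ ≤ M) {t : ℝ} (ht : t ∈ T) :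
    Q t = 0 := by
  have hgeometric : ∀ n : ℕ, ∀ t ∈ T, ‖Q t‖ ≤ M * (1 / 2) ^ n := by
    intro n
    induction n with
    | zero => simpa using hM
    | succ n ih =>
      intro t ht
      exact (opNorm_le_half_of_hasDerivAt hT hQ hm hs hQs hC ih ht).trans_eq (by ring)
  have hlim : Filter.Tendsto (fun n : ℕ => M * (1 / 2 : ℝ) ^ n) Filter.atTop (𝓝 (M * 0)) :=
    (tendsto_pow_atTop_nhds_zero_of_lt_one (by norm_num) (by norm_num)).const_mul M
  rw [mul_zero] at hlim
  exact norm_le_zero_iff.1 (ge_of_tendsto' hlim fun n => hgeometric n t ht)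

theorem exists_nhds_forall_eq_zero_of_hasDerivAt [CompleteSpace E] {t₀ r C : ℝ} (hr : 0 < r)
    (hQ : ∀ t ∈ Metric.closedBall t₀ r, ∀ k, HasDerivAt (fun s => Q s k) (Q t (m t k)) t)
    (hm : ∀ t ∈ Metric.closedBall t₀ r, ∀ k, ‖k‖ ≤ 1 → ‖m t k‖ ≤ C) :
    ∃ N ∈ 𝓝 t₀, ∀ s ∈ N, Q s = 0 → ∀ t ∈ N, Q t = 0 := by
  obtain ⟨M, hM⟩ := exists_opNorm_le_of_continuousOn_apply (isCompact_closedBall t₀ r)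
    fun k t ht => (hQ t ht k).continuousAt.continuousWithinAt
  have hC₀ : 0 ≤ C := (norm_nonneg _).trans (hm t₀ (Metric.mem_closedBall_self hr.le) 0 (by simp))
  set δ := min r (1 / (4 * (C + 1)))
  have hδ : 0 < δ := lt_min hr (by positivity)
  have hsub : Metric.closedBall t₀ δ ⊆ Metric.closedBall t₀ r :=
    Metric.closedBall_subset_closedBall (min_le_left _ _)
  have hCδ : C * (2 * δ) ≤ 1 / 2 := by
    have hδC : δ ≤ 1 / (4 * (C + 1)) := min_le_right _ _
    rw [le_div_iff₀ (by positivity)] at hδC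
    nlinarith
  refine ⟨Metric.closedBall t₀ δ, Metric.closedBall_mem_nhds _ hδ, fun s hs hQs t ht =>
    eq_zero_of_hasDerivAt_of_mul_norm_sub_le (convex_closedBall t₀ δ)
      (fun t ht => hQ t (hsub ht)) (fun t ht => hm t (hsub ht)) hs hQs (fun t ht => ?_)
      (fun t ht => hM t (hsub ht)) ht⟩
  have hdist : ‖t - s‖ ≤ 2 * δ := by
    rw [← dist_eq_norm]
    linarith [dist_triangle_right t s t₀, Metric.mem_closedBall.1 ht, Metric.mem_closedBall.1 hs]
  exact (mul_le_mul_of_nonneg_left hdist hC₀).trans hCδ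

end LinearEquation

section KernelSections

variable {EB : Type*} [NormedAddCommGroup EB] [NormedSpace ℝ EB]
  {B : Type*} [TopologicalSpace B] [ChartedSpace EB B]
  {F : Type*} [NormedAddCommGroup F] [NormedSpace ℝ F]
  {A : B → Type*} [∀ x, AddCommGroup (A x)] [∀ x, Module ℝ (A x)] [∀ x, TopologicalSpace (A x)]
  [TopologicalSpace (TotalSpace F A)] [FiberBundle F A] [VectorBundle ℝ F A]

/-- The expression of a field `P` of endomorphisms of `A` in the trivialization `e`. -/
noncomputable def coordEndomorphism (P : ∀ x, A x →L[ℝ] A x) (e : Trivialization F (π F A))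
    [MemTrivializationAtlas e] (x : B) : F →L[ℝ] F :=
  (e.continuousLinearMapAt ℝ x).comp ((P x).comp (e.symmL ℝ x))

theorem continuousOn_twoForm_apply {Ω : ∀ x, A x →L[ℝ] A x →L[ℝ] ℝ} {η : ∀ x, A x} {U : Set B}
    (hΩ : ContMDiffOn 𝓘(ℝ, EB) (𝓘(ℝ, EB).prod 𝓘(ℝ, F →L[ℝ] F →L[ℝ] ℝ)) ∞
      (fun x => TotalSpace.mk' (F →L[ℝ] F →L[ℝ] ℝ) x (Ω x)) U) (hη : SmoothSectionOn EB F η U) :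
    ContinuousOn (fun v : TotalSpace F A => Ω v.proj v.2 (η v.proj)) (π F A ⁻¹' U) := by
  have hsmooth : ContMDiffOn (𝓘(ℝ, EB).prod 𝓘(ℝ, F)) (𝓘(ℝ, EB).prod 𝓘(ℝ, ℝ)) ∞
      (fun v : TotalSpace F A => TotalSpace.mk' ℝ (E := Bundle.Trivial B ℝ) v.proj
        (Ω v.proj v.2 (η v.proj))) (π F A ⁻¹' U) := fun v hv => by
    apply ContMDiffWithinAt.clm_bundle_apply₂ (F₁ := F) (F₂ := F)
    · exact (hΩ.comp (Bundle.contMDiff_proj A).contMDiffOn fun _ h => h) v hv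
    · exact contMDiffWithinAt_id
    · exact hη.contMDiffOn_comp_proj v hv
  exact fun v hv => (contMDiffWithinAt_totalSpace.1 (hsmooth v hv)).2.continuousWithinAt

variable [ContMDiffVectorBundle ∞ F A 𝓘(ℝ, EB)]

theorem contMDiffOn_functional_comp_trivialization [IsManifold 𝓘(ℝ, EB) ∞ B] (x₀ : B)
    (l : F →L[ℝ] ℝ) :
    ContMDiffOn 𝓘(ℝ, EB) (𝓘(ℝ, EB).prod 𝓘(ℝ, F →L[ℝ] ℝ)) ∞
      (fun y => TotalSpace.mk' (F →L[ℝ] ℝ) (E := fun y => A y →L[ℝ] ℝ) y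
        (l.comp ((trivializationAt F A x₀).continuousLinearMapAt ℝ y)))
      (trivializationAt F A x₀).baseSet := by
  intro y₀ hy₀
  set e := trivializationAt F A x₀
  refine ContMDiffAt.contMDiffWithinAt (contMDiffAt_hom_of_uncurry (F₁ := F) (E₁ := A) (F₂ := ℝ)
    (E₂ := Bundle.Trivial B ℝ) (b := fun x : B => x) contMDiffAt_id
    (contMDiffAt_totalSpace.2 ⟨contMDiffAt_fst, ?_⟩))
  have hsymm : ContMDiffAt (𝓘(ℝ, EB).prod 𝓘(ℝ, F)) (𝓘(ℝ, EB).prod 𝓘(ℝ, F)) ∞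
      (fun q : B × F => TotalSpace.mk' F q.1 ((trivializationAt F A y₀).symm q.1 q.2)) (y₀, 0) :=
    contMDiffWithinAt_mk_trivialization_symm contMDiffAt_fst contMDiffAt_snd
      (FiberBundle.mem_baseSet_trivializationAt' y₀)
  have he : ContMDiffAt (𝓘(ℝ, EB).prod 𝓘(ℝ, F)) (𝓘(ℝ, EB).prod 𝓘(ℝ, F)) ∞ e
      (TotalSpace.mk' F y₀ ((trivializationAt F A y₀).symm y₀ 0)) :=
    (e.contMDiffOn (IB := 𝓘(ℝ, EB)) (n := ∞)).contMDiffAt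
      (e.open_source.mem_nhds (e.mem_source.2 hy₀))
  refine (l.contMDiff.contMDiffAt.comp (y₀, (0 : F))
    ((contMDiffAt_snd.comp _ he).comp (y₀, (0 : F)) hsymm)).congr_of_eventuallyEq ?_
  filter_upwards [continuousAt_fst.preimage_mem_nhds (e.open_baseSet.mem_nhds hy₀)] with q hq
  change l (e.continuousLinearMapAt ℝ q.1 _) = l (e _).2
  rw [e.continuousLinearMapAt_apply (R := ℝ), e.coe_linearMapAt_of_mem (R := ℝ) hq]

variable [∀ x, IsTopologicalAddGroup (A x)] [∀ x, ContinuousSMul ℝ (A x)]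
  {P : ∀ x, A x →L[ℝ] A x}

theorem contMDiffOn_coordEndomorphism
    (hP : ContMDiff 𝓘(ℝ, EB) (𝓘(ℝ, EB).prod 𝓘(ℝ, F →L[ℝ] F)) ∞
      (fun x => TotalSpace.mk' (F →L[ℝ] F) (E := fun x => A x →L[ℝ] A x) x (P x))) (x₀ : B) :
    ContMDiffOn 𝓘(ℝ, EB) 𝓘(ℝ, F →L[ℝ] F) ∞ (coordEndomorphism P (trivializationAt F A x₀))
      (trivializationAt F A x₀).baseSet := by
  have hcoord := (trivializationAt (F →L[ℝ] F) (fun x => A x →L[ℝ] A x)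
    x₀).contMDiffOn_section_baseSet_iff (IB := 𝓘(ℝ, EB)) (n := ∞) (s := P)
  rw [hom_trivializationAt_baseSet, inter_self] at hcoord
  refine (hcoord.1 hP.contMDiffOn).congr fun x _ => ?_
  rw [hom_trivializationAt_apply]
  rfl

theorem smoothSectionOn_projection_trivialization_symm
    (hP : ContMDiff 𝓘(ℝ, EB) (𝓘(ℝ, EB).prod 𝓘(ℝ, F →L[ℝ] F)) ∞
      (fun x => TotalSpace.mk' (F →L[ℝ] F) (E := fun x => A x →L[ℝ] A x) x (P x)))
    (e : Trivialization F (π F A)) [MemTrivializationAtlas e] (k : F) :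
    SmoothSectionOn EB F (fun y => P y (e.symm y k)) e.baseSet := fun y hy =>
  ContMDiffWithinAt.clm_bundle_apply (F₁ := F) (F₂ := F) (E₁ := A) (E₂ := A) (b := fun x => x)
    hP.contMDiffAt.contMDiffWithinAt (smoothSectionOn_trivialization_symm e k y hy)

theorem dirDeriv_functional_projection_trivialization_symm
    (hP : ContMDiff 𝓘(ℝ, EB) (𝓘(ℝ, EB).prod 𝓘(ℝ, F →L[ℝ] F)) ∞
      (fun x => TotalSpace.mk' (F →L[ℝ] F) (E := fun x => A x →L[ℝ] A x) x (P x)))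
    {x₀ x : B} (hx : x ∈ (trivializationAt F A x₀).baseSet) (v : TangentSpace 𝓘(ℝ, EB) x)
    (l : F →L[ℝ] ℝ) (k : F) :
    dirDeriv v (fun y => l ((trivializationAt F A x₀).continuousLinearMapAt ℝ y
        (P y ((trivializationAt F A x₀).symm y k)))) =
      l (ContinuousLinearMap.apply ℝ F k (mfderiv 𝓘(ℝ, EB) 𝓘(ℝ, F →L[ℝ] F)
        (coordEndomorphism P (trivializationAt F A x₀)) x v)) := by
  set e := trivializationAt F A x₀
  have hU := e.open_baseSet.mem_nhds hx
  refine Eq.trans (dirDeriv_congr v ?_) (dirDeriv_clm_comp v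
    (((contMDiffOn_coordEndomorphism hP x₀).contMDiffAt hU).mdifferentiableAt (by simp))
    (l.comp (ContinuousLinearMap.apply ℝ F k)))
  filter_upwards [hU] with y hy
  change _ = l (e.continuousLinearMapAt ℝ y (P y (e.symmL ℝ y k)))
  rw [e.symmL_apply hy]

variable [IsManifold 𝓘(ℝ, EB) ∞ B]

namespace LieAlgebroid

variable (L : LieAlgebroid EB F A)

/-- The coordinate expression, in the trivialization `e`, of the bracket of the section with
constant coordinates through `v` and of the image under `P` of the section with constant
coordinates `k`. When `P` projects to the kernel of the anchor, these are the coefficients of the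
linear equation satisfied along Hamiltonian trajectories by the restriction of the momentum to the
kernel. -/
noncomputable def kernelBracket (P : ∀ x, A x →L[ℝ] A x) (e : Trivialization F (π F A))
    [MemTrivializationAtlas e] (v : TotalSpace F A) (k : F) : F :=
  e.continuousLinearMapAt ℝ v.proj (L.bracket
    (fun y => e.symm y (e.continuousLinearMapAt ℝ v.proj v.2)) (fun y => P y (e.symm y k)) v.proj)

theorem exists_clm_eq_functional_kernelBracket
    (hP : ContMDiff 𝓘(ℝ, EB) (𝓘(ℝ, EB).prod 𝓘(ℝ, F →L[ℝ] F)) ∞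
      (fun x => TotalSpace.mk' (F →L[ℝ] F) (E := fun x => A x →L[ℝ] A x) x (P x)))
    (hker : ∀ x (a : A x), L.anchor x (P x a) = 0) (x₀ : B) (l : F →L[ℝ] ℝ) :
    ∃ R : TotalSpace F A → F →L[ℝ] ℝ,
      (∀ k, ContinuousOn (fun v => R v k) (π F A ⁻¹' (trivializationAt F A x₀).baseSet)) ∧
      ∀ v, v.proj ∈ (trivializationAt F A x₀).baseSet →
        ∀ k, R v k = l (L.kernelBracket P (trivializationAt F A x₀) v k) := by
  set e := trivializationAt F A x₀
  obtain ⟨Ω, hΩ, hΩe⟩ := L.differential_smooth e.baseSet e.open_baseSet _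
    (contMDiffOn_functional_comp_trivialization x₀ l)
  let dP : TotalSpace F A → F →L[ℝ] F := fun v =>
    mfderiv 𝓘(ℝ, EB) 𝓘(ℝ, F →L[ℝ] F) (coordEndomorphism P e) v.proj (L.anchor v.proj v.2)
  have hdP : ContinuousOn dP (π F A ⁻¹' e.baseSet) :=
    (contMDiffOn_mfderiv_apply e.open_baseSet (contMDiffOn_coordEndomorphism hP x₀) (b := π F A)
      (v := fun v => L.anchor v.proj v.2) (fun _ hv => hv)
      L.contMDiff_anchor_totalSpace.contMDiffOn).continuousOn
  let R : TotalSpace F A → F →L[ℝ] ℝ := fun v =>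
    l.comp (dP v) - (Ω v.proj v.2).comp ((P v.proj).comp (e.symmL ℝ v.proj))
  have hR : ∀ v : TotalSpace F A, v.proj ∈ e.baseSet → ∀ k,
      R v k = l (dP v k) - Ω v.proj v.2 (P v.proj (e.symm v.proj k)) := fun v hv k => by
    change l (dP v k) - Ω v.proj v.2 (P v.proj (e.symmL ℝ v.proj k)) = _
    rw [e.symmL_apply hv]
  refine ⟨R, fun k => ?_, fun v hv k => ?_⟩
  · refine ContinuousOn.congr (ContinuousOn.sub ?_ (continuousOn_twoForm_apply hΩ
      (smoothSectionOn_projection_trivialization_symm hP e k))) fun v hv => hR v hv k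
    exact (l.comp (ContinuousLinearMap.apply ℝ F k)).continuous.comp_continuousOn hdP
  · have hv_symm : e.symm v.proj (e.continuousLinearMapAt ℝ v.proj v.2) = v.2 := by
      rw [← e.symmL_apply (R := ℝ) hv, e.symmL_continuousLinearMapAt hv]
    have hdifferential := hΩe e.baseSet e.open_baseSet subset_rfl _ _
      (smoothSectionOn_trivialization_symm e (e.continuousLinearMapAt ℝ v.proj v.2))
      (smoothSectionOn_projection_trivialization_symm hP e k) v.proj hv
    simp only [algebroidDifferential, hker, dirDeriv_zero_left, sub_zero, hv_symm,
      ContinuousLinearMap.comp_apply] at hdifferential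
    have hderiv : dirDeriv (L.anchor v.proj v.2) (fun y => l (e.continuousLinearMapAt ℝ y
        (P y (e.symm y k)))) = l (dP v k) :=
      dirDeriv_functional_projection_trivialization_symm hP hv _ l k
    rw [hR v hv, ← hdifferential, ← hderiv, sub_add_eq_sub_sub_swap, sub_self, zero_sub, neg_neg]
    rfl

theorem exists_norm_kernelBracket_le [CompleteSpace F]
    (hP : ContMDiff 𝓘(ℝ, EB) (𝓘(ℝ, EB).prod 𝓘(ℝ, F →L[ℝ] F)) ∞
      (fun x => TotalSpace.mk' (F →L[ℝ] F) (E := fun x => A x →L[ℝ] A x) x (P x)))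
    (hker : ∀ x (a : A x), L.anchor x (P x a) = 0) {x₀ : B} {K : Set (TotalSpace F A)}
    (hK : IsCompact K) (hKU : K ⊆ π F A ⁻¹' (trivializationAt F A x₀).baseSet) :
    ∃ C, ∀ v ∈ K, ∀ k, ‖k‖ ≤ 1 → ‖L.kernelBracket P (trivializationAt F A x₀) v k‖ ≤ C := by
  obtain ⟨C, hC⟩ := exists_norm_le_of_forall_functional
    (v := fun i : K × Metric.closedBall (0 : F) 1 =>
      L.kernelBracket P (trivializationAt F A x₀) i.1 i.2) fun l => by
    obtain ⟨R, hR, hRl⟩ := L.exists_clm_eq_functional_kernelBracket hP hker x₀ l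
    obtain ⟨C, hC⟩ := exists_opNorm_le_of_continuousOn_apply hK fun k => (hR k).mono hKU
    refine ⟨C, fun ⟨⟨v, hv⟩, ⟨k, hk⟩⟩ => ?_⟩
    rw [← hRl v (hKU hv)]
    exact ((R v).unit_le_opNorm k (mem_closedBall_zero_iff.1 hk)).trans (hC v hv)
  exact ⟨C, fun v hv k hk => hC (⟨v, hv⟩, ⟨k, mem_closedBall_zero_iff.2 hk⟩)⟩

end LieAlgebroid

end KernelSections

section InvariantImage

variable {EB : Type*} [NormedAddCommGroup EB] [NormedSpace ℝ EB]
  {B : Type*} [TopologicalSpace B] [ChartedSpace EB B] [IsManifold 𝓘(ℝ, EB) ∞ B]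
  {F : Type*} [NormedAddCommGroup F] [NormedSpace ℝ F]
  {A : B → Type*} [∀ x, AddCommGroup (A x)] [∀ x, Module ℝ (A x)]
  [∀ x, TopologicalSpace (A x)] [∀ x, IsTopologicalAddGroup (A x)] [∀ x, ContinuousSMul ℝ (A x)]
  [TopologicalSpace (TotalSpace F A)] [FiberBundle F A] [VectorBundle ℝ F A]
  {FD : Type*} [NormedAddCommGroup FD] [NormedSpace ℝ FD]
  {D : B → Type*} [∀ x, AddCommGroup (D x)] [∀ x, Module ℝ (D x)] [∀ x, TopologicalSpace (D x)]
  [TopologicalSpace (TotalSpace FD D)] [FiberBundle FD D] [VectorBundle ℝ FD D]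

namespace InertiaOperator

variable {L : LieAlgebroid EB F A} {S : SmoothDual EB F A FD D} {I : InertiaOperator S}

theorem mem_dualAnchorImage_iff [CompleteSpace EB] [CompleteSpace F] (hL : L.IsTransitive)
    (hI : I.IsPositive) (hdec : I.HasOrthogonalDecomposition L) {ξ : TotalSpace FD D} :
    ξ ∈ L.dualAnchorImage S ↔
      ∀ k : A ξ.proj, L.anchor ξ.proj k = 0 → S.pairing ξ.proj ξ.2 k = 0 := by
  constructor
  · rintro ⟨p, hp⟩ k hk
    rw [hp, hk, map_zero]
  · intro hξ
    obtain ⟨σ, -, hσ⟩ := exists_horizontalLift hL hI hdec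
    refine ⟨(S.pairing ξ.proj ξ.2).comp (σ ξ.proj), fun a => ?_⟩
    have hvertical : S.pairing ξ.proj ξ.2 (a - σ ξ.proj (L.anchor ξ.proj a)) = 0 :=
      hξ _ (by rw [map_sub, hσ, anchor_anchorInv hL hdec, sub_self])
    rw [map_sub, sub_eq_zero] at hvertical
    exact hvertical

theorem mem_dualAnchorImage_iff_comp_projection_eq_zero [CompleteSpace EB] [CompleteSpace F]
    (hL : L.IsTransitive) (hI : I.IsPositive) (hdec : I.HasOrthogonalDecomposition L)
    {ξ : TotalSpace FD D} {P : A ξ.proj →L[ℝ] A ξ.proj}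
    (hP : ∀ a, L.anchor ξ.proj (P a) = 0 ∧ a - P a ∈ I.horizontal L ξ.proj)
    {e : Trivialization F (π F A)} [MemTrivializationAtlas e] (hξ : ξ.proj ∈ e.baseSet) :
    ξ ∈ L.dualAnchorImage S ↔
      (S.pairing ξ.proj ξ.2).comp (P.comp (e.symmL ℝ ξ.proj)) = 0 := by
  rw [mem_dualAnchorImage_iff hL hI hdec]
  refine ⟨fun hker => ContinuousLinearMap.ext fun k => hker _ (hP _).1, fun hzero a ha => ?_⟩
  have hcoord := DFunLike.congr_fun hzero (e.continuousLinearMapAt ℝ ξ.proj a)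
  simp only [ContinuousLinearMap.comp_apply, e.symmL_continuousLinearMapAt hξ] at hcoord
  rwa [projection_eq_self hI hP ha] at hcoord

variable [ContMDiffVectorBundle ∞ F A 𝓘(ℝ, EB)]

theorem projection_symmL_kernelBracket (hL : L.IsTransitive) (hI : I.IsPositive)
    {P : ∀ x, A x →L[ℝ] A x}
    (hPs : ContMDiff 𝓘(ℝ, EB) (𝓘(ℝ, EB).prod 𝓘(ℝ, F →L[ℝ] F)) ∞
      (fun x => TotalSpace.mk' (F →L[ℝ] F) (E := fun x => A x →L[ℝ] A x) x (P x)))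
    (hP : ∀ x (a : A x), L.anchor x (P x a) = 0 ∧ a - P x a ∈ I.horizontal L x)
    {e : Trivialization F (π F A)} [MemTrivializationAtlas e] {v : TotalSpace F A}
    (hv : v.proj ∈ e.baseSet) (k : F) :
    P v.proj (e.symmL ℝ v.proj (L.kernelBracket P e v k)) =
      L.bracket (fun y => e.symm y (e.continuousLinearMapAt ℝ v.proj v.2))
        (fun y => P y (e.symm y k)) v.proj := by
  rw [LieAlgebroid.kernelBracket, e.symmL_continuousLinearMapAt hv,
    projection_eq_self hI (hP v.proj) (L.anchor_bracket_eq_zero_of_anchor_eq_zero hL e.open_baseSet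
      (smoothSectionOn_trivialization_symm e _)
      (smoothSectionOn_projection_trivialization_symm hPs e k) (fun x _ => (hP x _).1) hv)]

variable [ContMDiffVectorBundle ∞ FD D 𝓘(ℝ, EB)]

theorem poissonBracket_linearFunction_projection (hL : L.IsTransitive) (hI : I.IsPositive)
    {P : ∀ x, A x →L[ℝ] A x}
    (hPs : ContMDiff 𝓘(ℝ, EB) (𝓘(ℝ, EB).prod 𝓘(ℝ, F →L[ℝ] F)) ∞
      (fun x => TotalSpace.mk' (F →L[ℝ] F) (E := fun x => A x →L[ℝ] A x) x (P x)))
    (hP : ∀ x (a : A x), L.anchor x (P x a) = 0 ∧ a - P x a ∈ I.horizontal L x)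
    {e : Trivialization F (π F A)} [MemTrivializationAtlas e] {ξ : TotalSpace FD D}
    (hξ : ξ.proj ∈ e.baseSet) {h : TotalSpace FD D → ℝ}
    (hh : MDifferentiableAt (𝓘(ℝ, EB).prod 𝓘(ℝ, FD)) 𝓘(ℝ, ℝ) h ξ) {a : A ξ.proj}
    (ha : S.HasFiberDifferentialAt h ξ a) (k : F) :
    L.poissonBracket S h (S.linearFunction fun y => P y (e.symm y k)) ξ =
      S.pairing ξ.proj ξ.2 (P ξ.proj (e.symmL ℝ ξ.proj (L.kernelBracket P e ⟨ξ.proj, a⟩ k))) := by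
  obtain ⟨U, hU, hξU, s, hs, hsξ⟩ := exists_smoothSectionOn_apply_eq (EB := EB) (F := FD) ξ.2
  have ha_symm : e.symm ξ.proj (e.continuousLinearMapAt ℝ ξ.proj a) = a := by
    rw [← e.symmL_apply (R := ℝ) hξ, e.symmL_continuousLinearMapAt hξ]
  rw [projection_symmL_kernelBracket hL hI hPs hP (v := ⟨ξ.proj, a⟩) hξ,
    L.poissonBracket_linearFunction hh (e.open_baseSet.inter hU) ⟨hξ, hξU⟩
      ((smoothSectionOn_trivialization_symm e (e.continuousLinearMapAt ℝ ξ.proj a)).mono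
        inter_subset_left)
      ((smoothSectionOn_projection_trivialization_symm hPs e k).mono inter_subset_left)
      (by rwa [ha_symm]) (hs.mono inter_subset_right) hsξ,
    (hP ξ.proj _).1, dirDeriv_zero_left, sub_zero]

theorem hasDerivAt_pairing_projection (hL : L.IsTransitive) (hI : I.IsPositive)
    {P : ∀ x, A x →L[ℝ] A x}
    (hPs : ContMDiff 𝓘(ℝ, EB) (𝓘(ℝ, EB).prod 𝓘(ℝ, F →L[ℝ] F)) ∞
      (fun x => TotalSpace.mk' (F →L[ℝ] F) (E := fun x => A x →L[ℝ] A x) x (P x)))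
    (hP : ∀ x (a : A x), L.anchor x (P x a) = 0 ∧ a - P x a ∈ I.horizontal L x)
    {e : Trivialization F (π F A)} [MemTrivializationAtlas e] {h : TotalSpace FD D → ℝ}
    {γ : ℝ → TotalSpace FD D} {J : Set ℝ} (hγ : L.IsHamiltonianTrajectory S h γ J) {t : ℝ}
    (ht : t ∈ J) (hγt : (γ t).proj ∈ e.baseSet)
    (hh : MDifferentiableAt (𝓘(ℝ, EB).prod 𝓘(ℝ, FD)) 𝓘(ℝ, ℝ) h (γ t)) {a : A (γ t).proj}
    (ha : S.HasFiberDifferentialAt h (γ t) a) (k : F) :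
    HasDerivAt (fun s => S.pairing (γ s).proj (γ s).2 (P (γ s).proj (e.symmL ℝ (γ s).proj k)))
      (S.pairing (γ t).proj (γ t).2
        (P (γ t).proj (e.symmL ℝ (γ t).proj (L.kernelBracket P e ⟨(γ t).proj, a⟩ k)))) t := by
  have hopen := e.open_baseSet.preimage (FiberBundle.continuous_proj FD D)
  rw [← poissonBracket_linearFunction_projection hL hI hPs hP hγt hh ha]
  refine ((hγ t ht).2 _ _ hopen hγt (S.isSmoothFunctionOn_linearFunction
    (smoothSectionOn_projection_trivialization_symm hPs e k))).congr_of_eventuallyEq ?_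
  filter_upwards [(hγ t ht).1.continuousAt.preimage_mem_nhds (hopen.mem_nhds hγt)] with s hs
  rw [e.symmL_apply hs, SmoothDual.linearFunction]

variable [CompleteSpace EB] [CompleteSpace F]

theorem exists_nhds_forall_mem_dualAnchorImage (hL : L.IsTransitive) (hI : I.IsPositive)
    (hdec : I.HasOrthogonalDecomposition L) {h : TotalSpace FD D → ℝ} {W : Set (TotalSpace FD D)}
    (hW : IsOpen W) (hh : S.IsSmoothFunctionOn h W) {γ : ℝ → TotalSpace FD D} {J : Set ℝ}
    (hJ : IsOpen J) (hγW : ∀ t ∈ J, γ t ∈ W) (hγ : L.IsHamiltonianTrajectory S h γ J) {t₀ : ℝ}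
    (ht₀ : t₀ ∈ J) :
    ∃ N ∈ 𝓝 t₀, ∀ s ∈ N, γ s ∈ L.dualAnchorImage S → ∀ t ∈ N, γ t ∈ L.dualAnchorImage S := by
  have ⟨P, hPs, hP⟩ := hdec
  have hdiff : ∀ ξ ∈ W, MDifferentiableAt (𝓘(ℝ, EB).prod 𝓘(ℝ, FD)) 𝓘(ℝ, ℝ) h ξ :=
    fun ξ hξ => hh.mdifferentiableAt hW hξ
  obtain ⟨-, a, ha, had⟩ := hh
  set e := trivializationAt F A (γ t₀).proj
  have hcont : ∀ t ∈ J, ContinuousAt γ t := fun t ht => (hγ t ht).1.continuousAt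
  obtain ⟨r, hr, hball⟩ : ∃ r, 0 < r ∧
      ∀ t ∈ Metric.closedBall t₀ r, t ∈ J ∧ (γ t).proj ∈ e.baseSet :=
    Metric.nhds_basis_closedBall.mem_iff.1 <| Filter.inter_mem (hJ.mem_nhds ht₀)
      ((hcont t₀ ht₀).preimage_mem_nhds ((e.open_baseSet.preimage
        (FiberBundle.continuous_proj FD D)).mem_nhds (FiberBundle.mem_baseSet_trivializationAt' _)))
  have ha_cont : ContinuousOn (fun t => TotalSpace.mk' F (γ t).proj (a (γ t)))
      (Metric.closedBall t₀ r) :=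
    ha.continuousOn.comp (fun t ht => (hcont t (hball t ht).1).continuousWithinAt)
      fun t ht => hγW t (hball t ht).1
  obtain ⟨C, hC⟩ := L.exists_norm_kernelBracket_le hPs (fun x v => (hP x v).1)
    ((isCompact_closedBall t₀ r).image_of_continuousOn ha_cont)
    (image_subset_iff.2 fun t ht => (hball t ht).2)
  obtain ⟨N, hN, hzero⟩ := exists_nhds_forall_eq_zero_of_hasDerivAt hr
    (Q := fun t => (S.pairing (γ t).proj (γ t).2).comp
      ((P (γ t).proj).comp (e.symmL ℝ (γ t).proj)))
    (fun t ht => hasDerivAt_pairing_projection hL hI hPs hP hγ (hball t ht).1 (hball t ht).2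
      (hdiff _ (hγW t (hball t ht).1)) (had _ (hγW t (hball t ht).1)))
    (fun t ht => hC _ (mem_image_of_mem _ ht))
  have himage : ∀ t ∈ Metric.closedBall t₀ r, γ t ∈ L.dualAnchorImage S ↔ _ := fun t ht =>
    mem_dualAnchorImage_iff_comp_projection_eq_zero hL hI hdec (hP _) (hball t ht).2
  refine ⟨N ∩ Metric.closedBall t₀ r, Filter.inter_mem hN (Metric.closedBall_mem_nhds _ hr),
    fun s hs hγs t ht => ?_⟩
  exact (himage t ht.2).2 (hzero s hs.1 ((himage s hs.2).1 hγs) t ht.1)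

theorem mem_dualAnchorImage_of_isHamiltonianTrajectory (hL : L.IsTransitive) (hI : I.IsPositive)
    (hdec : I.HasOrthogonalDecomposition L) {h : TotalSpace FD D → ℝ} {W : Set (TotalSpace FD D)}
    (hW : IsOpen W) (hh : S.IsSmoothFunctionOn h W) {γ : ℝ → TotalSpace FD D} {J : Set ℝ}
    (hJ : IsOpen J) (hγW : ∀ t ∈ J, γ t ∈ W) (hγ : L.IsHamiltonianTrajectory S h γ J) {T : Set ℝ}
    (hTJ : T ⊆ J) (hT : IsPreconnected T) {s t : ℝ} (hs : s ∈ T) (ht : t ∈ T)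
    (hγs : γ s ∈ L.dualAnchorImage S) : γ t ∈ L.dualAnchorImage S := by
  refine (hT.induction₂ (fun s t => γ s ∈ L.dualAnchorImage S ↔ γ t ∈ L.dualAnchorImage S)
    (fun u hu => ?_) (fun _ _ _ _ _ _ => Iff.trans) (fun _ _ _ _ => Iff.symm) hs ht).1 hγs
  obtain ⟨N, hN, hstay⟩ :=
    exists_nhds_forall_mem_dualAnchorImage hL hI hdec hW hh hJ hγW hγ (hTJ hu)
  filter_upwards [mem_nhdsWithin_of_mem_nhds hN] with v hv
  exact ⟨fun hγu => hstay u (mem_of_mem_nhds hN) hγu v hv,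
    fun hγv => hstay v hv hγv u (mem_of_mem_nhds hN)⟩

end InertiaOperator

end InvariantImage

section ChartField

variable {EB : Type*} [NormedAddCommGroup EB] [NormedSpace ℝ EB]
  {B : Type*} [TopologicalSpace B] [ChartedSpace EB B] [IsManifold 𝓘(ℝ, EB) ∞ B]

/-- The vector field that has the constant value `v` in the chart at `x₀`. -/
noncomputable def chartField (x₀ : B) (v : EB) (y : B) : TangentSpace 𝓘(ℝ, EB) y :=
  (trivializationAt EB (TangentSpace 𝓘(ℝ, EB)) x₀).symm y v

theorem smoothSectionOn_chartField (x₀ : B) (v : EB) :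
    SmoothSectionOn EB EB (chartField x₀ v) (chartAt EB x₀).source :=
  smoothSectionOn_trivialization_symm (trivializationAt EB (TangentSpace 𝓘(ℝ, EB)) x₀) v

theorem mfderiv_extChartAt_chartField {x₀ y : B} (hy : y ∈ (chartAt EB x₀).source) (v : EB) :
    mfderiv 𝓘(ℝ, EB) 𝓘(ℝ, EB) (extChartAt 𝓘(ℝ, EB) x₀) y (chartField x₀ v y) = v := by
  set e := trivializationAt EB (TangentSpace 𝓘(ℝ, EB)) x₀
  have hsymm : e.symmL ℝ y v = chartField x₀ v y := e.symmL_apply hy v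
  rw [← hsymm, ← TangentBundle.continuousLinearMapAt_trivializationAt hy]
  exact e.continuousLinearMapAt_symmL hy v

theorem chartField_mfderiv_extChartAt {x₀ y : B} (hy : y ∈ (chartAt EB x₀).source)
    (u : TangentSpace 𝓘(ℝ, EB) y) :
    chartField (EB := EB) x₀ (mfderiv 𝓘(ℝ, EB) 𝓘(ℝ, EB) (extChartAt 𝓘(ℝ, EB) x₀) y u) y = u := by
  set e := trivializationAt EB (TangentSpace 𝓘(ℝ, EB)) x₀
  have hsymm : ∀ w : EB, e.symmL ℝ y w = chartField x₀ w y := e.symmL_apply hy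
  refine (hsymm _).symm.trans ?_
  rw [← TangentBundle.continuousLinearMapAt_trivializationAt hy]
  exact e.symmL_continuousLinearMapAt hy u

theorem mfderiv_extChartAt_symm_apply {x₀ : B} {z : EB} (hz : z ∈ (extChartAt 𝓘(ℝ, EB) x₀).target)
    (v : EB) :
    mfderiv 𝓘(ℝ, EB) 𝓘(ℝ, EB) (extChartAt 𝓘(ℝ, EB) x₀).symm z v =
      chartField x₀ v ((extChartAt 𝓘(ℝ, EB) x₀).symm z) := by
  have hy := (extChartAt 𝓘(ℝ, EB) x₀).map_target hz
  refine (isInvertible_mfderiv_extChartAt hy).injective ?_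
  rw [mfderiv_extChartAt_chartField (by rwa [extChartAt_source] at hy)]
  have hcomp := mfderiv_extChartAt_comp_mfderivWithin_extChartAt_symm hz
  rw [ModelWithCorners.range_eq_univ, mfderivWithin_univ] at hcomp
  exact DFunLike.congr_fun hcomp v

theorem exists_contMDiffOn_dirDeriv_eq {x : B} (q : TangentSpace 𝓘(ℝ, EB) x →L[ℝ] ℝ) :
    ∃ f : B → ℝ, ContMDiffOn 𝓘(ℝ, EB) 𝓘(ℝ, ℝ) ∞ f (chartAt EB x).source ∧
      ∀ v : TangentSpace 𝓘(ℝ, EB) x, dirDeriv v f = q v := by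
  set e := trivializationAt EB (TangentSpace 𝓘(ℝ, EB)) x
  have hx := mem_chart_source EB x
  refine ⟨fun y => (q.comp (e.symmL ℝ x)) (extChartAt 𝓘(ℝ, EB) x y),
    (q.comp (e.symmL ℝ x)).contMDiff.comp_contMDiffOn contMDiffOn_extChartAt, fun v => ?_⟩
  rw [dirDeriv_clm_comp v (mdifferentiableAt_extChartAt hx),
    ← TangentBundle.continuousLinearMapAt_trivializationAt hx]
  exact congrArg q (e.symmL_continuousLinearMapAt hx v)

variable {x₀ : B} {c v : EB} {t : ℝ}

theorem hasMFDerivAt_chartLine (ht : c + t • v ∈ (extChartAt 𝓘(ℝ, EB) x₀).target) :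
    HasMFDerivAt 𝓘(ℝ, ℝ) 𝓘(ℝ, EB) (fun s : ℝ => (extChartAt 𝓘(ℝ, EB) x₀).symm (c + s • v)) t
      ((mfderiv 𝓘(ℝ, EB) 𝓘(ℝ, EB) (extChartAt 𝓘(ℝ, EB) x₀).symm (c + t • v)).comp
        (ContinuousLinearMap.toSpanSingleton ℝ v)) := by
  have hline : HasDerivAt (fun s : ℝ => c + s • v) v t := by
    simpa using ((hasDerivAt_id t).smul_const v).const_add c
  have hsymm : MDifferentiableAt 𝓘(ℝ, EB) 𝓘(ℝ, EB) (extChartAt 𝓘(ℝ, EB) x₀).symm (c + t • v) :=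
    ((contMDiffOn_extChartAt_symm (n := ∞) x₀).contMDiffAt
      ((isOpen_extChartAt_target x₀).mem_nhds ht)).mdifferentiableAt (by simp)
  exact hsymm.hasMFDerivAt.comp t hline.hasFDerivAt.hasMFDerivAt

theorem curveVelocity_chartLine (ht : c + t • v ∈ (extChartAt 𝓘(ℝ, EB) x₀).target) :
    curveVelocity EB (fun s : ℝ => (extChartAt 𝓘(ℝ, EB) x₀).symm (c + s • v)) t =
      chartField x₀ v ((extChartAt 𝓘(ℝ, EB) x₀).symm (c + t • v)) := by
  rw [curveVelocity, (hasMFDerivAt_chartLine ht).mfderiv, ← mfderiv_extChartAt_symm_apply ht]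
  exact congrArg (mfderiv 𝓘(ℝ, EB) 𝓘(ℝ, EB) (extChartAt 𝓘(ℝ, EB) x₀).symm (c + t • v))
    (one_smul ℝ v)

end ChartField

section SymplecticLeaf

variable {EB : Type*} [NormedAddCommGroup EB] [NormedSpace ℝ EB]
  {B : Type*} [TopologicalSpace B] [ChartedSpace EB B]
  {FD : Type*} [NormedAddCommGroup FD] [NormedSpace ℝ FD]
  {D : B → Type*} [∀ x, AddCommGroup (D x)] [∀ x, Module ℝ (D x)] [∀ x, TopologicalSpace (D x)]
  [TopologicalSpace (TotalSpace FD D)] [FiberBundle FD D] [VectorBundle ℝ FD D]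
  [ContMDiffVectorBundle ∞ FD D 𝓘(ℝ, EB)]

theorem mdifferentiable_fiber_line {x : B} (ξ η : D x) :
    MDifferentiable 𝓘(ℝ, ℝ) (𝓘(ℝ, EB).prod 𝓘(ℝ, FD))
      (fun t : ℝ => TotalSpace.mk' FD x (ξ + t • η)) := by
  intro t
  set e := trivializationAt FD D x
  have hx : x ∈ e.baseSet := FiberBundle.mem_baseSet_trivializationAt' x
  have hline : ContMDiff 𝓘(ℝ, ℝ) 𝓘(ℝ, FD) ∞
      (fun t : ℝ => e.continuousLinearMapAt ℝ x ξ + t • e.continuousLinearMapAt ℝ x η) :=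
    (contDiff_const.add (contDiff_id.smul contDiff_const)).contMDiff
  have hsymm : ∀ s : ℝ, e.symm x (e.continuousLinearMapAt ℝ x ξ +
      s • e.continuousLinearMapAt ℝ x η) = ξ + s • η := fun s => by
    rw [← e.symmL_apply (R := ℝ) hx, map_add, map_smul, e.symmL_continuousLinearMapAt hx,
      e.symmL_continuousLinearMapAt hx]
  have hmk := contMDiffWithinAt_mk_trivialization_symm (EB := EB) (e := e) (s := univ)
    (contMDiffWithinAt_const (c := x)) (hline t).contMDiffWithinAt hx
  simp only [hsymm, contMDiffWithinAt_univ] at hmk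
  exact hmk.mdifferentiableAt (by simp)

variable {F : Type*} [NormedAddCommGroup F] [NormedSpace ℝ F]
  {A : B → Type*} [∀ x, AddCommGroup (A x)] [∀ x, Module ℝ (A x)]
  [∀ x, TopologicalSpace (A x)] [∀ x, IsTopologicalAddGroup (A x)] [∀ x, ContinuousSMul ℝ (A x)]
  [TopologicalSpace (TotalSpace F A)] [FiberBundle F A] [VectorBundle ℝ F A]

variable [IsManifold 𝓘(ℝ, EB) ∞ B] [ContMDiffVectorBundle ∞ F A 𝓘(ℝ, EB)]

namespace LieAlgebroid

variable (L : LieAlgebroid EB F A) (S : SmoothDual EB F A FD D) {U : Set B}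

theorem poissonBracket_comp_proj_linearFunction (hU : IsOpen U) {f : B → ℝ}
    (hf : ContMDiffOn 𝓘(ℝ, EB) 𝓘(ℝ, ℝ) ∞ f U) {η : ∀ x, A x} (hη : SmoothSectionOn EB F η U)
    {ξ : TotalSpace FD D} (hξ : ξ.proj ∈ U) :
    L.poissonBracket S (fun ζ => f ζ.proj) (S.linearFunction η) ξ =
      - dirDeriv (L.anchor ξ.proj (η ξ.proj)) f := by
  obtain ⟨V, hV, hξV, s, hs, hsξ⟩ := exists_smoothSectionOn_apply_eq (EB := EB) (F := FD) ξ.2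
  have hzero : L.bracket (fun _ => 0) η ξ.proj = 0 := by
    rw [L.bracket_skew U hU _ _ (smoothSectionOn_zero U) hη _ hξ, L.bracket_zero_right hU hη hξ,
      neg_zero]
  have hfd := (S.isSmoothFunctionOn_comp_proj hf).mdifferentiableAt (ξ := ξ)
    (hU.preimage (FiberBundle.continuous_proj FD D)) hξ
  rw [L.poissonBracket_linearFunction hfd (hU.inter hV) ⟨hξ, hξV⟩ (smoothSectionOn_zero _)
    (hη.mono inter_subset_left) (S.hasFiberDifferentialAt_comp_proj f ξ)
    (hs.mono inter_subset_right) hsξ, hzero]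
  simp only [map_zero, sub_zero, zero_sub]

theorem poissonBracket_linearFunction_linearFunction (hU : IsOpen U) {ζ η : ∀ x, A x}
    (hζ : SmoothSectionOn EB F ζ U) (hη : SmoothSectionOn EB F η U)
    {ξ : TotalSpace FD D} (hξ : ξ.proj ∈ U) :
    L.poissonBracket S (S.linearFunction ζ) (S.linearFunction η) ξ =
      S.linearFunction (L.bracket ζ η) ξ := by
  obtain ⟨V, hV, hξV, s, hs, hsξ⟩ := exists_smoothSectionOn_apply_eq (EB := EB) (F := FD) ξ.2
  rw [L.poissonBracket_linearFunction (SmoothDual.mdifferentiableAt_linearFunction hU hζ hξ)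
    (hU.inter hV) ⟨hξ, hξV⟩ (hζ.mono inter_subset_left) (hη.mono inter_subset_left)
    (S.hasFiberDifferentialAt_linearFunction ζ ξ) (hs.mono inter_subset_right) hsξ]
  simp only [SmoothDual.linearFunction, sub_self, dirDeriv_const, sub_zero]

theorem isHamiltonianTrajectory_fiber_line {x : B} (hU : IsOpen U) (hx : x ∈ U) {f : B → ℝ}
    (hf : ContMDiffOn 𝓘(ℝ, EB) 𝓘(ℝ, ℝ) ∞ f U) {η : D x}
    (hη : ∀ a, S.pairing x η a = -dirDeriv (L.anchor x a) f) (ξ : D x) :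
    L.IsHamiltonianTrajectory S (fun ζ => f ζ.proj) (fun t => TotalSpace.mk' FD x (ξ + t • η))
      univ := by
  refine fun t _ => ⟨mdifferentiable_fiber_line ξ η t, fun W g hW hgW hg =>
    L.hasDerivAt_poissonBracket_of_linear (γ := fun t => TotalSpace.mk' FD x (ξ + t • η))
      ((S.isSmoothFunctionOn_comp_proj hf).mdifferentiableAt
        (hU.preimage (FiberBundle.continuous_proj FD D)) hx)
      (S.hasFiberDifferentialAt_comp_proj f _) (mdifferentiable_fiber_line ξ η t) ?_
      (fun b => ?_) hW hgW hg⟩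
  · rw [map_zero, curveVelocity, mfderiv_const]
    rfl
  · obtain ⟨V, hV, hxV, θ, hθ, rfl⟩ := exists_smoothSectionOn_apply_eq (EB := EB) (F := F) b
    have hxV : x ∈ V := hxV
    refine ⟨U ∩ V, θ, hU.inter hV, ⟨hx, hxV⟩, hθ.mono inter_subset_right, rfl, ?_⟩
    rw [L.poissonBracket_comp_proj_linearFunction S (hU.inter hV) (hf.mono inter_subset_left)
      (hθ.mono inter_subset_right) ⟨hx, hxV⟩, ← hη]
    have hline := ((hasDerivAt_id t).mul_const (S.pairing x η (θ x))).const_add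
      (S.pairing x ξ (θ x))
    exact (hline.congr_deriv (one_mul _)).congr_of_eventuallyEq
      (.of_forall fun s => by simp [SmoothDual.linearFunction])

theorem hamiltonianStep_fiber {x : B} (ξ η : D x) {q : TangentSpace 𝓘(ℝ, EB) x →L[ℝ] ℝ}
    (hq : ∀ a, S.pairing x η a = q (L.anchor x a)) :
    L.HamiltonianStep S ⟨x, ξ⟩ ⟨x, ξ + η⟩ := by
  obtain ⟨f, hf, hfq⟩ := exists_contMDiffOn_dirDeriv_eq (-q)
  have hU := (chartAt EB x).open_source
  have hx := mem_chart_source EB x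
  refine ⟨_, _, univ, fun t => ⟨x, ξ + t • η⟩,
    hU.preimage (FiberBundle.continuous_proj FD D), S.isSmoothFunctionOn_comp_proj hf, isOpen_univ,
    subset_univ _, fun t _ => hx,
    L.isHamiltonianTrajectory_fiber_line S hU hx hf (fun a => ?_) ξ, ?_, ?_⟩
  · rw [hfq, neg_apply, neg_neg, hq]
  · simp only [zero_smul, add_zero]
  · simp only [one_smul]

theorem isHamiltonianTrajectory_zeroSection (hU : IsOpen U) {ζ : ∀ x, A x}
    (hζ : SmoothSectionOn EB F ζ U) {x : ℝ → B} {J : Set ℝ} (hxU : ∀ t ∈ J, x t ∈ U)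
    (hx : ∀ t ∈ J, MDifferentiableAt 𝓘(ℝ, ℝ) 𝓘(ℝ, EB) x t)
    (hxζ : ∀ t ∈ J, curveVelocity EB x t = L.anchor (x t) (ζ (x t))) :
    L.IsHamiltonianTrajectory S (S.linearFunction ζ) (fun t => zeroSection FD D (x t)) J := by
  intro t ht
  have hγ : MDifferentiableAt 𝓘(ℝ, ℝ) (𝓘(ℝ, EB).prod 𝓘(ℝ, FD))
      (fun t => zeroSection FD D (x t)) t :=
    ((contMDiff_zeroSection (n := ∞) ℝ D).mdifferentiable (by simp) _).comp t (hx t ht)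
  refine ⟨hγ, fun W g hW hgW hg => L.hasDerivAt_poissonBracket_of_linear
    (γ := fun t => zeroSection FD D (x t))
    (SmoothDual.mdifferentiableAt_linearFunction hU hζ (hxU t ht))
    (S.hasFiberDifferentialAt_linearFunction ζ _) hγ (hxζ t ht) (fun b => ?_) hW hgW hg⟩
  obtain ⟨V, hV, hxV, θ, hθ, hθb⟩ := exists_smoothSectionOn_apply_eq (EB := EB) (F := F) b
  refine ⟨U ∩ V, θ, hU.inter hV, ⟨hxU t ht, hxV⟩, hθ.mono inter_subset_right, hθb, ?_⟩
  rw [L.poissonBracket_linearFunction_linearFunction S (hU.inter hV) (hζ.mono inter_subset_left)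
    (hθ.mono inter_subset_right) ⟨hxU t ht, hxV⟩]
  simpa only [S.linearFunction_zeroSection] using hasDerivAt_const t (0 : ℝ)

theorem hamiltonianStep_zeroSection_chart {x₀ : B} {c v : EB} {ζ : ∀ x, A x}
    (hζ : SmoothSectionOn EB F ζ (chartAt EB x₀).source)
    (hζv : ∀ y, L.anchor y (ζ y) = chartField x₀ v y)
    (hc : ∀ t ∈ Icc (0 : ℝ) 1, c + t • v ∈ (extChartAt 𝓘(ℝ, EB) x₀).target) :
    L.HamiltonianStep S (zeroSection FD D ((extChartAt 𝓘(ℝ, EB) x₀).symm c))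
      (zeroSection FD D ((extChartAt 𝓘(ℝ, EB) x₀).symm (c + v))) := by
  have hU := (chartAt EB x₀).open_source
  have hsource : ∀ t : ℝ, c + t • v ∈ (extChartAt 𝓘(ℝ, EB) x₀).target →
      (extChartAt 𝓘(ℝ, EB) x₀).symm (c + t • v) ∈ (chartAt EB x₀).source := fun t ht => by
    simpa only [extChartAt_source] using (extChartAt 𝓘(ℝ, EB) x₀).map_target ht
  have hline : Continuous fun t : ℝ => c + t • v := by fun_prop
  refine ⟨_, _, {t : ℝ | c + t • v ∈ (extChartAt 𝓘(ℝ, EB) x₀).target},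
    fun t => zeroSection FD D ((extChartAt 𝓘(ℝ, EB) x₀).symm (c + t • v)),
    hU.preimage (FiberBundle.continuous_proj FD D), S.isSmoothFunctionOn_linearFunction hζ,
    (isOpen_extChartAt_target x₀).preimage hline, hc, hsource,
    L.isHamiltonianTrajectory_zeroSection S hU hζ hsource
      (fun t ht => (hasMFDerivAt_chartLine ht).mdifferentiableAt)
      (fun t ht => (curveVelocity_chartLine ht).trans (hζv _).symm), ?_, ?_⟩
  · simp only [zero_smul, add_zero]
  · simp only [one_smul]

theorem reflTransGen_zeroSection [PreconnectedSpace B]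
    (hlift : ∀ x₀ : B, ∀ v : EB, ∃ ζ : ∀ x, A x, SmoothSectionOn EB F ζ (chartAt EB x₀).source ∧
      ∀ y, L.anchor y (ζ y) = chartField x₀ v y) (x y : B) :
    Relation.ReflTransGen (L.HamiltonianStep S) (zeroSection FD D x) (zeroSection FD D y) := by
  let R : B → B → Prop := fun x y =>
    Relation.ReflTransGen (L.HamiltonianStep S) (zeroSection FD D x) (zeroSection FD D y)
  suffices hlocal : ∀ x₀ : B, ∀ᶠ y in 𝓝 x₀, R x₀ y ∧ R y x₀ from
    (isPreconnected_univ.induction₂ (fun x y => R x y ∧ R y x)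
      (fun x₀ _ => by simpa only [nhdsWithin_univ] using hlocal x₀)
      (fun _ _ _ _ _ _ hxy hyz => ⟨hxy.1.trans hyz.1, hyz.2.trans hxy.2⟩)
      (fun _ _ _ _ h => h.symm) (mem_univ x) (mem_univ y)).1
  intro x₀
  obtain ⟨r, hr, hball⟩ := Metric.isOpen_iff.1
    (isOpen_extChartAt_target (I := 𝓘(ℝ, EB)) x₀) _ (mem_extChartAt_target x₀)
  have hstep : ∀ c ∈ Metric.ball (extChartAt 𝓘(ℝ, EB) x₀ x₀) r,
      ∀ c' ∈ Metric.ball (extChartAt 𝓘(ℝ, EB) x₀ x₀) r,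
      R ((extChartAt 𝓘(ℝ, EB) x₀).symm c) ((extChartAt 𝓘(ℝ, EB) x₀).symm c') := by
    intro c hc c' hc'
    obtain ⟨ζ, hζ, hζv⟩ := hlift x₀ (c' - c)
    have hsegment := L.hamiltonianStep_zeroSection_chart S hζ hζv fun t ht =>
      hball ((convex_ball (extChartAt 𝓘(ℝ, EB) x₀ x₀) r).add_smul_sub_mem hc hc' ht)
    rw [add_sub_cancel] at hsegment
    exact .single hsegment
  filter_upwards [(continuousAt_extChartAt x₀).preimage_mem_nhds
      (Metric.ball_mem_nhds (extChartAt 𝓘(ℝ, EB) x₀ x₀) hr),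
    extChartAt_source_mem_nhds (I := 𝓘(ℝ, EB)) x₀] with y hy hy_source
  have hto := hstep _ (Metric.mem_ball_self hr) _ hy
  have hfrom := hstep _ hy _ (Metric.mem_ball_self hr)
  rw [extChartAt_to_inv, (extChartAt 𝓘(ℝ, EB) x₀).left_inv hy_source] at hto hfrom
  exact ⟨hto, hfrom⟩

end LieAlgebroid

namespace InertiaOperator

variable {L : LieAlgebroid EB F A} {S : SmoothDual EB F A FD D} {I : InertiaOperator S}
  [CompleteSpace EB] [CompleteSpace F]

theorem symplecticLeaf_eq_dualAnchorImage [PreconnectedSpace B] (hL : L.IsTransitive)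
    (hI : I.IsPositive) (hdec : I.HasOrthogonalDecomposition L) {ξ : TotalSpace FD D}
    (hξ : ξ ∈ L.dualAnchorImage S) : L.symplecticLeaf S ξ = L.dualAnchorImage S := by
  refine Subset.antisymm (fun η hη => ?_) (fun η hη => ?_)
  · change Relation.ReflTransGen _ _ _ at hη
    induction hη with
    | refl => exact hξ
    | tail _ hstep ih =>
      obtain ⟨W, h, J, γ, hW, hh, hJ, hIJ, hγW, hγ, rfl, rfl⟩ := hstep
      exact mem_dualAnchorImage_of_isHamiltonianTrajectory hL hI hdec hW hh hJ hγW hγ hIJ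
        isPreconnected_Icc (left_mem_Icc.2 zero_le_one) (right_mem_Icc.2 zero_le_one) ih
  · have hto_zero : L.HamiltonianStep S ξ (zeroSection FD D ξ.proj) := by
      obtain ⟨p, hp⟩ := hξ
      have hstep := L.hamiltonianStep_fiber S ξ.2 (-ξ.2) (q := -p)
        (fun a => by rw [map_neg, neg_apply, hp, neg_apply])
      rwa [add_neg_cancel] at hstep
    have hfrom_zero : L.HamiltonianStep S (zeroSection FD D η.proj) η := by
      obtain ⟨p, hp⟩ := hη
      have hstep := L.hamiltonianStep_fiber S 0 η.2 hp
      rwa [zero_add] at hstep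
    exact ((L.reflTransGen_zeroSection S
      (fun x₀ v => ⟨_, smoothSectionOn_anchorInv hL hI hdec (smoothSectionOn_chartField x₀ v),
        fun _ => anchor_anchorInv hL hdec _⟩)
      ξ.proj η.proj).head hto_zero).tail hfrom_zero

end InertiaOperator

end SymplecticLeaf

section ChartMetric

variable {EB : Type*} [NormedAddCommGroup EB] [NormedSpace ℝ EB]
  {B : Type*} [TopologicalSpace B] [ChartedSpace EB B] [IsManifold 𝓘(ℝ, EB) ∞ B]

namespace RiemannMetric

variable (g : RiemannMetric EB B)

theorem inChart_eq {x₀ : B} {z : EB} (hz : z ∈ (extChartAt 𝓘(ℝ, EB) x₀).target) (v w : EB) :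
    g.inChart x₀ z v w = g.form ((extChartAt 𝓘(ℝ, EB) x₀).symm z)
      (chartField x₀ v ((extChartAt 𝓘(ℝ, EB) x₀).symm z))
      (chartField x₀ w ((extChartAt 𝓘(ℝ, EB) x₀).symm z)) := by
  rw [inChart, mfderiv_extChartAt_symm_apply hz, mfderiv_extChartAt_symm_apply hz]

theorem inChart_extChartAt {x₀ y : B} (hy : y ∈ (chartAt EB x₀).source) (v w : EB) :
    g.inChart x₀ (extChartAt 𝓘(ℝ, EB) x₀ y) v w =
      g.form y (chartField x₀ v y) (chartField x₀ w y) := by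
  rw [← extChartAt_source 𝓘(ℝ, EB)] at hy
  rw [inChart_eq g ((extChartAt 𝓘(ℝ, EB) x₀).map_source hy), (extChartAt 𝓘(ℝ, EB) x₀).left_inv hy]

theorem contMDiffOn_form_chartField (x₀ : B) (v w : EB) :
    ContMDiffOn 𝓘(ℝ, EB) 𝓘(ℝ, ℝ) ∞
      (fun y => g.form y (chartField x₀ v y) (chartField x₀ w y)) (chartAt EB x₀).source := by
  intro y hy
  have hsection : ContMDiffWithinAt 𝓘(ℝ, EB) (𝓘(ℝ, EB).prod 𝓘(ℝ, ℝ)) ∞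
      (fun y : B => TotalSpace.mk' ℝ (E := Bundle.Trivial B ℝ) y
        (g.form y (chartField x₀ v y) (chartField x₀ w y))) (chartAt EB x₀).source y :=
    ContMDiffWithinAt.clm_bundle_apply₂ (F₁ := EB) (F₂ := EB)
      g.contMDiff.contMDiffAt.contMDiffWithinAt (smoothSectionOn_chartField x₀ v y hy)
      (smoothSectionOn_chartField x₀ w y hy)
  exact (contMDiffWithinAt_totalSpace.1 hsection).2

theorem differentiableAt_inChart {x₀ : B} {z : EB} (hz : z ∈ (extChartAt 𝓘(ℝ, EB) x₀).target)
    (v w : EB) : DifferentiableAt ℝ (fun z => g.inChart x₀ z v w) z := by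
  have hz_nhds := (isOpen_extChartAt_target (I := 𝓘(ℝ, EB)) x₀).mem_nhds hz
  have hform := (g.contMDiffOn_form_chartField x₀ v w).contMDiffAt
    ((chartAt EB x₀).open_source.mem_nhds
      (extChartAt_source 𝓘(ℝ, EB) x₀ ▸ (extChartAt 𝓘(ℝ, EB) x₀).map_target hz))
  have hcomp := hform.comp z ((contMDiffOn_extChartAt_symm (n := ∞) x₀).contMDiffAt hz_nhds)
  refine (hcomp.mdifferentiableAt (by simp)).differentiableAt.congr_of_eventuallyEq ?_
  filter_upwards [hz_nhds] with z hz
  exact g.inChart_eq hz v w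

theorem dirDeriv_form_chartField {x₀ y : B} (hy : y ∈ (chartAt EB x₀).source) (u v w : EB) :
    dirDeriv (chartField x₀ u y) (fun y => g.form y (chartField x₀ v y) (chartField x₀ w y)) =
      fderiv ℝ (fun z => g.inChart x₀ z v w) (extChartAt 𝓘(ℝ, EB) x₀ y) u := by
  have hin := (g.differentiableAt_inChart ((extChartAt 𝓘(ℝ, EB) x₀).map_source
    ((extChartAt_source 𝓘(ℝ, EB) x₀).symm ▸ hy)) v w).mdifferentiableAt
  have hcongr : (fun y => g.form y (chartField x₀ v y) (chartField x₀ w y)) =ᶠ[𝓝 y]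
      (fun z => g.inChart x₀ z v w) ∘ extChartAt 𝓘(ℝ, EB) x₀ := by
    filter_upwards [(chartAt EB x₀).open_source.mem_nhds hy] with y hy
    exact (g.inChart_extChartAt hy v w).symm
  rw [dirDeriv_congr _ hcongr, dirDeriv,
    (hin.hasMFDerivAt.comp y (mdifferentiableAt_extChartAt hy).hasMFDerivAt).mfderiv]
  change mfderiv 𝓘(ℝ, EB) 𝓘(ℝ, ℝ) (fun z => g.inChart x₀ z v w) (extChartAt 𝓘(ℝ, EB) x₀ y)
    (mfderiv 𝓘(ℝ, EB) 𝓘(ℝ, EB) (extChartAt 𝓘(ℝ, EB) x₀) y (chartField x₀ u y)) = _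
  rw [mfderiv_extChartAt_chartField hy, mfderiv_eq_fderiv]
  rfl

end RiemannMetric

theorem hasDerivAt_extChartAt_comp_curve {x₀ : B} {x : ℝ → B} {t : ℝ}
    (hx : MDifferentiableAt 𝓘(ℝ, ℝ) 𝓘(ℝ, EB) x t) (ht : x t ∈ (chartAt EB x₀).source) :
    HasDerivAt (fun s => extChartAt 𝓘(ℝ, EB) x₀ (x s))
      (mfderiv 𝓘(ℝ, EB) 𝓘(ℝ, EB) (extChartAt 𝓘(ℝ, EB) x₀) (x t) (curveVelocity EB x t)) t :=
  hasDerivAt_comp_curve (mdifferentiableAt_extChartAt ht) hx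

theorem dirDeriv_chartField_functional {x₀ y : B} (hy : y ∈ (chartAt EB x₀).source) (v : EB)
    (l : EB →L[ℝ] ℝ) :
    dirDeriv (chartField x₀ v y) (fun y => l (extChartAt 𝓘(ℝ, EB) x₀ y)) = l v :=
  (dirDeriv_clm_comp _ (mdifferentiableAt_extChartAt hy) l).trans
    (congrArg l (mfderiv_extChartAt_chartField hy v))

theorem eq_of_forall_dirDeriv_functional_eq {x₀ y : B} (hy : y ∈ (chartAt EB x₀).source)
    {v w : TangentSpace 𝓘(ℝ, EB) y}
    (h : ∀ l : EB →L[ℝ] ℝ, dirDeriv v (fun y => l (extChartAt 𝓘(ℝ, EB) x₀ y)) =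
      dirDeriv w (fun y => l (extChartAt 𝓘(ℝ, EB) x₀ y))) : v = w := by
  have hchart := mdifferentiableAt_extChartAt (I := 𝓘(ℝ, EB)) hy
  refine (isInvertible_mfderiv_extChartAt (I := 𝓘(ℝ, EB)) (x := x₀)
    ((extChartAt_source 𝓘(ℝ, EB) x₀).symm ▸ hy)).injective
    ((SeparatingDual.eq_iff_forall_dual_eq (R := ℝ) (V := EB)).2 fun l => ?_)
  exact ((dirDeriv_clm_comp v hchart l).symm.trans (h l)).trans (dirDeriv_clm_comp w hchart l)

end ChartMetric

section GeodesicEquation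

variable {EB : Type*} [NormedAddCommGroup EB] [NormedSpace ℝ EB]
  {B : Type*} [TopologicalSpace B] [ChartedSpace EB B] [IsManifold 𝓘(ℝ, EB) ∞ B]
  {F : Type*} [NormedAddCommGroup F] [NormedSpace ℝ F]
  {A : B → Type*} [∀ x, AddCommGroup (A x)] [∀ x, Module ℝ (A x)]
  [∀ x, TopologicalSpace (A x)] [∀ x, IsTopologicalAddGroup (A x)]
  [∀ x, ContinuousSMul ℝ (A x)]
  [TopologicalSpace (TotalSpace F A)] [FiberBundle F A] [VectorBundle ℝ F A]
  [ContMDiffVectorBundle ∞ F A 𝓘(ℝ, EB)]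

theorem LieAlgebroid.anchor_bracket_eq_zero_of_chartField (L : LieAlgebroid EB F A)
    (hL : L.IsTransitive) {x₀ : B} {u v : EB} {ζ η : ∀ x, A x} {U : Set B} (hU : IsOpen U)
    (hU_chart : U ⊆ (chartAt EB x₀).source) (hζ : SmoothSectionOn EB F ζ U)
    (hη : SmoothSectionOn EB F η U) (hζu : ∀ y ∈ U, L.anchor y (ζ y) = chartField x₀ u y)
    (hηv : ∀ y ∈ U, L.anchor y (η y) = chartField x₀ v y) {x : B} (hx : x ∈ U) :
    L.anchor x (L.bracket ζ η x) = 0 := by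
  refine eq_of_forall_dirDeriv_functional_eq (hU_chart hx) fun l => ?_
  have hsmooth : ContMDiffOn 𝓘(ℝ, EB) 𝓘(ℝ, ℝ) ∞ (fun y => l (extChartAt 𝓘(ℝ, EB) x₀ y)) U :=
    l.contMDiff.comp_contMDiffOn (contMDiffOn_extChartAt.mono hU_chart)
  have hconst : ∀ {w : EB} {θ : ∀ x, A x}, (∀ y ∈ U, L.anchor y (θ y) = chartField x₀ w y) →
      (fun y => dirDeriv (L.anchor y (θ y)) (fun y => l (extChartAt 𝓘(ℝ, EB) x₀ y))) =ᶠ[𝓝 x]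
        fun _ => l w := fun hθ => by
    filter_upwards [hU.mem_nhds hx] with y hy
    rw [hθ y hy, dirDeriv_chartField_functional (hU_chart hy)]
  rw [L.dirDeriv_anchor_bracket hL hU hζ hη hsmooth hx, dirDeriv_congr _ (hconst hηv),
    dirDeriv_congr _ (hconst hζu), dirDeriv_const, dirDeriv_const, sub_zero, dirDeriv_zero_left]

variable {FD : Type*} [NormedAddCommGroup FD] [NormedSpace ℝ FD]
  {D : B → Type*} [∀ x, AddCommGroup (D x)] [∀ x, Module ℝ (D x)]
  [∀ x, TopologicalSpace (D x)]
  [TopologicalSpace (TotalSpace FD D)] [FiberBundle FD D] [VectorBundle ℝ FD D]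

namespace InertiaOperator

variable {L : LieAlgebroid EB F A} {S : SmoothDual EB F A FD D} {I : InertiaOperator S}

variable [ContMDiffVectorBundle ∞ FD D 𝓘(ℝ, EB)] [CompleteSpace EB] [CompleteSpace F]

theorem poissonBracket_hamiltonian_linearFunction
    (hL : L.IsTransitive) (hI : I.IsPositive) (hdec : I.HasOrthogonalDecomposition L)
    {g : RiemannMetric EB B} (hg : I.InducesMetric L g)
    {ξ : TotalSpace FD D} (hξ : (I.toEquiv ξ.proj).symm ξ.2 ∈ I.horizontal L ξ.proj)
    {U : Set B} (hU : IsOpen U) (hx : ξ.proj ∈ U) (hU_chart : U ⊆ (chartAt EB ξ.proj).source)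
    {η : ∀ x, A x} (hη : SmoothSectionOn EB F η U) {v : EB}
    (hηv : ∀ y ∈ U, L.anchor y (η y) = chartField ξ.proj v y) {c : EB}
    (hc : chartField ξ.proj c ξ.proj = L.anchor ξ.proj ((I.toEquiv ξ.proj).symm ξ.2)) :
    L.poissonBracket S I.hamiltonian (S.linearFunction η) ξ =
      1 / 2 * fderiv ℝ (fun z => g.inChart ξ.proj z c c)
        (extChartAt 𝓘(ℝ, EB) ξ.proj ξ.proj) v := by
  let ζ : ∀ x, A x := fun y => I.anchorInv L y (chartField ξ.proj c y)
  have hζ : SmoothSectionOn EB F ζ U := smoothSectionOn_anchorInv hL hI hdec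
    fun y hy => (smoothSectionOn_chartField ξ.proj c y (hU_chart hy)).mono hU_chart
  have hζξ : ζ ξ.proj = (I.toEquiv ξ.proj).symm ξ.2 := anchorInv_eq hL hI hdec hξ hc.symm
  have hIζ : SmoothSectionOn EB FD (fun y => I.toEquiv y (ζ y)) U :=
    I.contMDiff.comp_contMDiffOn hζ
  have hIζξ : I.toEquiv ξ.proj (ζ ξ.proj) = ξ.2 := by
    rw [hζξ, ContinuousLinearEquiv.apply_symm_apply]
  have hbracket : S.pairing ξ.proj ξ.2 (L.bracket ζ η ξ.proj) = 0 := by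
    have hperp := hξ _ (L.anchor_bracket_eq_zero_of_chartField hL hU hU_chart hζ hη
      (fun _ _ => anchor_anchorInv hL hdec _) hηv hx)
    rwa [metric, ContinuousLinearEquiv.apply_symm_apply] at hperp
  rw [L.poissonBracket_linearFunction
    (I.isSmoothFunctionOn_hamiltonian.mdifferentiableAt isOpen_univ (mem_univ ξ)) hU hx hζ hη
    (hζξ ▸ I.hasFiberDifferentialAt_hamiltonian ξ) hIζ hIζξ, hbracket]
  simp only [hamiltonian_sub_pairing_toEquiv, ζ, ← hg _ _ _]
  rw [hηv _ hx, dirDeriv_const_mul, g.dirDeriv_form_chartField (hU_chart hx)]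
  · ring
  · exact ((g.contMDiffOn_form_chartField ξ.proj c c).contMDiffAt
      ((chartAt EB ξ.proj).open_source.mem_nhds (hU_chart hx))).mdifferentiableAt (by simp)

end InertiaOperator

end GeodesicEquation

section GeodesicFlow

variable {EB : Type*} [NormedAddCommGroup EB] [NormedSpace ℝ EB]
  {B : Type*} [TopologicalSpace B] [ChartedSpace EB B] [IsManifold 𝓘(ℝ, EB) ∞ B]

theorem RiemannMetric.form_injective (g : RiemannMetric EB B) (x : B) :
    Function.Injective (g.form x) := by
  refine (injective_iff_map_eq_zero _).2 fun u hu => by_contra fun hne => ?_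
  exact (g.pos x u hne).ne' (by rw [hu, zero_apply])

variable {F : Type*} [NormedAddCommGroup F] [NormedSpace ℝ F]
  {A : B → Type*} [∀ x, AddCommGroup (A x)] [∀ x, Module ℝ (A x)]
  [∀ x, TopologicalSpace (A x)] [∀ x, IsTopologicalAddGroup (A x)]
  [∀ x, ContinuousSMul ℝ (A x)]
  [TopologicalSpace (TotalSpace F A)] [FiberBundle F A] [VectorBundle ℝ F A]
  {FD : Type*} [NormedAddCommGroup FD] [NormedSpace ℝ FD]
  {D : B → Type*} [∀ x, AddCommGroup (D x)] [∀ x, Module ℝ (D x)]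
  [∀ x, TopologicalSpace (D x)]
  [TopologicalSpace (TotalSpace FD D)] [FiberBundle FD D] [VectorBundle ℝ FD D]

namespace InertiaOperator

variable {L : LieAlgebroid EB F A} {S : SmoothDual EB F A FD D} {I : InertiaOperator S}

theorem symm_mem_horizontal {x : B} {ξ : D x} {p : TangentSpace 𝓘(ℝ, EB) x →L[ℝ] ℝ}
    (hp : ∀ a, S.pairing x ξ a = p (L.anchor x a)) :
    (I.toEquiv x).symm ξ ∈ I.horizontal L x := fun k hk => by
  rw [metric, ContinuousLinearEquiv.apply_symm_apply, hp, hk, map_zero]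

variable {g : RiemannMetric EB B}

theorem eq_form_anchor_symm (hL : L.IsTransitive) (hI : I.IsPositive)
    (hdec : I.HasOrthogonalDecomposition L) (hg : I.InducesMetric L g) {x : B} {ξ : D x}
    {p : TangentSpace 𝓘(ℝ, EB) x →L[ℝ] ℝ} (hp : ∀ a, S.pairing x ξ a = p (L.anchor x a)) :
    p = g.form x (L.anchor x ((I.toEquiv x).symm ξ)) := by
  ext w
  rw [hg, anchorInv_eq hL hI hdec (symm_mem_horizontal hp) rfl, metric,
    ContinuousLinearEquiv.apply_symm_apply, hp, anchor_anchorInv hL hdec]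

theorem eq_form_iff_eq_anchor_symm (hL : L.IsTransitive) (hI : I.IsPositive)
    (hdec : I.HasOrthogonalDecomposition L) (hg : I.InducesMetric L g) {x : B} {ξ : D x}
    {p : TangentSpace 𝓘(ℝ, EB) x →L[ℝ] ℝ} (hp : ∀ a, S.pairing x ξ a = p (L.anchor x a))
    {u : TangentSpace 𝓘(ℝ, EB) x} :
    p = g.form x u ↔ u = L.anchor x ((I.toEquiv x).symm ξ) := by
  rw [eq_form_anchor_symm hL hI hdec hg hp, (g.form_injective x).eq_iff, eq_comm]

variable {x : ℝ → B} {ξ : ∀ t, D (x t)} {p : ∀ t, TangentSpace 𝓘(ℝ, EB) (x t) →L[ℝ] ℝ} {J : Set ℝ}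

theorem linearFunction_eventuallyEq_inChart (hJ : IsOpen J)
    (hξ : ∀ t ∈ J, ∀ a : A (x t), S.pairing (x t) (ξ t) a = p t (L.anchor (x t) a))
    (hx : ∀ t ∈ J, MDifferentiableAt 𝓘(ℝ, ℝ) 𝓘(ℝ, EB) x t)
    (hpg : ∀ t ∈ J, p t = g.form (x t) (curveVelocity EB x t)) {t : ℝ} (ht : t ∈ J)
    {U : Set B} (hU : IsOpen U) (htU : x t ∈ U) (hU_chart : U ⊆ (chartAt EB (x t)).source)
    {η : ∀ x, A x} {v : EB} (hηv : ∀ y ∈ U, L.anchor y (η y) = chartField (x t) v y) :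
    (fun s => S.linearFunction η (⟨x s, ξ s⟩ : TotalSpace FD D)) =ᶠ[𝓝 t]
      fun s => g.inChart (x t) (extChartAt 𝓘(ℝ, EB) (x t) (x s))
        (deriv (fun s => extChartAt 𝓘(ℝ, EB) (x t) (x s)) s) v := by
  filter_upwards [hJ.mem_nhds ht, (hx t ht).continuousAt.preimage_mem_nhds (hU.mem_nhds htU)]
    with s hs hsU
  have hvelocity : chartField (x t) (deriv (fun s => extChartAt 𝓘(ℝ, EB) (x t) (x s)) s) (x s) =
      curveVelocity EB x s := by
    rw [(hasDerivAt_extChartAt_comp_curve (hx s hs) (hU_chart hsU)).deriv]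
    exact chartField_mfderiv_extChartAt (hU_chart hsU) (curveVelocity EB x s)
  rw [g.inChart_extChartAt (hU_chart hsU), hvelocity]
  change S.pairing (x s) (ξ s) (η (x s)) = _
  rw [hξ s hs, hηv _ hsU, hpg s hs]

variable [CompleteSpace EB] [CompleteSpace F]

theorem contMDiff_anchorInv_totalSpace (hL : L.IsTransitive) (hI : I.IsPositive)
    (hdec : I.HasOrthogonalDecomposition L) :
    ContMDiff 𝓘(ℝ, EB).tangent (𝓘(ℝ, EB).prod 𝓘(ℝ, F)) ∞
      (fun v : TangentBundle 𝓘(ℝ, EB) B => TotalSpace.mk' F v.1 (I.anchorInv L v.1 v.2)) := by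
  obtain ⟨σ, hσ_smooth, hσ⟩ := exists_horizontalLift hL hI hdec
  simp only [← hσ]
  exact fun v => ContMDiffAt.clm_bundle_apply (F₁ := EB) (F₂ := F)
    (E₁ := TangentSpace 𝓘(ℝ, EB)) (E₂ := A) (b := fun v : TangentBundle 𝓘(ℝ, EB) B => v.1)
    (ϕ := fun v => σ v.1) (v := fun v => v.2)
    ((hσ_smooth v.1).comp v (Bundle.contMDiff_proj (n := ∞) _ v)) contMDiffAt_id

variable [ContMDiffVectorBundle ∞ F A 𝓘(ℝ, EB)]

theorem exists_smoothSectionOn_apply_eq_anchor_eq (hL : L.IsTransitive) (hI : I.IsPositive)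
    (hdec : I.HasOrthogonalDecomposition L) {X : ∀ x, TangentSpace 𝓘(ℝ, EB) x} {U : Set B}
    (hU : IsOpen U) (hX : SmoothSectionOn EB EB X U) {x : B} (hx : x ∈ U) {a : A x}
    (ha : L.anchor x a = X x) :
    ∃ V ⊆ U, IsOpen V ∧ x ∈ V ∧ ∃ η, SmoothSectionOn EB F η V ∧ η x = a ∧
      ∀ y, L.anchor y (η y) = X y := by
  have ⟨P, hP_smooth, hP⟩ := hdec
  obtain ⟨V, hV, hxV, ζ, hζ, hζx⟩ := exists_smoothSectionOn_apply_eq (EB := EB) (F := F) a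
  refine ⟨U ∩ V, inter_subset_left, hU.inter hV, ⟨hx, hxV⟩,
    fun y => P y (ζ y) + I.anchorInv L y (X y), fun y hy => ?_, ?_, fun y => ?_⟩
  · exact ContMDiffWithinAt.add_section
      (ContMDiffWithinAt.clm_bundle_apply (F₁ := F) (F₂ := F) (E₁ := A) (E₂ := A)
        (b := fun x => x) hP_smooth.contMDiffAt.contMDiffWithinAt
        ((hζ y hy.2).mono inter_subset_right))
      ((smoothSectionOn_anchorInv hL hI hdec hX y hy.1).mono inter_subset_left)
  · change P x (ζ x) + I.anchorInv L x (X x) = a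
    rw [hζx, anchorInv_eq hL hI hdec (hP x a).2 (by rw [map_sub, (hP x a).1, sub_zero, ha]),
      add_sub_cancel]
  · rw [map_add, (hP y _).1, anchor_anchorInv hL hdec, zero_add]

variable [ContMDiffVectorBundle ∞ FD D 𝓘(ℝ, EB)]

theorem hasDerivAt_linearFunction_iff_euler_lagrange (hL : L.IsTransitive) (hI : I.IsPositive)
    (hdec : I.HasOrthogonalDecomposition L) (hg : I.InducesMetric L g) (hJ : IsOpen J)
    (hξ : ∀ t ∈ J, ∀ a : A (x t), S.pairing (x t) (ξ t) a = p t (L.anchor (x t) a))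
    (hx : ∀ t ∈ J, MDifferentiableAt 𝓘(ℝ, ℝ) 𝓘(ℝ, EB) x t)
    (hpg : ∀ t ∈ J, p t = g.form (x t) (curveVelocity EB x t)) {t : ℝ} (ht : t ∈ J)
    {U : Set B} (hU : IsOpen U) (htU : x t ∈ U) (hU_chart : U ⊆ (chartAt EB (x t)).source)
    {η : ∀ x, A x} (hη : SmoothSectionOn EB F η U) {v : EB}
    (hηv : ∀ y ∈ U, L.anchor y (η y) = chartField (x t) v y) :
    HasDerivAt (fun s => S.linearFunction η (⟨x s, ξ s⟩ : TotalSpace FD D))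
        (L.poissonBracket S I.hamiltonian (S.linearFunction η) ⟨x t, ξ t⟩) t ↔
      let c : ℝ → EB := fun s => extChartAt 𝓘(ℝ, EB) (x t) (x s)
      HasDerivAt (fun s => g.inChart (x t) (c s) (deriv c s) v)
        (1 / 2 * fderiv ℝ (fun y => g.inChart (x t) y (deriv c t) (deriv c t)) (c t) v) t := by
  have hc : chartField (x t) (deriv (fun s => extChartAt 𝓘(ℝ, EB) (x t) (x s)) t) (x t) =
      L.anchor (x t) ((I.toEquiv (x t)).symm (ξ t)) := by
    rw [(hasDerivAt_extChartAt_comp_curve (hx t ht) (hU_chart htU)).deriv]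
    exact (chartField_mfderiv_extChartAt (hU_chart htU) _).trans
      ((eq_form_iff_eq_anchor_symm hL hI hdec hg (hξ t ht)).1 (hpg t ht))
  rw [poissonBracket_hamiltonian_linearFunction hL hI hdec hg (ξ := ⟨x t, ξ t⟩)
    (symm_mem_horizontal (hξ t ht)) hU htU hU_chart hη hηv hc]
  exact (linearFunction_eventuallyEq_inChart hJ hξ hx hpg ht hU htU hU_chart hηv).hasDerivAt_iff

theorem isGeodesicFlowTrajectory_of_isEulerArnoldTrajectory (hL : L.IsTransitive)
    (hI : I.IsPositive) (hdec : I.HasOrthogonalDecomposition L) (hg : I.InducesMetric L g)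
    (hJ : IsOpen J)
    (hξ : ∀ t ∈ J, ∀ a : A (x t), S.pairing (x t) (ξ t) a = p t (L.anchor (x t) a))
    (h : I.IsEulerArnoldTrajectory L (fun t => ⟨x t, ξ t⟩) J) :
    g.IsGeodesicFlowTrajectory x p J := by
  have hx : ∀ t ∈ J, MDifferentiableAt 𝓘(ℝ, ℝ) 𝓘(ℝ, EB) x t := fun t ht =>
    MDifferentiableAt.comp (g := π FD D) (f := fun t => (⟨x t, ξ t⟩ : TotalSpace FD D)) t
      ((Bundle.contMDiff_proj (n := ∞) (IB := 𝓘(ℝ, EB)) (F := FD) D).mdifferentiable (by simp) _)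
      (h t ht).1
  have hvelocity : ∀ t ∈ J,
      curveVelocity EB x t = L.anchor (x t) ((I.toEquiv (x t)).symm (ξ t)) := fun t ht =>
    L.curveVelocity_eq_anchor (γ := fun t => (⟨x t, ξ t⟩ : TotalSpace FD D))
      (I.isSmoothFunctionOn_hamiltonian.mdifferentiableAt isOpen_univ (mem_univ _))
      (I.hasFiberDifferentialAt_hamiltonian _) (h t ht).1 (h t ht).2
  have hpg : ∀ t ∈ J, p t = g.form (x t) (curveVelocity EB x t) := fun t ht =>
    (eq_form_iff_eq_anchor_symm hL hI hdec hg (hξ t ht)).2 (hvelocity t ht)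
  refine ⟨⟨hx, fun t ht => ?_, fun t ht v => ?_⟩, hpg⟩
  · refine (((L.contMDiff_anchor_totalSpace.comp I.contMDiff_symm).mdifferentiable (by simp)
      (⟨x t, ξ t⟩ : TotalSpace FD D)).comp t (h t ht).1).congr_of_eventuallyEq ?_
    filter_upwards [hJ.mem_nhds ht] with s hs
    rw [hvelocity s hs]
    rfl
  · have hchart := (chartAt EB (x t)).open_source
    have hxt := mem_chart_source EB (x t)
    have hη := smoothSectionOn_anchorInv hL hI hdec (smoothSectionOn_chartField (x t) v)
    exact (hasDerivAt_linearFunction_iff_euler_lagrange hL hI hdec hg hJ hξ hx hpg ht hchart hxt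
      subset_rfl hη fun _ _ => anchor_anchorInv hL hdec _).1
      ((h t ht).2 _ _ (hchart.preimage (FiberBundle.continuous_proj FD D)) hxt
        (S.isSmoothFunctionOn_linearFunction hη))

theorem isEulerArnoldTrajectory_of_isGeodesicFlowTrajectory (hL : L.IsTransitive)
    (hI : I.IsPositive) (hdec : I.HasOrthogonalDecomposition L) (hg : I.InducesMetric L g)
    (hJ : IsOpen J)
    (hξ : ∀ t ∈ J, ∀ a : A (x t), S.pairing (x t) (ξ t) a = p t (L.anchor (x t) a))
    (h : g.IsGeodesicFlowTrajectory x p J) :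
    I.IsEulerArnoldTrajectory L (fun t => ⟨x t, ξ t⟩) J := by
  obtain ⟨⟨hx, hx_velocity, heuler_lagrange⟩, hpg⟩ := h
  have hvelocity : ∀ t ∈ J,
      curveVelocity EB x t = L.anchor (x t) ((I.toEquiv (x t)).symm (ξ t)) := fun t ht =>
    (eq_form_iff_eq_anchor_symm hL hI hdec hg (hξ t ht)).1 (hpg t ht)
  intro t ht
  have hγ : MDifferentiableAt 𝓘(ℝ, ℝ) (𝓘(ℝ, EB).prod 𝓘(ℝ, FD))
      (fun t => (⟨x t, ξ t⟩ : TotalSpace FD D)) t := by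
    refine (((I.contMDiff.comp (contMDiff_anchorInv_totalSpace hL hI hdec)).mdifferentiable
      (by simp) _).comp t (hx_velocity t ht)).congr_of_eventuallyEq ?_
    filter_upwards [hJ.mem_nhds ht] with s hs
    change (⟨x s, ξ s⟩ : TotalSpace FD D) =
      ⟨x s, I.toEquiv (x s) (I.anchorInv L (x s) (curveVelocity EB x s))⟩
    rw [anchorInv_eq hL hI hdec (symm_mem_horizontal (hξ s hs)) (hvelocity s hs).symm,
      ContinuousLinearEquiv.apply_symm_apply]
  refine ⟨hγ, fun W f hW hγW hf => L.hasDerivAt_poissonBracket_of_linear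
    (γ := fun t => (⟨x t, ξ t⟩ : TotalSpace FD D))
    (I.isSmoothFunctionOn_hamiltonian.mdifferentiableAt isOpen_univ (mem_univ _))
    (I.hasFiberDifferentialAt_hamiltonian _) hγ (hvelocity t ht) (fun b => ?_) hW hγW hf⟩
  have hxt := mem_chart_source EB (x t)
  obtain ⟨U, hU_chart, hU, htU, η, hη, hηb, hη_anchor⟩ :=
    exists_smoothSectionOn_apply_eq_anchor_eq hL hI hdec (chartAt EB (x t)).open_source
      (smoothSectionOn_chartField (x t) _) hxt
      (chartField_mfderiv_extChartAt hxt (L.anchor (x t) b)).symm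
  exact ⟨U, η, hU, htU, hη, hηb, (hasDerivAt_linearFunction_iff_euler_lagrange hL hI hdec hg hJ
    hξ hx hpg ht hU htU hU_chart hη fun y _ => hη_anchor y).2 (heuler_lagrange t ht _)⟩

theorem isEulerArnoldTrajectory_iff_isGeodesicFlowTrajectory (hL : L.IsTransitive)
    (hI : I.IsPositive) (hdec : I.HasOrthogonalDecomposition L) (hg : I.InducesMetric L g)
    (hJ : IsOpen J)
    (hξ : ∀ t ∈ J, ∀ a : A (x t), S.pairing (x t) (ξ t) a = p t (L.anchor (x t) a)) :
    I.IsEulerArnoldTrajectory L (fun t => ⟨x t, ξ t⟩) J ↔ g.IsGeodesicFlowTrajectory x p J :=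
  ⟨isGeodesicFlowTrajectory_of_isEulerArnoldTrajectory hL hI hdec hg hJ hξ,
    isEulerArnoldTrajectory_of_isGeodesicFlowTrajectory hL hI hdec hg hJ hξ⟩

end InertiaOperator

end GeodesicFlow

section Velocity

variable {E : Type*} [NormedAddCommGroup E] [NormedSpace ℝ E]
  {M : Type*} [TopologicalSpace M] [ChartedSpace E M]
  {E' : Type*} [NormedAddCommGroup E'] [NormedSpace ℝ E']
  {M' : Type*} [TopologicalSpace M'] [ChartedSpace E' M']

/-- The curve `c` passes through `g` at time `0` with velocity `v`. -/
def HasVelocity (c : ℝ → M) (g : M) (v : TangentSpace 𝓘(ℝ, E) g) : Prop :=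
  c 0 = g ∧ ∃ d : ℝ →L[ℝ] E, HasMFDerivAt 𝓘(ℝ, ℝ) 𝓘(ℝ, E) c 0 d ∧ d 1 = v

namespace HasVelocity

variable {c c' : ℝ → M} {g : M} {v w : TangentSpace 𝓘(ℝ, E) g}

theorem congr (h : HasVelocity c g v) (hc : c' =ᶠ[𝓝 0] c) : HasVelocity c' g v := by
  obtain ⟨hc0, d, hd, hv⟩ := h
  exact ⟨hc.self_of_nhds.trans hc0, d, hd.congr_of_eventuallyEq hc, hv⟩

theorem unique (hv : HasVelocity c g v) (hw : HasVelocity c g w) : v = w := by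
  obtain ⟨-, d, hd, rfl⟩ := hv
  obtain ⟨-, d', hd', rfl⟩ := hw
  exact DFunLike.congr_fun (hasMFDerivAt_unique hd hd') (1 : ℝ)

theorem const (x : M) : HasVelocity (fun _ : ℝ => x) x (0 : TangentSpace 𝓘(ℝ, E) x) :=
  ⟨rfl, 0, hasMFDerivAt_const x (0 : ℝ), rfl⟩

theorem line (z w : E) : HasVelocity (fun t : ℝ => z + t • w) z w := by
  have hderiv : HasDerivAt (fun t : ℝ => z + t • w) w 0 := by
    simpa using ((hasDerivAt_id (0 : ℝ)).smul_const w).const_add z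
  exact ⟨by simp, ContinuousLinearMap.toSpanSingleton ℝ w,
    hderiv.hasFDerivAt.hasMFDerivAt, one_smul ℝ w⟩

theorem cast (h : HasVelocity c g v) {g' : M} (hg : g = g') : HasVelocity c g' (hg ▸ v) := by
  subst hg
  exact h

theorem comp_within {f : M → M'} {s : Set M} (h : HasVelocity c g v)
    (hf : MDifferentiableWithinAt 𝓘(ℝ, E) 𝓘(ℝ, E') f s g) (hs : ∀ᶠ t in 𝓝 0, c t ∈ s) :
    HasVelocity (fun t => f (c t)) (f g) (mfderivWithin 𝓘(ℝ, E) 𝓘(ℝ, E') f s g v) := by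
  obtain ⟨rfl, d, hd, rfl⟩ := h
  exact ⟨rfl, _, (hf.hasMFDerivWithinAt.comp (0 : ℝ)
    (hd.hasMFDerivWithinAt (s := c ⁻¹' s)) subset_rfl).hasMFDerivAt hs, rfl⟩

theorem comp {f : M → M'} (h : HasVelocity c g v)
    (hf : MDifferentiableAt 𝓘(ℝ, E) 𝓘(ℝ, E') f g) :
    HasVelocity (fun t => f (c t)) (f g) (mfderiv 𝓘(ℝ, E) 𝓘(ℝ, E') f g v) := by
  rw [← mfderivWithin_univ]
  exact h.comp_within hf.mdifferentiableWithinAt (Filter.Eventually.of_forall fun _ => mem_univ _)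

end HasVelocity

theorem hasVelocity_symm_line {φ : OpenPartialHomeomorph M E}
    (hφ : φ.MDifferentiable 𝓘(ℝ, E) 𝓘(ℝ, E)) {g : M} (hg : g ∈ φ.source)
    (v : TangentSpace 𝓘(ℝ, E) g) :
    let w : E := mfderiv 𝓘(ℝ, E) 𝓘(ℝ, E) φ g v
    HasVelocity (fun t : ℝ => φ.symm (φ g + t • w)) g v := by
  intro w
  obtain ⟨hstart, d, hd, hdv⟩ :=
    (HasVelocity.line (φ g) w).comp
      (hφ.mdifferentiableAt_symm (φ.map_source hg))
  exact ⟨hstart.trans (φ.left_inv hg), d, hd,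
    hdv.trans (DFunLike.congr_fun (hφ.symm_comp_deriv hg) v)⟩

theorem exists_hasVelocity_of_isSubmersionAt [IsManifold 𝓘(ℝ, E) ∞ M]
    [IsManifold 𝓘(ℝ, E') ∞ M'] {f : M → M'} {g : M}
    (hf : Manifold.IsSubmersionAt 𝓘(ℝ, E) 𝓘(ℝ, E') ∞ f g) {v : TangentSpace 𝓘(ℝ, E) g}
    (hv : mfderiv 𝓘(ℝ, E) 𝓘(ℝ, E') f g v = 0) :
    ∃ c : ℝ → M, HasVelocity c g v ∧ ∀ᶠ t in 𝓝 0, f (c t) = f g := by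
  set φ := hf.domChart
  set ψ := hf.codChart
  have hg : g ∈ φ.source := hf.mem_domChart_source
  have hfg : f g ∈ ψ.source := hf.mem_codChart_source
  have hφ : φ.MDifferentiable 𝓘(ℝ, E) 𝓘(ℝ, E) :=
    ⟨(contMDiffOn_of_mem_maximalAtlas hf.domChart_mem_maximalAtlas).mdifferentiableOn (by simp),
      (contMDiffOn_symm_of_mem_maximalAtlas hf.domChart_mem_maximalAtlas).mdifferentiableOn
        (by simp)⟩
  have hψ : MDifferentiableAt 𝓘(ℝ, E') 𝓘(ℝ, E') ψ (f g) :=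
    ((contMDiffOn_of_mem_maximalAtlas hf.codChart_mem_maximalAtlas).contMDiffAt
      (ψ.open_source.mem_nhds hfg)).mdifferentiableAt (by simp)
  have hnormal_form : ∀ z ∈ φ.target, ψ (f (φ.symm z)) = (hf.equiv z).1 := fun z hz =>
    hf.writtenInCharts (by simpa using hz)
  have hψfg : ψ (f g) = (hf.equiv (φ g)).1 := by
    rw [← hnormal_form _ (φ.map_source hg), φ.left_inv hg]
  set w : E := mfderiv 𝓘(ℝ, E) 𝓘(ℝ, E) φ g v
  have hc : HasVelocity (fun t : ℝ => φ.symm (φ g + t • w)) g v := hasVelocity_symm_line hφ hg v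
  have htarget : ∀ᶠ t : ℝ in 𝓝 0, φ g + t • w ∈ φ.target :=
    ContinuousAt.eventually_mem (by fun_prop)
      (φ.open_target.mem_nhds (by simpa using φ.map_source hg))
  have hψ_line : ∀ᶠ t : ℝ in 𝓝 0,
      ψ (f (φ.symm (φ g + t • w))) = ψ (f g) + t • (hf.equiv w).1 := by
    filter_upwards [htarget] with t ht
    rw [hnormal_form _ ht, hψfg, map_add, map_smul, Prod.fst_add, Prod.smul_fst]
  have hw : (hf.equiv w).1 = 0 := by
    have hvelocity := (hc.comp (hf.contMDiffAt.mdifferentiableAt (by simp))).comp hψ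
    rw [hv, map_zero] at hvelocity
    exact ((HasVelocity.line _ _).congr hψ_line).unique hvelocity
  refine ⟨_, hc, ?_⟩
  filter_upwards [htarget, hψ_line] with t ht hψt
  refine ψ.injOn (hf.source_subset_preimage_source (φ.map_target ht)) hfg ?_
  rw [hψt, hw, smul_zero, add_zero]

end Velocity

section GroupoidSubmersion

variable {EB : Type*} [NormedAddCommGroup EB] [NormedSpace ℝ EB]
  {B : Type*} [TopologicalSpace B] [ChartedSpace EB B] [IsManifold 𝓘(ℝ, EB) ∞ B]
  {EG : Type*} [NormedAddCommGroup EG] [NormedSpace ℝ EG]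
  {G : Type*} [TopologicalSpace G] [ChartedSpace EG G] [IsManifold 𝓘(ℝ, EG) ∞ G]

namespace LieGroupoid

variable {𝒢 : LieGroupoid EB B EG G} {g h : G}

theorem src_mul_inv (hgh : 𝒢.src h = 𝒢.src g) : 𝒢.src (𝒢.mul h (𝒢.inv g)) = 𝒢.trg g := by
  rw [𝒢.src_mul _ _ (hgh.trans (𝒢.trg_inv g).symm), 𝒢.src_inv]

theorem trg_mul_inv (hgh : 𝒢.src h = 𝒢.src g) : 𝒢.trg (𝒢.mul h (𝒢.inv g)) = 𝒢.trg h :=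
  𝒢.trg_mul _ _ (hgh.trans (𝒢.trg_inv g).symm)

theorem mul_inv_mul_cancel (hgh : 𝒢.src h = 𝒢.src g) : 𝒢.mul (𝒢.mul h (𝒢.inv g)) g = h := by
  rw [← 𝒢.mul_assoc _ _ _ (hgh.trans (𝒢.trg_inv g).symm) (𝒢.src_inv g), 𝒢.inv_mul, ← hgh,
    𝒢.mul_one]

theorem mul_mul_inv_cancel (hgh : 𝒢.src h = 𝒢.trg g) : 𝒢.mul (𝒢.mul h g) (𝒢.inv g) = h := by
  rw [← 𝒢.mul_assoc _ _ _ hgh (𝒢.trg_inv g).symm, 𝒢.mul_inv, ← hgh, 𝒢.mul_one]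

theorem exists_hasVelocity {v : TangentSpace 𝓘(ℝ, EG) g} (hv : v ∈ 𝒢.sourceTangent g) :
    ∃ c : ℝ → G, HasVelocity c g v ∧ ∀ᶠ t in 𝓝 0, 𝒢.src (c t) = 𝒢.src g :=
  exists_hasVelocity_of_isSubmersionAt (𝒢.submersion_src g) hv

theorem mem_sourceTangent {v : TangentSpace 𝓘(ℝ, EG) g} {c : ℝ → G}
    (hc : HasVelocity c g v) (hsrc : ∀ᶠ t in 𝓝 0, 𝒢.src (c t) = 𝒢.src g) :
    v ∈ 𝒢.sourceTangent g :=
  (hc.comp ((𝒢.submersion_src g).contMDiffAt.mdifferentiableAt (by simp))).unique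
    ((HasVelocity.const _).congr hsrc)

theorem hasVelocity_trg {v : TangentSpace 𝓘(ℝ, EG) g} {c : ℝ → G} (hc : HasVelocity c g v) :
    HasVelocity (fun t => 𝒢.trg (c t)) (𝒢.trg g) (mfderiv 𝓘(ℝ, EG) 𝓘(ℝ, EB) 𝒢.trg g v) :=
  hc.comp ((𝒢.submersion_trg g).contMDiffAt.mdifferentiableAt (by simp))

theorem hasVelocity_rightTranslate (hgh : 𝒢.src h = 𝒢.trg g) {v : TangentSpace 𝓘(ℝ, EG) h}
    {c : ℝ → G} (hc : HasVelocity c h v) (hsrc : ∀ᶠ t in 𝓝 0, 𝒢.src (c t) = 𝒢.src h) :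
    HasVelocity (fun t => 𝒢.mul (c t) g) (𝒢.mul h g) (𝒢.rightTranslate g h v) := by
  have hsmooth : ContMDiffWithinAt 𝓘(ℝ, EG) 𝓘(ℝ, EG) ∞ (fun h' => 𝒢.mul h' g)
      (𝒢.sourceFiber (𝒢.trg g)) h :=
    (𝒢.contMDiff_mul (h, g) hgh).comp (f := fun h' => (h', g)) h
      (contMDiffAt_id.prodMk contMDiffAt_const).contMDiffWithinAt fun _ hh' => hh'
  exact hc.comp_within (hsmooth.mdifferentiableWithinAt (by simp))
    (hsrc.mono fun _ ht => ht.trans hgh)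

namespace AlgebroidIdentification

variable {F : Type*} [NormedAddCommGroup F] [NormedSpace ℝ F]
  {A : B → Type*} [∀ x, AddCommGroup (A x)] [∀ x, Module ℝ (A x)]
  [∀ x, TopologicalSpace (A x)] [∀ x, IsTopologicalAddGroup (A x)]
  [∀ x, ContinuousSMul ℝ (A x)]
  [TopologicalSpace (TotalSpace F A)] [FiberBundle F A] [VectorBundle ℝ F A]
  {L : LieAlgebroid EB F A} (Φ : AlgebroidIdentification 𝒢 L)

/-- The right translate to `g` of the vector tangent to the source fibre at the identity of `trg g`
that corresponds to `a`; the inverse of `toAlgebroid g` on the tangent space of the source fibre. -/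
noncomputable def fromAlgebroid (g : G) (a : A (𝒢.trg g)) : TangentSpace 𝓘(ℝ, EG) g :=
  𝒢.one_mul g ▸ 𝒢.rightTranslate g (𝒢.one (𝒢.trg g)) (Φ.toFun (𝒢.trg g) a)

theorem hasVelocity_toAlgebroid {v : TangentSpace 𝓘(ℝ, EG) g} {c : ℝ → G}
    (hc : HasVelocity c g v) (hsrc : ∀ᶠ t in 𝓝 0, 𝒢.src (c t) = 𝒢.src g) :
    HasVelocity (fun t => 𝒢.mul (c t) (𝒢.inv g)) (𝒢.one (𝒢.trg g))
      (Φ.toFun (𝒢.trg g) (Φ.toAlgebroid g v)) := by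
  have htranslate := (hasVelocity_rightTranslate (𝒢.trg_inv g).symm hc hsrc).cast (𝒢.mul_inv g)
  have hmem : 𝒢.mul_inv g ▸ 𝒢.rightTranslate (𝒢.inv g) g v ∈ Set.range (Φ.toFun (𝒢.trg g)) := by
    rw [Φ.range_eq]
    exact mem_sourceTangent htranslate
      (hsrc.mono fun _ ht => (src_mul_inv ht).trans (𝒢.src_one _).symm)
  rw [toAlgebroid, Function.invFun_eq hmem]
  exact htranslate

theorem hasVelocity_fromAlgebroid {a : A (𝒢.trg g)} {c : ℝ → G}
    (hc : HasVelocity c (𝒢.one (𝒢.trg g)) (Φ.toFun (𝒢.trg g) a))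
    (hsrc : ∀ᶠ t in 𝓝 0, 𝒢.src (c t) = 𝒢.trg g) :
    HasVelocity (fun t => 𝒢.mul (c t) g) g (Φ.fromAlgebroid g a) :=
  (hasVelocity_rightTranslate (𝒢.src_one _) hc
    (hsrc.mono fun _ ht => ht.trans (𝒢.src_one _).symm)).cast (𝒢.one_mul g)

theorem exists_hasVelocity_toFun {x : B} (a : A x) :
    ∃ c : ℝ → G, HasVelocity c (𝒢.one x) (Φ.toFun x a) ∧ ∀ᶠ t in 𝓝 0, 𝒢.src (c t) = x := by
  have hmem : Φ.toFun x a ∈ (𝒢.sourceTangent (𝒢.one x) : Set _) := Φ.range_eq x ▸ mem_range_self a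
  simpa only [𝒢.src_one] using exists_hasVelocity (𝒢 := 𝒢) hmem

theorem fromAlgebroid_mem (g : G) (a : A (𝒢.trg g)) :
    Φ.fromAlgebroid g a ∈ 𝒢.sourceTangent g := by
  obtain ⟨c, hc, hsrc⟩ := Φ.exists_hasVelocity_toFun a
  exact mem_sourceTangent (Φ.hasVelocity_fromAlgebroid hc hsrc)
    (hsrc.mono fun _ ht => 𝒢.src_mul _ _ ht)

theorem toAlgebroid_fromAlgebroid (g : G) (a : A (𝒢.trg g)) :
    Φ.toAlgebroid g (Φ.fromAlgebroid g a) = a := by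
  obtain ⟨c, hc, hsrc⟩ := Φ.exists_hasVelocity_toFun a
  have hback := Φ.hasVelocity_toAlgebroid (Φ.hasVelocity_fromAlgebroid hc hsrc)
    (hsrc.mono fun _ ht => 𝒢.src_mul _ _ ht)
  exact Φ.injective _
    (hback.unique (hc.congr (hsrc.mono fun _ ht => mul_mul_inv_cancel ht)))

theorem fromAlgebroid_toAlgebroid {v : TangentSpace 𝓘(ℝ, EG) g} (hv : v ∈ 𝒢.sourceTangent g) :
    Φ.fromAlgebroid g (Φ.toAlgebroid g v) = v := by
  obtain ⟨c, hc, hsrc⟩ := exists_hasVelocity (𝒢 := 𝒢) hv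
  have hback := Φ.hasVelocity_fromAlgebroid (Φ.hasVelocity_toAlgebroid hc hsrc)
    (hsrc.mono fun _ ht => src_mul_inv ht)
  exact hback.unique (hc.congr (hsrc.mono fun _ ht => mul_inv_mul_cancel ht))

theorem bijOn_toAlgebroid (g : G) : BijOn (Φ.toAlgebroid g) (𝒢.sourceTangent g) univ :=
  InvOn.bijOn (f' := Φ.fromAlgebroid g)
    ⟨fun _ hv => Φ.fromAlgebroid_toAlgebroid hv, fun a _ => Φ.toAlgebroid_fromAlgebroid g a⟩
    (mapsTo_univ _ _) fun a _ => Φ.fromAlgebroid_mem g a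

theorem anchor_toAlgebroid {v : TangentSpace 𝓘(ℝ, EG) g} (hv : v ∈ 𝒢.sourceTangent g) :
    L.anchor (𝒢.trg g) (Φ.toAlgebroid g v) = mfderiv 𝓘(ℝ, EG) 𝓘(ℝ, EB) 𝒢.trg g v := by
  obtain ⟨c, hc, hsrc⟩ := exists_hasVelocity (𝒢 := 𝒢) hv
  have htranslate := hasVelocity_trg (𝒢 := 𝒢) (Φ.hasVelocity_toAlgebroid hc hsrc)
  rw [Φ.anchor_eq] at htranslate
  have hanchor := htranslate.cast (𝒢.trg_one _)
  rw [eqRec_eq_cast, eqRec_eq_cast, cast_cast, cast_eq] at hanchor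
  exact hanchor.unique ((hasVelocity_trg (𝒢 := 𝒢) hc).congr (hsrc.mono fun _ ht => trg_mul_inv ht))

variable {FD : Type*} [NormedAddCommGroup FD] [NormedSpace ℝ FD]
  {D : B → Type*} [∀ x, AddCommGroup (D x)] [∀ x, Module ℝ (D x)]
  [∀ x, TopologicalSpace (D x)]
  [TopologicalSpace (TotalSpace FD D)] [FiberBundle FD D] [VectorBundle ℝ FD D]
  {S : SmoothDual EB F A FD D} {I : InertiaOperator S}

theorem mem_horizontal_iff {v : TangentSpace 𝓘(ℝ, EG) g} :
    v ∈ Φ.horizontal I g ↔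
      v ∈ 𝒢.sourceTangent g ∧ Φ.toAlgebroid g v ∈ I.horizontal L (𝒢.trg g) := by
  refine and_congr_right fun _ => ⟨fun hv a ha => ?_, fun hv k hk hk0 => ?_⟩
  · obtain ⟨k, hk, rfl⟩ := (Φ.bijOn_toAlgebroid g).surjOn (mem_univ a)
    exact hv k hk (by rw [← Φ.anchor_toAlgebroid hk, ha])
  · exact hv _ (by rw [Φ.anchor_toAlgebroid hk, hk0])

theorem bijOn_toAlgebroid_horizontal (I : InertiaOperator S) (g : G) :
    BijOn (Φ.toAlgebroid g) (Φ.horizontal I g) (I.horizontal L (𝒢.trg g)) := by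
  refine ⟨fun v hv => (Φ.mem_horizontal_iff.1 hv).2,
    (Φ.bijOn_toAlgebroid g).injOn.mono fun v hv => hv.1, fun a ha => ?_⟩
  obtain ⟨v, hv, rfl⟩ := (Φ.bijOn_toAlgebroid g).surjOn (mem_univ a)
  exact ⟨v, Φ.mem_horizontal_iff.2 ⟨hv, ha⟩, rfl⟩

theorem bijOn_mfderiv_trg (hL : L.IsTransitive) (hI : I.IsPositive)
    (hdec : I.HasOrthogonalDecomposition L) (g : G) :
    BijOn (mfderiv 𝓘(ℝ, EG) 𝓘(ℝ, EB) 𝒢.trg g) (Φ.horizontal I g) univ :=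
  ((InertiaOperator.bijOn_anchor_horizontal hL hI hdec _).comp
    (Φ.bijOn_toAlgebroid_horizontal I g)).congr fun _ hv => Φ.anchor_toAlgebroid hv.1

theorem isRiemannianSubmersionTrg (hL : L.IsTransitive) (hI : I.IsPositive)
    (hdec : I.HasOrthogonalDecomposition L) {gB : RiemannMetric EB B}
    (hgB : I.InducesMetric L gB) (x : B) : Φ.IsRiemannianSubmersionTrg I gB x where
  contMDiffOn g _ := (𝒢.submersion_trg g).contMDiffAt.contMDiffWithinAt
  surjective g _ ζ := by
    obtain ⟨v, hv, hvζ⟩ := (Φ.bijOn_mfderiv_trg hL hI hdec g).surjOn (mem_univ ζ)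
    exact ⟨v, hv.1, hvζ⟩
  bijOn g _ := Φ.bijOn_mfderiv_trg hL hI hdec g
  isometry g _ v hv w hw := by
    rw [← Φ.anchor_toAlgebroid hv.1, ← Φ.anchor_toAlgebroid hw.1]
    exact InertiaOperator.form_anchor_anchor hL hI hdec hgB (Φ.mem_horizontal_iff.1 hv).2
      (Φ.mem_horizontal_iff.1 hw).2

end AlgebroidIdentification

end LieGroupoid

end GroupoidSubmersion

theorem mainTheorem11_general
    {EB : Type*} [NormedAddCommGroup EB] [NormedSpace ℝ EB] [CompleteSpace EB]
    {B : Type*} [TopologicalSpace B] [ChartedSpace EB B] [IsManifold 𝓘(ℝ, EB) ∞ B]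
    {F : Type*} [NormedAddCommGroup F] [NormedSpace ℝ F] [CompleteSpace F]
    {A : B → Type*} [∀ x, AddCommGroup (A x)] [∀ x, Module ℝ (A x)]
    [∀ x, TopologicalSpace (A x)] [∀ x, IsTopologicalAddGroup (A x)]
    [∀ x, ContinuousSMul ℝ (A x)]
    [TopologicalSpace (TotalSpace F A)] [FiberBundle F A] [VectorBundle ℝ F A]
    [ContMDiffVectorBundle ∞ F A 𝓘(ℝ, EB)]
    {FD : Type*} [NormedAddCommGroup FD] [NormedSpace ℝ FD]
    {D : B → Type*} [∀ x, AddCommGroup (D x)] [∀ x, Module ℝ (D x)]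
    [∀ x, TopologicalSpace (D x)]
    [TopologicalSpace (TotalSpace FD D)] [FiberBundle FD D] [VectorBundle ℝ FD D]
    [ContMDiffVectorBundle ∞ FD D 𝓘(ℝ, EB)]
    (L : LieAlgebroid EB F A) (hL : L.IsTransitive)
    (S : SmoothDual EB F A FD D)
    (I : InertiaOperator S) (hI : I.IsPositive) (hdec : I.HasOrthogonalDecomposition L) :
    ∃ gB : RiemannMetric EB B,
      I.InducesMetric L gB ∧
      (PreconnectedSpace B → ∀ ξ ∈ L.dualAnchorImage S,
        L.symplecticLeaf S ξ = L.dualAnchorImage S) ∧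
      (∀ (W : Set (TotalSpace FD D)) (h : TotalSpace FD D → ℝ) (J : Set ℝ)
        (γ : ℝ → TotalSpace FD D), IsOpen W → S.IsSmoothFunctionOn h W → IsOpen J →
        IsPreconnected J → (∀ t ∈ J, γ t ∈ W) → L.IsHamiltonianTrajectory S h γ J →
        (∃ t ∈ J, γ t ∈ L.dualAnchorImage S) → ∀ t ∈ J, γ t ∈ L.dualAnchorImage S) ∧
      (∀ (J : Set ℝ) (x : ℝ → B) (p : ∀ t, TangentSpace 𝓘(ℝ, EB) (x t) →L[ℝ] ℝ)
        (ξ : ∀ t, D (x t)), IsOpen J →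
        (∀ t ∈ J, ∀ a : A (x t), S.pairing (x t) (ξ t) a = p t (L.anchor (x t) a)) →
        (I.IsEulerArnoldTrajectory L (fun t => ⟨x t, ξ t⟩) J ↔
          gB.IsGeodesicFlowTrajectory x p J)) ∧
      (∀ x, BijOn (L.anchor x) (I.horizontal L x) univ ∧
        ∀ a ∈ I.horizontal L x, ∀ b ∈ I.horizontal L x,
          gB.form x (L.anchor x a) (L.anchor x b) = I.metric a b) ∧
      (∀ {EG : Type*} [NormedAddCommGroup EG] [NormedSpace ℝ EG]
        {G : Type*} [TopologicalSpace G] [ChartedSpace EG G] [IsManifold 𝓘(ℝ, EG) ∞ G]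
        (𝒢 : LieGroupoid EB B EG G) (Φ : LieGroupoid.AlgebroidIdentification 𝒢 L) (x : B),
        Φ.IsRiemannianSubmersionTrg I gB x) := by
  obtain ⟨gB, hgB⟩ := InertiaOperator.exists_inducesMetric hL hI hdec
  refine ⟨gB, hgB, fun _ ξ hξ => ?leaf, ?stays, fun J x p ξ hJ hξ => ?geodesicFlow,
    fun x => ⟨?anchorBijOn, fun a ha b hb => ?anchorIsometry⟩, fun 𝒢 Φ x => ?submersion⟩
  case leaf => exact InertiaOperator.symplecticLeaf_eq_dualAnchorImage hL hI hdec hξ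
  case stays =>
    rintro W h J γ hW hh hJ hJ_conn hγW hγ ⟨s, hs, hγs⟩ t ht
    exact InertiaOperator.mem_dualAnchorImage_of_isHamiltonianTrajectory hL hI hdec hW hh hJ hγW hγ
      subset_rfl hJ_conn hs ht hγs
  case geodesicFlow =>
    exact InertiaOperator.isEulerArnoldTrajectory_iff_isGeodesicFlowTrajectory hL hI hdec hgB hJ hξ
  case anchorBijOn => exact InertiaOperator.bijOn_anchor_horizontal hL hI hdec x
  case anchorIsometry => exact InertiaOperator.form_anchor_anchor hL hI hdec hgB ha hb
  case submersion => exact Φ.isRiemannianSubmersionTrg hL hI hdec hgB x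

theorem mainTheorem11
    {EB : Type*} [NormedAddCommGroup EB] [NormedSpace ℝ EB] [CompleteSpace EB]
    {B : Type*} [TopologicalSpace B] [ChartedSpace EB B] [IsManifold 𝓘(ℝ, EB) ∞ B]
    {F : Type*} [NormedAddCommGroup F] [NormedSpace ℝ F] [CompleteSpace F]
    {A : B → Type*} [∀ x, AddCommGroup (A x)] [∀ x, Module ℝ (A x)]
    [∀ x, TopologicalSpace (A x)] [∀ x, IsTopologicalAddGroup (A x)]
    [∀ x, ContinuousSMul ℝ (A x)]
    [TopologicalSpace (TotalSpace F A)] [FiberBundle F A] [VectorBundle ℝ F A]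
    [ContMDiffVectorBundle ∞ F A 𝓘(ℝ, EB)]
    {FD : Type*} [NormedAddCommGroup FD] [NormedSpace ℝ FD] [CompleteSpace FD]
    {D : B → Type*} [∀ x, AddCommGroup (D x)] [∀ x, Module ℝ (D x)]
    [∀ x, TopologicalSpace (D x)]
    [TopologicalSpace (TotalSpace FD D)] [FiberBundle FD D] [VectorBundle ℝ FD D]
    [ContMDiffVectorBundle ∞ FD D 𝓘(ℝ, EB)]
    (L : LieAlgebroid EB F A) (hL : L.IsTransitive)
    (S : SmoothDual EB F A FD D)
    (I : InertiaOperator S) (hI : I.IsPositive) (hdec : I.HasOrthogonalDecomposition L) :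
    ∃ gB : RiemannMetric EB B,
      (∀ x (ζ η : TangentSpace 𝓘(ℝ, EB) x),
        gB.form x ζ η = I.metric (I.anchorInv L x ζ) (I.anchorInv L x η)) ∧
      (PreconnectedSpace B → ∀ ξ ∈ L.dualAnchorImage S,
        L.symplecticLeaf S ξ = L.dualAnchorImage S) ∧
      (∀ (J : Set ℝ) (γ : ℝ → TotalSpace FD D), IsOpen J → IsPreconnected J →
        I.IsEulerArnoldTrajectory L γ J → (∃ t ∈ J, γ t ∈ L.dualAnchorImage S) →
        ∀ t ∈ J, γ t ∈ L.dualAnchorImage S) ∧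
      (∀ (J : Set ℝ) (x : ℝ → B) (p : ∀ t, TangentSpace 𝓘(ℝ, EB) (x t) →L[ℝ] ℝ)
        (ξ : ∀ t, D (x t)), IsOpen J →
        (∀ t ∈ J, ∀ a : A (x t), S.pairing (x t) (ξ t) a = p t (L.anchor (x t) a)) →
        (I.IsEulerArnoldTrajectory L (fun t => ⟨x t, ξ t⟩) J ↔
          gB.IsGeodesicFlowTrajectory x p J)) ∧
      (∀ x, BijOn (L.anchor x) (I.horizontal L x) univ ∧
        ∀ a ∈ I.horizontal L x, ∀ b ∈ I.horizontal L x,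
          gB.form x (L.anchor x a) (L.anchor x b) = I.metric a b) ∧
      (∀ {EG : Type*} [NormedAddCommGroup EG] [NormedSpace ℝ EG] [CompleteSpace EG]
        {G : Type*} [TopologicalSpace G] [ChartedSpace EG G] [IsManifold 𝓘(ℝ, EG) ∞ G]
        (𝒢 : LieGroupoid EB B EG G), 𝒢.IsTransitive →
        ∀ (Φ : LieGroupoid.AlgebroidIdentification 𝒢 L) (x : B),
          Φ.IsRiemannianSubmersionTrg I gB x) := by
  obtain ⟨gB, hgB, hleaf, hstays, hflow, hanchor, htrg⟩ :=
    mainTheorem11_general L hL S I hI hdec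
  exact ⟨gB, hgB, hleaf, fun J γ hJ hJ_conn hγ => hstays univ I.hamiltonian J γ isOpen_univ
    I.isSmoothFunctionOn_hamiltonian hJ hJ_conn (fun _ _ => mem_univ _) hγ, hflow, hanchor,
    fun 𝒢 _ Φ x => htrg 𝒢 Φ x⟩
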